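/- Let $a<0<b$, let $U\in C^\infty([a,b])$ be real valued, let $\alpha,\beta,\gamma_1,\gamma_2\in\mathbb R$, and let $\Psi,\Phi,\Upsilon_1,\Upsilon_2\in C^\infty(\mathbb R)$ be real valued with supports in $[-1,1]$. For $\varepsilon>0$ let $\mathcal S_\varepsilon$ be the operator in $L_2(a,b)$ $$\mathcal S_\varepsilon=\frac{d^4}{dx^4}+U(x)+\alpha\varepsilon^{-4}\Psi\Big(\frac x\varepsilon\Big)+\beta\varepsilon^{-3}\Phi\Big(\frac x\varepsilon\Big)+\gamma_1\varepsilon^{-2}\Upsilon_1\Big(\frac x\varepsilon\Big)+\gamma_2\varepsilon^{-1}\Upsilon_2\Big(\frac x\varepsilon\Big)$$ with domain $\{f\in W_2^4(a,b): f(a)=f'(a)=f(b)=f'(b)=0\}$, and let $\lambda_1^\varepsilon\le\lambda_2^\varepsilon\le\dots$ be its eigenvalues, enumerated in increasing order with multiplicity taken into account. The resonant set $\Sigma_\Psi$ is the set of real $\alpha$ for which the problem $$w^{(4)}+\alpha\Psi w=0\ \text{ on } (-1,1),\qquad w''(\pm1)=w'''(\pm1)=0$$ has a nontrivial solution. Assume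 that, if $\alpha\in\Sigma_\Psi$, then the space of solutions is one-dimensional and $w_\alpha'(-1)\,w_\alpha'(1)\ne0$ for a nontrivial solution $w_\alpha$; in this case put $\theta=w_\alpha'(1)/w_\alpha'(-1)$ and $\vartheta=\int_{-1}^1\Phi(\xi)\big(w_\alpha(\xi)/w_\alpha'(-1)\big)^2d\xi$. Let $\mathcal S_{\alpha,\beta}(\Psi,\Phi)$ be the operator in $L_2(a,b)$ acting by $f\mapsto f^{(4)}+Uf$ on $(a,0)\cup(0,b)$, with domain the set of $f\in W_2^4((a,0)\cup(0,b))$ such that $f(a)=f'(a)=f(b)=f'(b)=0$ and, at the origin, - $f(\pm0)=f'(\pm0)=0$, if $\alpha\notin\Sigma_\Psi$; - $f(\pm0)=0$, $\ f'(+0)=\theta f'(-0)$, $\ \theta f''(+0)-f''(-0)=\beta\,\vartheta f'(-0)$, if $\alpha\in\Sigma_\Psi$. Suppose that $\lambda$ is a simple eigenvalue of $\mathcal S_{\alpha,\beta}(\Psi,\Phi)$ with eigenfunction $v$, $\|v\|=1$, where $\|\cdot\|$ is the norm of $L_2(a,b)$. Then there exist an index $j$ and constants $c_1,c_2,\varepsilon_0>0$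 such that for every $\varepsilon\in(0,\varepsilon_0)$ the eigenvalue $\lambda_j^\varepsilon$ of $\mathcal S_\varepsilon$ is simple and has an eigenfunction $y_j^\varepsilon$ with $\|y_j^\varepsilon\|=1$, $$|\lambda_j^\varepsilon-\lambda|\le c_1\varepsilon,\qquad \|y_j^\varepsilon-v\|\le c_2\varepsilon .$$ -/

import Mathlib

open MeasureTheory Set
open scoped ContDiff

namespace FourthOrder

noncomputable section

/-- The complex Hilbert space `L₂(a, b)`. -/
abbrev L2 (a b : ℝ) : Type := Lp ℂ 2 (volume.restrict (Ioo a b))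

/-! ### Eigenvalues of unbounded operators -/

/-- The eigenspace `ker (A - μ)` of a partially defined operator. -/
def eigenspace {H : Type*} [AddCommGroup H] [Module ℂ H] (A : H →ₗ.[ℂ] H) (μ : ℝ) :
    Submodule ℂ H where
  carrier := {u | (u, (μ : ℂ) • u) ∈ A.graph}
  zero_mem' := by
    simp only [mem_ofPred_eq, smul_zero]
    exact A.graph.zero_mem
  add_mem' := by
    intro u v hu hv
    simpa using A.graph.add_mem hu hv
  smul_mem' := by
    intro c u hu
    have := A.graph.smul_mem c hu
    simpa [smul_comm c] using this

/-- `μ` is a simple eigenvalue of `A`: its eigenspace is one-dimensional. -/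
def IsSimpleEigenvalue {H : Type*} [AddCommGroup H] [Module ℂ H] (A : H →ₗ.[ℂ] H) (μ : ℝ) :
    Prop :=
  Module.finrank ℂ (eigenspace A μ) = 1

/-- `u` is a normalized eigenfunction of `A` for the eigenvalue `μ`. -/
def IsNormalizedEigenfunction {H : Type*} [NormedAddCommGroup H] [Module ℂ H]
    (A : H →ₗ.[ℂ] H) (μ : ℝ) (u : H) : Prop :=
  (∃ hu : u ∈ A.domain, A ⟨u, hu⟩ = (μ : ℂ) • u) ∧ ‖u‖ = 1

/-- `μ` is the `k`-th eigenvalue of `A` (`k = 1, 2, …`) when the eigenvalues are enumerated in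
increasing order with multiplicity taken into account: fewer than `k` eigenvalues lie strictly
below `μ`, and at least `k` of them are `≤ μ`. -/
def IsKthEigenvalue {H : Type*} [AddCommGroup H] [Module ℂ H] (A : H →ₗ.[ℂ] H) (k : ℕ) (μ : ℝ) :
    Prop :=
  eigenspace A μ ≠ ⊥ ∧
  Module.rank ℂ (⨆ (ν : ℝ) (_ : ν < μ), eigenspace A ν : Submodule ℂ H) < (k : Cardinal) ∧
  (k : Cardinal) ≤ Module.rank ℂ (⨆ (ν : ℝ) (_ : ν ≤ μ), eigenspace A ν : Submodule ℂ H)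

/-! ### The Sobolev space `W₂⁴` on an interval -/

/-- `d 0` is (the continuous representative of) a function in `W₂⁴(p, q)` with derivatives
`d 1, …, d 4`: each `d j`, `j < 4`, is absolutely continuous on `[p, q]` with derivative
`d (j + 1)`, and `d 4 ∈ L₂(p, q)`.  The values of `d j`, `j < 4`, at `p` and `q` are the boundary
values (traces) of the `j`-th derivative. -/
structure IsSobolevJet (p q : ℝ) (d : ℕ → ℝ → ℂ) : Prop where
  ftc : ∀ j < 4, ∀ x ∈ Icc p q, d j x = d j p + ∫ t in p..x, d (j + 1) t
  memLp : MemLp (d 4) 2 (volume.restrict (Ioo p q))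

/-- On `(p, q)` the function `u` is in `W₂⁴(p, q)`, with derivatives `d j`, and
`h = u'''' + V u` almost everywhere. -/
structure Realizes (p q : ℝ) (V : ℝ → ℝ) (d : ℕ → ℝ → ℂ) (u h : ℝ → ℂ) : Prop where
  jet : IsSobolevJet p q d
  eq_zero : u =ᵐ[volume.restrict (Ioo p q)] d 0
  eq_op : h =ᵐ[volume.restrict (Ioo p q)] fun x => d 4 x + (V x : ℂ) * d 0 x

theorem intervalIntegrable_of_jet {p q : ℝ} {d : ℕ → ℝ → ℂ} (hpq : p ≤ q)
    (hd : IsSobolevJet p q d) :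
    ∀ j ≤ 4, IntervalIntegrable (d j) volume p q := by
  have step : ∀ j < 4, IntervalIntegrable (d (j + 1)) volume p q →
      IntervalIntegrable (d j) volume p q := by
    intro j hj hi
    have hc : ContinuousOn (fun x => d j p + ∫ t in p..x, d (j + 1) t) (Icc p q) := by
      have := intervalIntegral.continuousOn_primitive_interval' hi left_mem_uIcc
      rw [uIcc_of_le hpq] at this
      exact continuousOn_const.add this
    have hc' : ContinuousOn (d j) (Icc p q) := hc.congr (hd.ftc j hj)
    exact ContinuousOn.intervalIntegrable (by rwa [uIcc_of_le hpq])
  have h4 : IntervalIntegrable (d 4) volume p q := by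
    rw [intervalIntegrable_iff_integrableOn_Ioo_of_le hpq]
    exact hd.memLp.integrable (by norm_num)
  have h3 := step 3 (by norm_num) h4
  have h2 := step 2 (by norm_num) h3
  have h1 := step 1 (by norm_num) h2
  have h0 := step 0 (by norm_num) h1
  intro j hj
  interval_cases j <;> assumption

theorem ae_eq_zero_of_primitive {p q : ℝ} {f g : ℝ → ℂ} (hpq : p ≤ q)
    (hg : IntervalIntegrable g volume p q)
    (h : ∀ x ∈ Icc p q, f x = f p + ∫ t in p..x, g t)
    (hf : f =ᵐ[volume.restrict (Ioo p q)] 0) :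
    g =ᵐ[volume.restrict (Ioo p q)] 0 := by
  have hc : ContinuousOn f (Icc p q) := by
    have := intervalIntegral.continuousOn_primitive_interval' hg left_mem_uIcc
    rw [uIcc_of_le hpq] at this
    exact (continuousOn_const.add this).congr h
  have hz : EqOn f 0 (Ioo p q) :=
    Measure.eqOn_open_of_ae_eq hf isOpen_Ioo (hc.mono Ioo_subset_Icc_self) continuousOn_const
  have hD := hg.ae_hasDerivAt_integral
  refine (ae_restrict_iff' measurableSet_Ioo).2 ?_
  filter_upwards [hD] with x hx hxI
  have hx' : x ∈ uIcc p q := by rw [uIcc_of_le hpq]; exact Ioo_subset_Icc_self hxI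
  have h1 := hx hx' p left_mem_uIcc
  have h2 : HasDerivAt (fun x => ∫ t in p..x, g t) 0 x := by
    refine (hasDerivAt_const x (-f p)).congr_of_eventuallyEq ?_
    filter_upwards [isOpen_Ioo.mem_nhds hxI] with y hy
    have e1 := h y (Ioo_subset_Icc_self hy)
    have e2 : f y = 0 := hz hy
    rw [e2] at e1
    exact eq_neg_of_add_eq_zero_right e1.symm
  exact h1.unique h2

theorem Realizes.eq_zero_of_eq_zero {p q : ℝ} {V : ℝ → ℝ} {d : ℕ → ℝ → ℂ} {u h : ℝ → ℂ}
    (hpq : p ≤ q) (H : Realizes p q V d u h) (hu : u =ᵐ[volume.restrict (Ioo p q)] 0) :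
    h =ᵐ[volume.restrict (Ioo p q)] 0 := by
  have hi := intervalIntegrable_of_jet hpq H.jet
  have h0 : d 0 =ᵐ[volume.restrict (Ioo p q)] 0 := H.eq_zero.symm.trans hu
  have h1 := ae_eq_zero_of_primitive hpq (hi 1 (by norm_num)) (H.jet.ftc 0 (by norm_num)) h0
  have h2 := ae_eq_zero_of_primitive hpq (hi 2 (by norm_num)) (H.jet.ftc 1 (by norm_num)) h1
  have h3 := ae_eq_zero_of_primitive hpq (hi 3 (by norm_num)) (H.jet.ftc 2 (by norm_num)) h2
  have h4 := ae_eq_zero_of_primitive hpq (hi 4 (by norm_num)) (H.jet.ftc 3 (by norm_num)) h3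
  filter_upwards [H.eq_op, h0, h4] with x hx hx0 hx4
  simp [hx, hx0, hx4]

theorem Realizes.zero {p q : ℝ} {V : ℝ → ℝ} : Realizes p q V 0 0 0 where
  jet := ⟨by simp, by simp⟩
  eq_zero := Filter.EventuallyEq.rfl
  eq_op := Filter.Eventually.of_forall (by simp)

theorem Realizes.add {p q : ℝ} {V : ℝ → ℝ} {d d' : ℕ → ℝ → ℂ} {u u' h h' : ℝ → ℂ} (hpq : p ≤ q)
    (H : Realizes p q V d u h) (H' : Realizes p q V d' u' h') :
    Realizes p q V (d + d') (u + u') (h + h') where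
  jet := by
    refine ⟨fun j hj x hx => ?_, H.jet.memLp.add H'.jet.memLp⟩
    have hsub : uIcc p x ⊆ uIcc p q := by
      rw [uIcc_of_le hpq, uIcc_of_le hx.1]
      exact Icc_subset_Icc_right hx.2
    have i1 := (intervalIntegrable_of_jet hpq H.jet (j + 1) hj).mono_set hsub
    have i2 := (intervalIntegrable_of_jet hpq H'.jet (j + 1) hj).mono_set hsub
    have e1 := H.jet.ftc j hj x hx
    have e2 := H'.jet.ftc j hj x hx
    simp only [Pi.add_apply]
    rw [intervalIntegral.integral_add i1 i2, e1, e2]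
    ring
  eq_zero := H.eq_zero.add H'.eq_zero
  eq_op := by
    filter_upwards [H.eq_op, H'.eq_op] with x h1 h2
    simp only [Pi.add_apply, h1, h2]
    ring

theorem Realizes.smul {p q : ℝ} {V : ℝ → ℝ} {d : ℕ → ℝ → ℂ} {u h : ℝ → ℂ} (c : ℂ)
    (H : Realizes p q V d u h) : Realizes p q V (c • d) (c • u) (c • h) where
  jet := by
    refine ⟨fun j hj x hx => ?_, H.jet.memLp.const_smul c⟩
    have e1 := H.jet.ftc j hj x hx
    simp only [Pi.smul_apply, smul_eq_mul]
    rw [intervalIntegral.integral_const_mul, e1]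
    ring
  eq_zero := H.eq_zero.const_smul c
  eq_op := by
    filter_upwards [H.eq_op] with x h1
    simp only [Pi.smul_apply, h1, smul_eq_mul]
    ring

theorem Realizes.congr {p q : ℝ} {V : ℝ → ℝ} {d : ℕ → ℝ → ℂ} {u h u' h' : ℝ → ℂ}
    (H : Realizes p q V d u h) (hu : u' =ᵐ[volume.restrict (Ioo p q)] u)
    (hh : h' =ᵐ[volume.restrict (Ioo p q)] h) : Realizes p q V d u' h' :=
  ⟨H.jet, hu.trans H.eq_zero, hh.trans H.eq_op⟩

/-! ### The operators `S_ε` -/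

/-- Graph of `d⁴/dx⁴ + V` in `L₂(a, b)` with domain
`{f ∈ W₂⁴(a, b) : f(a) = f'(a) = 0, f(b) = f'(b) = 0}`. -/
def dirichletGraph (a b : ℝ) (hab : a ≤ b) (V : ℝ → ℝ) : Submodule ℂ (L2 a b × L2 a b) where
  carrier := {g | ∃ d : ℕ → ℝ → ℂ, Realizes a b V d g.1 g.2 ∧
    d 0 a = 0 ∧ d 1 a = 0 ∧ d 0 b = 0 ∧ d 1 b = 0}
  zero_mem' := ⟨0, Realizes.zero.congr (Lp.coeFn_zero _ _ _) (Lp.coeFn_zero _ _ _),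
    by simp⟩
  add_mem' := by
    rintro g g' ⟨d, hd, h1, h2, h3, h4⟩ ⟨d', hd', h1', h2', h3', h4'⟩
    exact ⟨d + d', (hd.add hab hd').congr (Lp.coeFn_add _ _) (Lp.coeFn_add _ _),
      by simp [h1, h1'], by simp [h2, h2'], by simp [h3, h3'], by simp [h4, h4']⟩
  smul_mem' := by
    rintro c g ⟨d, hd, h1, h2, h3, h4⟩
    exact ⟨c • d, (hd.smul c).congr (Lp.coeFn_smul _ _) (Lp.coeFn_smul _ _),
      by simp [h1], by simp [h2], by simp [h3], by simp [h4]⟩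

/-- The graph is single-valued, so it is the graph of the operator below. -/
theorem dirichletGraph_single {a b : ℝ} (hab : a ≤ b) (V : ℝ → ℝ) :
    ∀ g ∈ dirichletGraph a b hab V, g.1 = 0 → g.2 = 0 := by
  rintro g ⟨d, hd, -⟩ h0
  apply (Lp.eq_zero_iff_ae_eq_zero).2
  exact hd.eq_zero_of_eq_zero hab ((Lp.eq_zero_iff_ae_eq_zero).1 h0)

/-- The operator `d⁴/dx⁴ + V` in `L₂(a, b)` with Dirichlet conditions
`f(a) = f'(a) = f(b) = f'(b) = 0`. -/
def dirichletOperator (a b : ℝ) (hab : a ≤ b) (V : ℝ → ℝ) : L2 a b →ₗ.[ℂ] L2 a b :=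
  (dirichletGraph a b hab V).toLinearPMap

theorem dirichletOperator_graph {a b : ℝ} (hab : a ≤ b) (V : ℝ → ℝ) :
    (dirichletOperator a b hab V).graph = dirichletGraph a b hab V :=
  Submodule.toLinearPMap_graph_eq _ (dirichletGraph_single hab V)

/-- `Ψ_ε(x) = α ε⁻⁴ Ψ(x/ε) + β ε⁻³ Φ(x/ε) + γ₁ ε⁻² Υ₁(x/ε) + γ₂ ε⁻¹ Υ₂(x/ε)`. -/
def regularization (α β γ₁ γ₂ : ℝ) (Ψ Φ Υ₁ Υ₂ : ℝ → ℝ) (ε x : ℝ) : ℝ :=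
  α * (ε ^ 4)⁻¹ * Ψ (x / ε) + β * (ε ^ 3)⁻¹ * Φ (x / ε) + γ₁ * (ε ^ 2)⁻¹ * Υ₁ (x / ε)
    + γ₂ * ε⁻¹ * Υ₂ (x / ε)

/-- The operator `S_ε = d⁴/dx⁴ + U + Ψ_ε` with Dirichlet conditions at `a` and `b`. -/
def perturbedOperator (a b : ℝ) (hab : a ≤ b) (U : ℝ → ℝ) (α β γ₁ γ₂ : ℝ)
    (Ψ Φ Υ₁ Υ₂ : ℝ → ℝ) (ε : ℝ) : L2 a b →ₗ.[ℂ] L2 a b :=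
  dirichletOperator a b hab fun x => U x + regularization α β γ₁ γ₂ Ψ Φ Υ₁ Υ₂ ε x

/-! ### The resonant set -/

/-- `w 0` is a solution, with derivatives `w 1, …, w 4`, of `w'''' + α Ψ w = 0` on `[-1, 1]`,
`w''(±1) = w'''(±1) = 0`. -/
structure IsResonanceSolution (α : ℝ) (Ψ : ℝ → ℝ) (w : ℕ → ℝ → ℂ) : Prop where
  hasDeriv : ∀ j < 4, ∀ ξ ∈ Icc (-1 : ℝ) 1,
    HasDerivWithinAt (w j) (w (j + 1) ξ) (Icc (-1 : ℝ) 1) ξ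
  eqn : ∀ ξ ∈ Icc (-1 : ℝ) 1, w 4 ξ + (α : ℂ) * (Ψ ξ : ℂ) * w 0 ξ = 0
  bc_left : w 2 (-1) = 0 ∧ w 3 (-1) = 0
  bc_right : w 2 1 = 0 ∧ w 3 1 = 0

/-- `w` is an eigenfunction: a solution that does not vanish identically on `[-1, 1]`. -/
def IsResonanceEigenfunction (α : ℝ) (Ψ : ℝ → ℝ) (w : ℕ → ℝ → ℂ) : Prop :=
  IsResonanceSolution α Ψ w ∧ ∃ ξ ∈ Icc (-1 : ℝ) 1, w 0 ξ ≠ 0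

/-- The resonant set `Σ_Ψ`. -/
def resonantSet (Ψ : ℝ → ℝ) : Set ℝ := {α | ∃ w, IsResonanceEigenfunction α Ψ w}

/-- Nondegeneracy of the resonance: `α` is a simple eigenvalue (any two eigenfunctions are
proportional), and `w'(-1) w'(1) ≠ 0` for the eigenfunctions. -/
def NondegenerateResonance (α : ℝ) (Ψ : ℝ → ℝ) : Prop :=
  (∀ w w', IsResonanceEigenfunction α Ψ w → IsResonanceEigenfunction α Ψ w' →
    ∃ c : ℂ, ∀ ξ ∈ Icc (-1 : ℝ) 1, w' 0 ξ = c * w 0 ξ) ∧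
  ∀ w, IsResonanceEigenfunction α Ψ w → w 1 (-1) * w 1 1 ≠ 0

/-- `θ_Ψ(α) = w'(1) / w'(-1)` for an eigenfunction `w`. -/
def theta (w : ℕ → ℝ → ℂ) : ℂ := w 1 1 / w 1 (-1)

/-- The functional `ϑ_Φ[f] = ∫_{-1}^{1} Φ f² dξ`. -/
def vartheta (Φ : ℝ → ℝ) (f : ℝ → ℂ) : ℂ := ∫ ξ in (-1 : ℝ)..1, (Φ ξ : ℂ) * f ξ ^ 2

/-! ### The limit operator -/

/-- A pair of functions on `(a, 0)` and `(0, b)`, given with their derivatives, satisfies the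
Dirichlet conditions at `a` and `b`. -/
def OuterConditions (a b : ℝ) (l r : ℕ → ℝ → ℂ) : Prop :=
  l 0 a = 0 ∧ l 1 a = 0 ∧ r 0 b = 0 ∧ r 1 b = 0

/-- `f(±0) = f'(±0) = 0`. -/
def DecoupledConditions (l r : ℕ → ℝ → ℂ) : Prop :=
  l 0 0 = 0 ∧ l 1 0 = 0 ∧ r 0 0 = 0 ∧ r 1 0 = 0

/-- `f(±0) = 0`, `f'(+0) - θ f'(-0) = 0` and
`θ f''(+0) - f''(-0) - β ϑ_Φ[w / w'(-1)] f'(-0) = 0`, where `w` is an eigenfunction of the resonance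
problem.  For a nondegenerate resonance `θ` and `ϑ_Φ[w / w'(-1)]` are the same for all
eigenfunctions `w`. -/
def CouplingConditions (α β : ℝ) (Ψ Φ : ℝ → ℝ) (l r : ℕ → ℝ → ℂ) : Prop :=
  l 0 0 = 0 ∧ r 0 0 = 0 ∧ ∀ w, IsResonanceEigenfunction α Ψ w →
    r 1 0 - theta w * l 1 0 = 0 ∧
    theta w * r 2 0 - l 2 0 - β * vartheta Φ (fun ξ => w 0 ξ / w 1 (-1)) * l 1 0 = 0

open Classical in
/-- The interface conditions at the origin of the limit operator. -/
def InterfaceConditions (α β : ℝ) (Ψ Φ : ℝ → ℝ) (l r : ℕ → ℝ → ℂ) : Prop :=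
  if α ∈ resonantSet Ψ then CouplingConditions α β Ψ Φ l r else DecoupledConditions l r

theorem InterfaceConditions.zero {α β : ℝ} {Ψ Φ : ℝ → ℝ} : InterfaceConditions α β Ψ Φ 0 0 := by
  unfold InterfaceConditions
  split_ifs
  · exact ⟨by simp, by simp, by simp⟩
  · simp [DecoupledConditions]

theorem InterfaceConditions.add {α β : ℝ} {Ψ Φ : ℝ → ℝ} {l r l' r' : ℕ → ℝ → ℂ}
    (h : InterfaceConditions α β Ψ Φ l r) (h' : InterfaceConditions α β Ψ Φ l' r') :
    InterfaceConditions α β Ψ Φ (l + l') (r + r') := by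
  unfold InterfaceConditions at *
  split_ifs at *
  · obtain ⟨h1, h2, h3⟩ := h
    obtain ⟨h1', h2', h3'⟩ := h'
    refine ⟨by simp [h1, h1'], by simp [h2, h2'], fun w hw => ?_⟩
    obtain ⟨e1, e2⟩ := h3 w hw
    obtain ⟨e1', e2'⟩ := h3' w hw
    simp only [Pi.add_apply]
    exact ⟨by linear_combination e1 + e1', by linear_combination e2 + e2'⟩
  · obtain ⟨h1, h2, h3, h4⟩ := h
    obtain ⟨h1', h2', h3', h4'⟩ := h'
    simp [DecoupledConditions, *]

theorem InterfaceConditions.smul {α β : ℝ} {Ψ Φ : ℝ → ℝ} {l r : ℕ → ℝ → ℂ} (c : ℂ)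
    (h : InterfaceConditions α β Ψ Φ l r) : InterfaceConditions α β Ψ Φ (c • l) (c • r) := by
  unfold InterfaceConditions at *
  split_ifs at *
  · obtain ⟨h1, h2, h3⟩ := h
    refine ⟨by simp [h1], by simp [h2], fun w hw => ?_⟩
    obtain ⟨e1, e2⟩ := h3 w hw
    simp only [Pi.smul_apply, smul_eq_mul]
    exact ⟨by linear_combination c * e1, by linear_combination c * e2⟩
  · obtain ⟨h1, h2, h3, h4⟩ := h
    simp [DecoupledConditions, *]

/-- The graph in `L₂(a, b)` of the limit operator `S_{α,β}(Ψ, Φ) f = f'''' + U f`, with domain the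
functions in `W₂⁴((a, 0) ∪ (0, b))` that satisfy the Dirichlet conditions at `a`, `b` and the
interface conditions at the origin; `l` and `r` are the restrictions of `f` to `(a, 0)` and
`(0, b)`, with their derivatives. -/
def limitGraph (a b : ℝ) (ha : a < 0) (hb : 0 < b) (U : ℝ → ℝ) (α β : ℝ) (Ψ Φ : ℝ → ℝ) :
    Submodule ℂ (L2 a b × L2 a b) where
  carrier := {g | ∃ l r : ℕ → ℝ → ℂ, Realizes a 0 U l g.1 g.2 ∧ Realizes 0 b U r g.1 g.2 ∧
    OuterConditions a b l r ∧ InterfaceConditions α β Ψ Φ l r}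
  zero_mem' := by
    have hl : volume.restrict (Ioo a 0) ≤ volume.restrict (Ioo a b) :=
      Measure.restrict_mono (Ioo_subset_Ioo_right hb.le) le_rfl
    have hr : volume.restrict (Ioo 0 b) ≤ volume.restrict (Ioo a b) :=
      Measure.restrict_mono (Ioo_subset_Ioo_left ha.le) le_rfl
    have h0 := Lp.coeFn_zero ℂ 2 (volume.restrict (Ioo a b))
    exact ⟨0, 0, Realizes.zero.congr (ae_mono hl h0) (ae_mono hl h0),
      Realizes.zero.congr (ae_mono hr h0) (ae_mono hr h0),
      by simp [OuterConditions], InterfaceConditions.zero⟩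
  add_mem' := by
    have hl : volume.restrict (Ioo a 0) ≤ volume.restrict (Ioo a b) :=
      Measure.restrict_mono (Ioo_subset_Ioo_right hb.le) le_rfl
    have hr : volume.restrict (Ioo 0 b) ≤ volume.restrict (Ioo a b) :=
      Measure.restrict_mono (Ioo_subset_Ioo_left ha.le) le_rfl
    rintro g g' ⟨l, r, h1, h2, ⟨o1, o2, o3, o4⟩, h4⟩ ⟨l', r', h1', h2', ⟨p1, p2, p3, p4⟩, h4'⟩
    have e1 := Lp.coeFn_add g.1 g'.1
    have e2 := Lp.coeFn_add g.2 g'.2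
    exact ⟨l + l', r + r', (h1.add ha.le h1').congr (ae_mono hl e1) (ae_mono hl e2),
      (h2.add hb.le h2').congr (ae_mono hr e1) (ae_mono hr e2),
      by simp [OuterConditions, *], h4.add h4'⟩
  smul_mem' := by
    have hl : volume.restrict (Ioo a 0) ≤ volume.restrict (Ioo a b) :=
      Measure.restrict_mono (Ioo_subset_Ioo_right hb.le) le_rfl
    have hr : volume.restrict (Ioo 0 b) ≤ volume.restrict (Ioo a b) :=
      Measure.restrict_mono (Ioo_subset_Ioo_left ha.le) le_rfl
    rintro c g ⟨l, r, h1, h2, ⟨o1, o2, o3, o4⟩, h4⟩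
    have e1 := Lp.coeFn_smul c g.1
    have e2 := Lp.coeFn_smul c g.2
    exact ⟨c • l, c • r, (h1.smul c).congr (ae_mono hl e1) (ae_mono hl e2),
      (h2.smul c).congr (ae_mono hr e1) (ae_mono hr e2),
      by simp [OuterConditions, *], h4.smul c⟩

/-- The graph is single-valued, so it is the graph of the operator below. -/
theorem limitGraph_single {a b : ℝ} (ha : a < 0) (hb : 0 < b) (U : ℝ → ℝ) (α β : ℝ)
    (Ψ Φ : ℝ → ℝ) : ∀ g ∈ limitGraph a b ha hb U α β Ψ Φ, g.1 = 0 → g.2 = 0 := by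
  rintro g ⟨l, r, hl, hr, -⟩ h0
  have h0' := (Lp.eq_zero_iff_ae_eq_zero).1 h0
  apply (Lp.eq_zero_iff_ae_eq_zero).2
  have el := hl.eq_zero_of_eq_zero ha.le (ae_mono
    (Measure.restrict_mono (Ioo_subset_Ioo_right hb.le) le_rfl) h0')
  have er := hr.eq_zero_of_eq_zero hb.le (ae_mono
    (Measure.restrict_mono (Ioo_subset_Ioo_left ha.le) le_rfl) h0')
  have hne : ∀ᵐ x : ℝ, x ≠ 0 := by simp [ae_iff, measure_singleton]
  refine (ae_restrict_iff' measurableSet_Ioo).2 ?_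
  filter_upwards [(ae_restrict_iff' measurableSet_Ioo).1 el,
    (ae_restrict_iff' measurableSet_Ioo).1 er, hne] with x h1 h2 h3 hx
  rcases lt_or_gt_of_ne h3 with h | h
  · exact h1 ⟨hx.1, h⟩
  · exact h2 ⟨h, hx.2⟩

/-- The limit operator `S_{α,β}(Ψ, Φ)` in `L₂(a, b)`. -/
def limitOperator (a b : ℝ) (ha : a < 0) (hb : 0 < b) (U : ℝ → ℝ) (α β : ℝ) (Ψ Φ : ℝ → ℝ) :
    L2 a b →ₗ.[ℂ] L2 a b :=
  (limitGraph a b ha hb U α β Ψ Φ).toLinearPMap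

theorem limitOperator_graph {a b : ℝ} (ha : a < 0) (hb : 0 < b) (U : ℝ → ℝ) (α β : ℝ)
    (Ψ Φ : ℝ → ℝ) :
    (limitOperator a b ha hb U α β Ψ Φ).graph = limitGraph a b ha hb U α β Ψ Φ :=
  Submodule.toLinearPMap_graph_eq _ (limitGraph_single ha hb U α β Ψ Φ)

/-- Shapes: smooth real functions on the line supported in `[-1, 1]`. -/
structure IsShape (f : ℝ → ℝ) : Prop where
  smooth : ContDiff ℝ ∞ f
  support : tsupport f ⊆ Icc (-1) 1

end

end FourthOrder

open FourthOrder

/-! The proof constructs no approximate eigenfunctions. It rests on two a priori estimates, uniform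
for small ε, for every y in the domain of S_ε with (S_ε - λ)y = f: y is within K(‖f‖ + ε‖y‖) of some
multiple of v, and |⟨v, f⟩| ≤ Kε(‖f‖ + ‖y‖). They are collected in `IsMatching.exists_estimates`;
the rest is Hilbert space theory.

From the estimates to the eigenvalue (`IsNearEigenpair.exists_index`). If no eigenvalue of S_ε were
δ-close to λ, the equation with f = v would have a solution with ‖y‖ ≤ 1/δ, and the second estimate
would read 1 ≤ Kε(1 + 1/δ), which is false for small ε. A unit eigenvector e whose eigenvalue ν is
δ-close to λ satisfies the equation with f = (ν - λ)e. The first estimate forces |⟨v, e⟩| ≥ 3/4, the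
second then gives |ν - λ| = O(ε), and the first, used again, puts e within O(ε) of a multiple of v.
Two orthonormal eigenvectors of this kind would violate Bessel's inequality, so the eigenvalue is
unique and simple.

The index does not depend on ε (`exists_isKthEigenvalue_near`). No eigenvalue of S_ε ever equals m =
λ - δ. The domain of S_ε is fixed and its quadratic form varies continuously with ε > 0, so by
min-max the number of eigenvalues below m is locally constant on an interval (0, ε₁), hence
constant. The index is this number plus one. This argument needs no lower bound on S_ε uniform in ε,
so eigenvalues that escape to -∞ do no harm.

From the differential equation to the estimates. Outside [-ε, ε] the potential is U, and Grönwall's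
inequality compares y with exact solutions of the limit equation that satisfy the Dirichlet
conditions at a or at b; each side has a two-parameter family (`exists_isLeftFamily`,
`exists_isRightFamily`). Inside, w(ξ) = y(εξ) satisfies w'''' + αΨw + εβΦw = O(ε²), with w''(±1) =
O(ε²) and w'''(±1) = O(ε³), so w is close to a solution of the resonance problem
(`InnerData.exists_near_resonance`). If α is not resonant this solution is zero, so y and y' nearly
vanish at ±ε. If α is resonant it is a multiple of the eigenfunction, which relates y'(ε) to
θy'(-ε); Green's formula against that eigenfunction (`green_resonance`) supplies the condition on
second derivatives with the coefficient βϑ. In both cases a linear map J, whose kernel is the set of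
interface conditions, is O(ε) on the traces of y at ±ε (`IsInterfaceMap`).

Consequently the outer parameters of y almost lie in the kernel of the limit matching problem. Since
λ is simple, this kernel is spanned by the parameters of v, which gives the first estimate
(`IsMatching.exists_near_glue`). For the second, ⟨v, f⟩ is integrated by parts: what survives is a
difference of boundary forms at ±ε, which is controlled by J because the interface conditions are
isotropic (`IsMatching.exists_pairing_le`). -/

namespace FourthOrder

/-! ### Primitives and integration by parts -/

/-- `f` is a primitive of the integrable function `f'` on `[p, q]`. -/
structure IsPrimitive (p q : ℝ) (f f' : ℝ → ℂ) : Prop where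
  int : IntervalIntegrable f' volume p q
  ftc : ∀ x ∈ Icc p q, f x = f p + ∫ t in p..x, f' t

theorem IsPrimitive.continuousOn {p q : ℝ} {f f' : ℝ → ℂ} (hpq : p ≤ q)
    (h : IsPrimitive p q f f') : ContinuousOn f (Icc p q) := by
  have := intervalIntegral.continuousOn_primitive_interval' h.int left_mem_uIcc
  rw [uIcc_of_le hpq] at this
  exact (continuousOn_const.add this).congr h.ftc

theorem intervalIntegrable_sub_interval {E : Type*} [NormedAddCommGroup E] {p q x y : ℝ}
    {f : ℝ → E} (hpq : p ≤ q)
    (h : IntervalIntegrable f volume p q) (hx : x ∈ Icc p q) (hy : y ∈ Icc p q) :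
    IntervalIntegrable f volume x y :=
  h.mono_set (by rw [uIcc_of_le hpq]; exact uIcc_subset_Icc hx hy)

theorem IsPrimitive.sub_eq {p q : ℝ} {f f' : ℝ → ℂ} (hpq : p ≤ q) (h : IsPrimitive p q f f')
    {x y : ℝ} (hx : x ∈ Icc p q) (hy : y ∈ Icc p q) : f y - f x = ∫ t in x..y, f' t := by
  have hp : p ∈ Icc p q := left_mem_Icc.2 hpq
  rw [h.ftc x hx, h.ftc y hy, ← intervalIntegral.integral_add_adjacent_intervals
    (intervalIntegrable_sub_interval hpq h.int hp hx) (intervalIntegrable_sub_interval hpq h.int hx hy)]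
  ring

theorem IsPrimitive.mono {p q p' q' : ℝ} {f f' : ℝ → ℂ} (h : IsPrimitive p q f f')
    (hp : p ≤ p') (hpq' : p' ≤ q') (hq : q' ≤ q) : IsPrimitive p' q' f f' := by
  have hpq : p ≤ q := hp.trans (hpq'.trans hq)
  refine ⟨intervalIntegrable_sub_interval hpq h.int ⟨hp, hpq'.trans hq⟩ ⟨hp.trans hpq', hq⟩,
    fun x hx => ?_⟩
  rw [← h.sub_eq hpq ⟨hp, hpq'.trans hq⟩ ⟨hp.trans hx.1, hx.2.trans hq⟩]
  ring

/-- Any `δ` that serves `Φ` serves `f`. With `Φ` the primitive of `‖f'‖`, this makes primitives of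
merely integrable complex functions absolutely continuous. -/
theorem absolutelyContinuousOnInterval_of_dist_le {E : Type*} [NormedAddCommGroup E]
    {f : ℝ → E} {Φ : ℝ → ℝ} {p q : ℝ}
    (hΦ : AbsolutelyContinuousOnInterval Φ p q)
    (h : ∀ x ∈ uIcc p q, ∀ y ∈ uIcc p q, dist (f x) (f y) ≤ dist (Φ x) (Φ y)) :
    AbsolutelyContinuousOnInterval f p q := by
  rw [absolutelyContinuousOnInterval_iff] at *
  intro e he
  obtain ⟨δ, hδ, H⟩ := hΦ e he
  refine ⟨δ, hδ, fun E hE hs => lt_of_le_of_lt (Finset.sum_le_sum fun i hi => ?_) (H E hE hs)⟩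
  exact h _ (hE.1 i hi).1 _ (hE.1 i hi).2

theorem IsPrimitive.absolutelyContinuous {p q : ℝ} {f f' : ℝ → ℂ} (hpq : p ≤ q)
    (h : IsPrimitive p q f f') : AbsolutelyContinuousOnInterval f p q := by
  have hn : IntervalIntegrable (fun t => ‖f' t‖) volume p q := h.int.norm
  refine absolutelyContinuousOnInterval_of_dist_le
    (hn.absolutelyContinuousOnInterval_intervalIntegral (c := p) left_mem_uIcc) ?_
  rw [uIcc_of_le hpq]
  intro x hx y hy
  have hp : p ∈ Icc p q := left_mem_Icc.2 hpq
  rw [dist_comm, dist_eq_norm, h.sub_eq hpq hx hy, dist_comm, dist_eq_norm,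
    intervalIntegral.integral_interval_sub_left
      (intervalIntegrable_sub_interval hpq hn hp hy) (intervalIntegrable_sub_interval hpq hn hp hx)]
  exact intervalIntegral.norm_integral_le_abs_integral_norm

theorem IsPrimitive.mul_integrable {p q : ℝ} {f f' g g' : ℝ → ℂ} (hpq : p ≤ q)
    (hf : IsPrimitive p q f f') (hg : IsPrimitive p q g g') :
    IntervalIntegrable (fun t => f' t * g t) volume p q :=
  hf.int.mul_continuousOn (by rw [uIcc_of_le hpq]; exact hg.continuousOn hpq)

/-- The derivatives are only integrable (in a jet the fourth one need not be continuous), so the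
pointwise product rule holds only almost everywhere. The product minus the primitive of its a.e.
derivative is absolutely continuous with derivative zero a.e., hence constant. -/
theorem IsPrimitive.mul {p q : ℝ} {f f' g g' : ℝ → ℂ} (hpq : p ≤ q)
    (hf : IsPrimitive p q f f') (hg : IsPrimitive p q g g') :
    IsPrimitive p q (fun x => f x * g x) (fun x => f' x * g x + g' x * f x) := by
  have hint : IntervalIntegrable (fun x => f' x * g x + g' x * f x) volume p q :=
    (hf.mul_integrable hpq hg).add (hg.mul_integrable hpq hf)
  refine ⟨hint, ?_⟩
  set H : ℝ → ℂ := fun x => ∫ t in p..x, (f' t * g t + g' t * f t) with hH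
  have hHp : IsPrimitive p q H (fun x => f' x * g x + g' x * f x) :=
    ⟨hint, fun x _ => by simp [hH]⟩
  have hac : AbsolutelyContinuousOnInterval (fun x => f x • g x - H x) p q :=
    ((hf.absolutelyContinuous hpq).smul (hg.absolutelyContinuous hpq)).sub
      (hHp.absolutelyContinuous hpq)
  have der : ∀ {F F' : ℝ → ℂ}, IsPrimitive p q F F' →
      ∀ᵐ x, x ∈ Ioo p q → HasDerivAt F (F' x) x := by
    intro F F' hF
    filter_upwards [hF.int.ae_hasDerivAt_integral] with x hx hxI
    have := (hx (by rw [uIcc_of_le hpq]; exact Ioo_subset_Icc_self hxI) p left_mem_uIcc).const_add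
      (F p)
    refine this.congr_of_eventuallyEq ?_
    filter_upwards [isOpen_Ioo.mem_nhds hxI] with y hy
    exact hF.ftc y (Ioo_subset_Icc_self hy)
  have hp0 : ∀ᵐ x : ℝ, x ≠ p := by simp [ae_iff, measure_singleton]
  have hq0 : ∀ᵐ x : ℝ, x ≠ q := by simp [ae_iff, measure_singleton]
  obtain ⟨C, hC⟩ := hac.const_of_ae_hasDerivAt_zero (by
    filter_upwards [der hf, der hg, der hHp, hp0, hq0] with x h1 h2 h3 h4 h5 hx
    rw [uIcc_of_le hpq] at hx
    have hx' : x ∈ Ioo p q := ⟨lt_of_le_of_ne hx.1 (Ne.symm h4), lt_of_le_of_ne hx.2 h5⟩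
    have := ((h1 hx').mul (h2 hx')).sub (h3 hx')
    have e0 : (0 : ℂ) = f' x * g x + f x * g' x - (f' x * g x + g' x * f x) := by ring
    rw [e0]
    exact this)
  rw [uIcc_of_le hpq] at hC
  intro x hx
  have e1 := hC x hx
  have e2 := hC p (left_mem_Icc.2 hpq)
  have e3 : H p = 0 := by simp [hH]
  simp only [smul_eq_mul, e3] at e1 e2
  have : H x = ∫ t in p..x, (f' t * g t + g' t * f t) := rfl
  rw [← this]
  linear_combination e1 - e2

theorem IsPrimitive.integral_by_parts {p q : ℝ} {f f' g g' : ℝ → ℂ} (hpq : p ≤ q)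
    (hf : IsPrimitive p q f f') (hg : IsPrimitive p q g g') :
    ∫ t in p..q, f' t * g t = f q * g q - f p * g p - ∫ t in p..q, f t * g' t := by
  have h := (hf.mul hpq hg).ftc q (right_mem_Icc.2 hpq)
  rw [intervalIntegral.integral_add (hf.mul_integrable hpq hg) (hg.mul_integrable hpq hf)] at h
  have e : ∫ t in p..q, f t * g' t = ∫ t in p..q, g' t * f t := by
    congr 1; ext t; ring
  rw [e]
  linear_combination -h

theorem isPrimitive_of_hasDerivWithinAt {p q : ℝ} {f f' : ℝ → ℂ} (hpq : p ≤ q)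
    (hf : ∀ x ∈ Icc p q, HasDerivWithinAt f (f' x) (Icc p q) x)
    (hint : IntervalIntegrable f' volume p q) : IsPrimitive p q f f' := by
  refine ⟨hint, fun x hx => ?_⟩
  have hsub : Icc p x ⊆ Icc p q := Icc_subset_Icc_right hx.2
  rw [intervalIntegral.integral_eq_sub_of_hasDerivAt_of_le hx.1
    (fun y hy => ((hf y (hsub hy)).continuousWithinAt).mono hsub)
    (fun y hy => (hf y (hsub (Ioo_subset_Icc_self hy))).hasDerivAt
      (Icc_mem_nhds hy.1 (hy.2.trans_le hx.2)))
    (intervalIntegrable_sub_interval hpq hint (left_mem_Icc.2 hpq) hx)]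
  ring

theorem IsPrimitive.hasDerivWithinAt {p q : ℝ} {f f' : ℝ → ℂ} (hpq : p < q)
    (hf : IsPrimitive p q f f') (hc : ContinuousOn f' (Icc p q)) :
    ∀ x ∈ Icc p q, HasDerivWithinAt f (f' x) (Icc p q) x := by
  intro x hx
  have hint : IntervalIntegrable f' volume p x :=
    intervalIntegrable_sub_interval hpq.le hf.int (left_mem_Icc.2 hpq.le) hx
  have : Fact (x ∈ Icc p q) := ⟨hx⟩
  have h := intervalIntegral.integral_hasDerivWithinAt_right (s := Icc p q) (t := Icc p q) hint
    (hc.stronglyMeasurableAtFilter_nhdsWithin measurableSet_Icc x) (hc x hx)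
  refine (h.const_add (f p)).congr (fun y hy => hf.ftc y hy) (hf.ftc x hx)

/-! ### Jets -/

/-- `d 0` is of class `C³` on `[p, q]` with derivatives `d 1, d 2, d 3`, and `d 3` is absolutely
continuous with derivative `d 4`. -/
structure IsJet (p q : ℝ) (d : ℕ → ℝ → ℂ) : Prop where
  prim : ∀ j < 4, IsPrimitive p q (d j) (d (j + 1))

theorem IsSobolevJet.isJet {p q : ℝ} {d : ℕ → ℝ → ℂ} (hpq : p ≤ q) (h : IsSobolevJet p q d) :
    IsJet p q d :=
  ⟨fun j hj => ⟨intervalIntegrable_of_jet hpq h (j + 1) hj, h.ftc j hj⟩⟩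

theorem IsJet.continuousOn {p q : ℝ} {d : ℕ → ℝ → ℂ} (hpq : p ≤ q) (h : IsJet p q d) {j : ℕ}
    (hj : j < 4) : ContinuousOn (d j) (Icc p q) := (h.prim j hj).continuousOn hpq

theorem IsJet.mono {p q p' q' : ℝ} {d : ℕ → ℝ → ℂ} (h : IsJet p q d)
    (hp : p ≤ p') (hpq' : p' ≤ q') (hq : q' ≤ q) : IsJet p' q' d :=
  ⟨fun j hj => (h.prim j hj).mono hp hpq' hq⟩

theorem IsPrimitive.conj {p q : ℝ} {f f' : ℝ → ℂ} (h : IsPrimitive p q f f') :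
    IsPrimitive p q (fun x => starRingEnd ℂ (f x)) (fun x => starRingEnd ℂ (f' x)) := by
  refine ⟨?_, fun x hx => ?_⟩
  · have := h.int
    rw [intervalIntegrable_iff] at *
    exact (Complex.conjCLE.toContinuousLinearMap.integrable_comp this)
  · rw [h.ftc x hx, map_add]
    congr 1
    rw [intervalIntegral.integral_of_le hx.1, intervalIntegral.integral_of_le hx.1]
    exact integral_conj.symm

theorem IsJet.conj {p q : ℝ} {d : ℕ → ℝ → ℂ} (h : IsJet p q d) :
    IsJet p q (fun j x => starRingEnd ℂ (d j x)) := ⟨fun j hj => (h.prim j hj).conj⟩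

theorem IsPrimitive.add {p q : ℝ} {f f' g g' : ℝ → ℂ} (hpq : p ≤ q) (hf : IsPrimitive p q f f')
    (hg : IsPrimitive p q g g') : IsPrimitive p q (f + g) (f' + g') := by
  refine ⟨hf.int.add hg.int, fun x hx => ?_⟩
  simp only [Pi.add_apply]
  rw [intervalIntegral.integral_add
    (intervalIntegrable_sub_interval hpq hf.int (left_mem_Icc.2 hpq) hx)
    (intervalIntegrable_sub_interval hpq hg.int (left_mem_Icc.2 hpq) hx), hf.ftc x hx, hg.ftc x hx]
  ring

theorem IsPrimitive.const_smul {p q : ℝ} {f f' : ℝ → ℂ} (c : ℂ) (hf : IsPrimitive p q f f') :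
    IsPrimitive p q (c • f) (c • f') := by
  refine ⟨hf.int.smul c, fun x hx => ?_⟩
  simp only [Pi.smul_apply, smul_eq_mul]
  rw [intervalIntegral.integral_const_mul, hf.ftc x hx]
  ring

theorem IsJet.add {p q : ℝ} {d e : ℕ → ℝ → ℂ} (hpq : p ≤ q) (hd : IsJet p q d)
    (he : IsJet p q e) : IsJet p q (d + e) := ⟨fun j hj => (hd.prim j hj).add hpq (he.prim j hj)⟩

theorem IsJet.const_smul {p q : ℝ} {d : ℕ → ℝ → ℂ} (c : ℂ) (hd : IsJet p q d) :
    IsJet p q (c • d) := ⟨fun j hj => (hd.prim j hj).const_smul c⟩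

theorem IsJet.sub {p q : ℝ} {d e : ℕ → ℝ → ℂ} (hpq : p ≤ q) (hd : IsJet p q d)
    (he : IsJet p q e) : IsJet p q (d - e) := by
  have := hd.add hpq (he.const_smul (-1))
  rwa [neg_one_smul, ← sub_eq_add_neg] at this

theorem IsPrimitive.comp_mul {p q : ℝ} {f f' : ℝ → ℂ} {s : ℝ} (hs : 0 < s)
    (hf : IsPrimitive (s * p) (s * q) f f') :
    IsPrimitive p q (fun x => f (s * x)) (fun x => (s : ℂ) * f' (s * x)) := by
  refine ⟨?_, fun x hx => ?_⟩
  · refine IntervalIntegrable.const_mul ?_ _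
    have := hf.int.comp_mul_left (c := s)
    simpa [mul_div_cancel_left₀ _ hs.ne'] using this
  · rw [hf.ftc (s * x) ⟨by have := hx.1; gcongr, by have := hx.2; gcongr⟩,
      intervalIntegral.integral_const_mul]
    congr 1
    have := intervalIntegral.smul_integral_comp_mul_left (a := p) (b := x) f' s
    rw [← this, Complex.real_smul]

/-- The rescaled jet `ξ ↦ s ^ j d_j(s ξ)` of `ξ ↦ d_0(s ξ)`. -/
theorem IsJet.rescale {p q : ℝ} {d : ℕ → ℝ → ℂ} {s : ℝ} (hs : 0 < s)
    (hd : IsJet (s * p) (s * q) d) : IsJet p q (fun j x => (s : ℂ) ^ j * d j (s * x)) := by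
  refine ⟨fun j hj => ?_⟩
  have := ((hd.prim j hj).comp_mul hs).const_smul ((s : ℂ) ^ j)
  refine ⟨?_, fun x hx => ?_⟩
  · convert this.int using 2 with x
    simp only [Pi.smul_apply, smul_eq_mul]; ring
  · have h2 := this.ftc x hx
    simp only [Pi.smul_apply, smul_eq_mul] at h2
    rw [h2]; congr 2; ext t; ring

/-- The reflected jet of `x ↦ d_0(-x)`. -/
noncomputable def reflect (d : ℕ → ℝ → ℂ) : ℕ → ℝ → ℂ := fun j x => (-1) ^ j * d j (-x)

theorem IsJet.reflect {p q : ℝ} {d : ℕ → ℝ → ℂ} (hpq : p ≤ q) (hd : IsJet p q d) :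
    IsJet (-q) (-p) (reflect d) := by
  refine ⟨fun j hj => ?_⟩
  have hp := hd.prim j hj
  have hint : IntervalIntegrable (fun x => d (j + 1) (-x)) volume (-q) (-p) := by
    have := hp.int.comp_mul_left (c := -1)
    simpa [div_neg] using this.symm
  refine ⟨hint.const_mul _, fun x hx => ?_⟩
  simp only [FourthOrder.reflect, neg_neg]
  rw [intervalIntegral.integral_const_mul, intervalIntegral.integral_comp_neg (fun t => d (j + 1) t),
    neg_neg, ← hp.sub_eq hpq ⟨by linarith [hx.2], by linarith [hx.1]⟩ (right_mem_Icc.2 hpq)]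
  ring

theorem isJet_of_hasDerivWithinAt {p q : ℝ} {d : ℕ → ℝ → ℂ} (hpq : p ≤ q)
    (hd : ∀ j < 4, ∀ x ∈ Icc p q, HasDerivWithinAt (d j) (d (j + 1) x) (Icc p q) x)
    (h4 : ContinuousOn (d 4) (Icc p q)) : IsJet p q d := by
  refine ⟨fun j hj => isPrimitive_of_hasDerivWithinAt hpq (hd j hj) ?_⟩
  apply ContinuousOn.intervalIntegrable
  rw [uIcc_of_le hpq]
  rcases Nat.lt_or_ge (j + 1) 4 with h | h
  · exact fun x hx => (hd (j + 1) h x hx).continuousWithinAt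
  · obtain rfl : j = 3 := by omega
    exact h4

theorem IsJet.hasDerivWithinAt {p q : ℝ} {d : ℕ → ℝ → ℂ} (hpq : p < q) (hd : IsJet p q d)
    (h4 : ContinuousOn (d 4) (Icc p q)) :
    ∀ j < 4, ∀ x ∈ Icc p q, HasDerivWithinAt (d j) (d (j + 1) x) (Icc p q) x := by
  intro j hj
  refine (hd.prim j hj).hasDerivWithinAt hpq ?_
  rcases Nat.lt_or_ge (j + 1) 4 with h | h
  · exact hd.continuousOn hpq.le h
  · obtain rfl : j = 3 := by omega
    exact h4

/-- Green's formula, after two integrations by parts. -/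
theorem IsJet.green_half {p q : ℝ} {d e : ℕ → ℝ → ℂ} (hpq : p ≤ q) (hd : IsJet p q d)
    (he : IsJet p q e) :
    ∫ t in p..q, d 4 t * e 0 t = (d 3 q * e 0 q - d 2 q * e 1 q) - (d 3 p * e 0 p - d 2 p * e 1 p)
      + ∫ t in p..q, d 2 t * e 2 t := by
  have h1 := (hd.prim 3 (by norm_num)).integral_by_parts hpq (he.prim 0 (by norm_num))
  have h2 := (hd.prim 2 (by norm_num)).integral_by_parts hpq (he.prim 1 (by norm_num))
  norm_num at h1 h2
  rw [h1, h2]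
  ring

/-- Green's formula for the operator `d⁴/dx⁴`. -/
theorem IsJet.green {p q : ℝ} {d e : ℕ → ℝ → ℂ} (hpq : p ≤ q) (hd : IsJet p q d)
    (he : IsJet p q e) :
    ∫ t in p..q, d 4 t * e 0 t =
      (d 3 q * e 0 q - d 2 q * e 1 q + d 1 q * e 2 q - d 0 q * e 3 q)
      - (d 3 p * e 0 p - d 2 p * e 1 p + d 1 p * e 2 p - d 0 p * e 3 p)
      + ∫ t in p..q, e 4 t * d 0 t := by
  have h1 := hd.green_half hpq he
  have h2 := he.green_half hpq hd
  have e : ∫ t in p..q, e 2 t * d 2 t = ∫ t in p..q, d 2 t * e 2 t := by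
    congr 1; ext t; ring
  rw [e] at h2
  rw [h1, h2]
  ring

/-! ### Grönwall estimate for jets -/

/-- The right-hand side `H` of the hypothesis has right derivative `M f ≤ M H`, so the differential
form of Grönwall's inequality applies to `H`, which dominates `f`. -/
theorem le_mul_exp_of_le_integral {p q c M : ℝ} {f : ℝ → ℝ} (hpq : p ≤ q) (hM : 0 ≤ M)
    (hf : ContinuousOn f (Icc p q)) (hf0 : ∀ x ∈ Icc p q, 0 ≤ f x)
    (h : ∀ x ∈ Icc p q, f x ≤ c + M * ∫ t in p..x, f t) :
    ∀ x ∈ Icc p q, f x ≤ c * Real.exp (M * (x - p)) := by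
  have hc : 0 ≤ c := by
    have := h p (left_mem_Icc.2 hpq)
    simp at this
    exact (hf0 p (left_mem_Icc.2 hpq)).trans this
  have hint : IntervalIntegrable f volume p q :=
    ContinuousOn.intervalIntegrable (by rwa [uIcc_of_le hpq])
  set H : ℝ → ℝ := fun x => c + M * ∫ t in p..x, f t with hH
  have hHc : ContinuousOn H (Icc p q) := by
    have := intervalIntegral.continuousOn_primitive_interval' hint left_mem_uIcc
    rw [uIcc_of_le hpq] at this
    exact continuousOn_const.add (continuousOn_const.mul this)
  have hd : ∀ x ∈ Ico p q, HasDerivWithinAt H (M * f x) (Ici x) x := by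
    intro x hx
    have hx' : x ∈ Icc p q := Ico_subset_Icc_self hx
    have hi : IntervalIntegrable f volume p x :=
      intervalIntegrable_sub_interval hpq hint (left_mem_Icc.2 hpq) hx'
    have hcx : ContinuousWithinAt f (Ici x) x :=
      ((hf x hx').mono (Icc_subset_Icc_left hx'.1)).mono_of_mem_nhdsWithin
        (Icc_mem_nhdsGE hx.2)
    have hmeas : StronglyMeasurableAtFilter f (nhdsWithin x (Ioi x)) := by
      have h1 := hf.stronglyMeasurableAtFilter_nhdsWithin (μ := volume) measurableSet_Icc x
      refine h1.filter_mono ?_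
      refine nhdsWithin_le_of_mem ?_
      exact Filter.mem_of_superset (Ioo_mem_nhdsGT hx.2)
        (fun y hy => ⟨hx.1.trans hy.1.le, hy.2.le⟩)
    have := intervalIntegral.integral_hasDerivWithinAt_right (s := Ici x) (t := Ioi x) hi hmeas (hcx.mono Ioi_subset_Ici_self)
    exact (this.const_mul M).const_add c
  have hb := norm_le_gronwallBound_of_norm_deriv_right_le (δ := c) (K := M) (ε := 0) hHc hd
    (by simp [hH, abs_of_nonneg hc]) (by
      intro x hx
      have hx' : x ∈ Icc p q := Ico_subset_Icc_self hx
      rw [norm_mul, Real.norm_of_nonneg hM, Real.norm_of_nonneg (hf0 x hx'), add_zero]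
      exact mul_le_mul_of_nonneg_left ((h x hx').trans (le_abs_self _)) hM)
  intro x hx
  have := hb x hx
  rw [gronwallBound_ε0] at this
  exact ((h x hx).trans (le_abs_self _)).trans this

/-- The size of a jet at a point. -/
noncomputable def jetNorm (d : ℕ → ℝ → ℂ) (x : ℝ) : ℝ := ‖d 0 x‖ + ‖d 1 x‖ + ‖d 2 x‖ + ‖d 3 x‖

theorem jetNorm_nonneg (d : ℕ → ℝ → ℂ) (x : ℝ) : 0 ≤ jetNorm d x := by
  unfold jetNorm; positivity

theorem norm_le_jetNorm (d : ℕ → ℝ → ℂ) (x : ℝ) {j : ℕ} (hj : j < 4) : ‖d j x‖ ≤ jetNorm d x := by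
  unfold jetNorm
  have h0 := norm_nonneg (d 0 x)
  have h1 := norm_nonneg (d 1 x)
  have h2 := norm_nonneg (d 2 x)
  have h3 := norm_nonneg (d 3 x)
  interval_cases j <;> linarith

theorem IsJet.continuousOn_jetNorm {p q : ℝ} {d : ℕ → ℝ → ℂ} (hpq : p ≤ q) (hd : IsJet p q d) :
    ContinuousOn (jetNorm d) (Icc p q) :=
  (((hd.continuousOn hpq (by norm_num)).norm.add (hd.continuousOn hpq (by norm_num)).norm).add
    (hd.continuousOn hpq (by norm_num)).norm).add (hd.continuousOn hpq (by norm_num)).norm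

theorem IsPrimitive.norm_le {p q : ℝ} {f f' : ℝ → ℂ} {x : ℝ}
    (h : IsPrimitive p q f f') (hx : x ∈ Icc p q) :
    ‖f x‖ ≤ ‖f p‖ + ∫ t in p..x, ‖f' t‖ := by
  rw [h.ftc x hx]
  exact (norm_add_le _ _).trans (by
    gcongr; exact intervalIntegral.norm_integral_le_integral_norm hx.1)

/-- Summing the four primitives leaves the integrals of `d 1, …, d 4`. The last is at most the
defect plus `M ‖d 0‖`, so the Grönwall rate is `M + 1`. The defect is integrated up to `q` to make
it a constant independent of `x`. -/
theorem IsJet.jetNorm_le {p q M : ℝ} {V : ℝ → ℝ} {d : ℕ → ℝ → ℂ} (hpq : p ≤ q)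
    (hd : IsJet p q d) (hV : ContinuousOn V (Icc p q)) (hM : ∀ x ∈ Icc p q, |V x| ≤ M) :
    ∀ x ∈ Icc p q, jetNorm d x ≤
      (jetNorm d p + ∫ t in p..q, ‖d 4 t + V t * d 0 t‖) * Real.exp ((M + 1) * (x - p)) := by
  have hM0 : 0 ≤ M := (abs_nonneg _).trans (hM p (left_mem_Icc.2 hpq))
  have hVd : IntervalIntegrable (fun t => (V t : ℂ) * d 0 t) volume p q := by
    apply ContinuousOn.intervalIntegrable
    rw [uIcc_of_le hpq]
    exact (Complex.continuous_ofReal.comp_continuousOn hV).mul (hd.continuousOn hpq (by norm_num))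
  have hg : IntervalIntegrable (fun t => ‖d 4 t + V t * d 0 t‖) volume p q :=
    (((hd.prim 3 (by norm_num)).int).add hVd).norm
  have hi : ∀ j < 4, IntervalIntegrable (fun t => ‖d j t‖) volume p q := fun j hj =>
    ContinuousOn.intervalIntegrable (by rw [uIcc_of_le hpq]; exact (hd.continuousOn hpq hj).norm)
  refine le_mul_exp_of_le_integral hpq (by positivity) (hd.continuousOn_jetNorm hpq)
    (fun x _ => jetNorm_nonneg d x) fun x hx => ?_
  have hp : p ∈ Icc p q := left_mem_Icc.2 hpq
  have e0 := (hd.prim 0 (by norm_num)).norm_le hx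
  have e1 := (hd.prim 1 (by norm_num)).norm_le hx
  have e2 := (hd.prim 2 (by norm_num)).norm_le hx
  have e3 := (hd.prim 3 (by norm_num)).norm_le hx
  have s0 := intervalIntegrable_sub_interval hpq (hi 0 (by norm_num)) hp hx
  have s1 := intervalIntegrable_sub_interval hpq (hi 1 (by norm_num)) hp hx
  have s2 := intervalIntegrable_sub_interval hpq (hi 2 (by norm_num)) hp hx
  have s3 := intervalIntegrable_sub_interval hpq (hi 3 (by norm_num)) hp hx
  have sg := intervalIntegrable_sub_interval hpq hg hp hx
  have s4 := intervalIntegrable_sub_interval hpq (hd.prim 3 (by norm_num)).int.norm hp hx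
  have e4 : ∫ t in p..x, ‖d 4 t‖ ≤ ∫ t in p..x, (‖d 4 t + V t * d 0 t‖ + M * ‖d 0 t‖) := by
    refine intervalIntegral.integral_mono_on hx.1 s4 (sg.add (s0.const_mul M)) fun t ht => ?_
    have ht' : t ∈ Icc p q := ⟨ht.1, ht.2.trans hx.2⟩
    have : d 4 t = (d 4 t + V t * d 0 t) - V t * d 0 t := by ring
    calc ‖d 4 t‖ ≤ ‖d 4 t + V t * d 0 t‖ + ‖(V t : ℂ) * d 0 t‖ := by
          conv_lhs => rw [this]
          exact norm_sub_le _ _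
      _ ≤ _ := by
          rw [norm_mul, Complex.norm_real, Real.norm_eq_abs]
          gcongr
          exact hM t ht'
  rw [intervalIntegral.integral_add sg (s0.const_mul M), intervalIntegral.integral_const_mul] at e4
  have e5 : ∫ t in p..x, ‖d 4 t + V t * d 0 t‖ ≤ ∫ t in p..q, ‖d 4 t + V t * d 0 t‖ :=
    intervalIntegral.integral_mono_interval le_rfl hx.1 hx.2
      (Filter.Eventually.of_forall fun _ => norm_nonneg _) hg
  have e6 : ∫ t in p..x, jetNorm d t = (∫ t in p..x, ‖d 0 t‖) + (∫ t in p..x, ‖d 1 t‖)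
      + (∫ t in p..x, ‖d 2 t‖) + ∫ t in p..x, ‖d 3 t‖ := by
    unfold jetNorm
    rw [intervalIntegral.integral_add ((s0.add s1).add s2) s3,
      intervalIntegral.integral_add (s0.add s1) s2, intervalIntegral.integral_add s0 s1]
  have n0 : 0 ≤ ∫ t in p..x, ‖d 0 t‖ :=
    intervalIntegral.integral_nonneg hx.1 fun _ _ => norm_nonneg _
  have n1 : 0 ≤ ∫ t in p..x, ‖d 1 t‖ :=
    intervalIntegral.integral_nonneg hx.1 fun _ _ => norm_nonneg _
  have n2 : 0 ≤ ∫ t in p..x, ‖d 2 t‖ :=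
    intervalIntegral.integral_nonneg hx.1 fun _ _ => norm_nonneg _
  have n3 : 0 ≤ ∫ t in p..x, ‖d 3 t‖ :=
    intervalIntegral.integral_nonneg hx.1 fun _ _ => norm_nonneg _
  norm_num at e0 e1 e2 e3
  rw [e6]
  have : jetNorm d x ≤ jetNorm d p + ((∫ t in p..x, ‖d 1 t‖)
      + (∫ t in p..x, ‖d 2 t‖) + (∫ t in p..x, ‖d 3 t‖) + ∫ t in p..x, ‖d 4 t‖) := by
    unfold jetNorm; linarith
  nlinarith [mul_nonneg hM0 n1, mul_nonneg hM0 n2, mul_nonneg hM0 n3]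


/-! ### Linear equations: existence -/

/-- Picard iteration in the weighted unknown `w` with `W t = exp (κ (t - p)) w t`. The weight lowers
the Lipschitz constant of the integral operator to at most `M / κ`, and `κ = 2 (M + 1)` makes it a
contraction on the whole interval at once. -/
theorem exists_volterra_solution {E : Type*} [NormedAddCommGroup E] [NormedSpace ℝ E]
    [CompleteSpace E] {p q M : ℝ} (hpq : p ≤ q) (hM : 0 ≤ M) (A : ℝ → E → E) (F : ℝ → E)
    (hF : ContinuousOn F (Icc p q))
    (hA : ∀ W : ℝ → E, Continuous W → ContinuousOn (fun t => A t (W t)) (Icc p q))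
    (hL : ∀ t ∈ Icc p q, ∀ u w, ‖A t u - A t w‖ ≤ M * ‖u - w‖) :
    ∃ W : ℝ → E, Continuous W ∧ ∀ x ∈ Icc p q, W x = F x + ∫ t in p..x, A t (W t) := by
  obtain ⟨κ, hκ⟩ : ∃ κ : ℝ, κ = 2 * (M + 1) := ⟨_, rfl⟩
  have hκ0 : 0 < κ := by rw [hκ]; positivity
  let ext : C(Icc p q, E) → ℝ → E := fun w t =>
    Real.exp (κ * (t - p)) • w (projIcc p q hpq t)
  have hext : ∀ w, Continuous (ext w) := fun w => by
    have : Continuous (projIcc p q hpq) := continuous_projIcc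
    fun_prop
  have hii : ∀ w, IntervalIntegrable (fun t => A t (ext w t)) volume p q := fun w =>
    ContinuousOn.intervalIntegrable (by rw [uIcc_of_le hpq]; exact hA _ (hext w))
  have hprim : ∀ w, ContinuousOn (fun x => ∫ t in p..x, A t (ext w t)) (Icc p q) := fun w => by
    have := intervalIntegral.continuousOn_primitive_interval' (hii w) left_mem_uIcc
    rwa [uIcc_of_le hpq] at this
  let T : C(Icc p q, E) → C(Icc p q, E) := fun w =>
    ⟨fun x => Real.exp (-(κ * (x - p))) • (F x + ∫ t in p..(x : ℝ), A t (ext w t)), by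
      have h1 : ContinuousOn (fun x : ℝ => Real.exp (-(κ * (x - p))) •
          (F x + ∫ t in p..(x : ℝ), A t (ext w t))) (Icc p q) :=
        (by fun_prop : Continuous fun x : ℝ => Real.exp (-(κ * (x - p)))).continuousOn.smul
          (hF.add (hprim w))
      exact continuousOn_iff_continuous_domRestrict.1 h1⟩
  have hT_apply : ∀ w (x : Icc p q), T w x =
      Real.exp (-(κ * (x - p))) • (F x + ∫ t in p..(x : ℝ), A t (ext w t)) := fun _ _ => rfl
  have hT : ContractingWith (1 / 2) T := by
    refine ⟨by rw [← NNReal.coe_lt_coe]; norm_num, LipschitzWith.of_dist_le_mul fun w w' => ?_⟩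
    rw [ContinuousMap.dist_le (by positivity)]
    intro x
    have hx := x.2
    have hpI : p ∈ Icc p q := left_mem_Icc.2 hpq
    have e1 : (T w) x - (T w') x = Real.exp (-(κ * (x - p))) •
        ∫ t in p..(x : ℝ), (A t (ext w t) - A t (ext w' t)) := by
      rw [intervalIntegral.integral_sub (intervalIntegrable_sub_interval hpq (hii w) hpI hx)
        (intervalIntegrable_sub_interval hpq (hii w') hpI hx)]
      rw [hT_apply, hT_apply, ← smul_sub]
      congr 1
      abel
    have e2 : ‖∫ t in p..(x : ℝ), (A t (ext w t) - A t (ext w' t))‖ ≤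
        ∫ t in p..(x : ℝ), M * dist w w' * Real.exp (κ * (t - p)) := by
      refine intervalIntegral.norm_integral_le_of_norm_le hx.1 ?_
        (Continuous.intervalIntegrable (by fun_prop) _ _)
      refine Filter.Eventually.of_forall fun t ht => ?_
      have ht' : t ∈ Icc p q := ⟨ht.1.le, ht.2.trans hx.2⟩
      refine (hL t ht' _ _).trans ?_
      simp only [ext]
      rw [← smul_sub, norm_smul, Real.norm_of_nonneg (Real.exp_pos _).le, mul_assoc,
        mul_comm (dist w w')]
      gcongr
      rw [← dist_eq_norm]
      exact ContinuousMap.dist_apply_le_dist _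
    have e3 : ∫ t in p..(x : ℝ), M * dist w w' * Real.exp (κ * (t - p)) =
        M * dist w w' * ((Real.exp (κ * (x - p)) - 1) / κ) := by
      rw [intervalIntegral.integral_const_mul]
      congr 1
      have hd : ∀ t ∈ uIcc p (x : ℝ), HasDerivAt (fun t => Real.exp (κ * (t - p)) / κ)
          (Real.exp (κ * (t - p))) t := by
        intro t _
        have h1 : HasDerivAt (fun t => κ * (t - p)) κ t := by
          simpa using ((hasDerivAt_id t).sub_const p).const_mul κ
        have := (h1.exp).div_const κ
        rwa [mul_div_cancel_right₀ _ hκ0.ne'] at this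
      rw [intervalIntegral.integral_eq_sub_of_hasDerivAt hd
        (Continuous.intervalIntegrable (by fun_prop) _ _)]
      simp
      ring
    rw [dist_eq_norm, e1, norm_smul, Real.norm_of_nonneg (Real.exp_pos _).le]
    calc Real.exp (-(κ * (x - p))) * ‖∫ t in p..(x : ℝ), (A t (ext w t) - A t (ext w' t))‖
        ≤ Real.exp (-(κ * (x - p))) * (M * dist w w' * ((Real.exp (κ * (x - p)) - 1) / κ)) := by
          gcongr
          exact e2.trans e3.le
      _ ≤ Real.exp (-(κ * (x - p))) * (M * dist w w' * ((Real.exp (κ * (x - p))) / κ)) := by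
          gcongr
          linarith
      _ = M / κ * dist w w' := by
          rw [Real.exp_neg]
          field_simp
      _ ≤ (1 / 2 : ℝ) * dist w w' := by
          refine mul_le_mul_of_nonneg_right ?_ dist_nonneg
          rw [div_le_iff₀ hκ0, hκ]
          linarith
      _ = _ := by norm_num
  have : Nonempty C(Icc p q, E) := ⟨0⟩
  set w := ContractingWith.fixedPoint T hT with hw
  have hfix : T w = w := hT.fixedPoint_isFixedPt
  refine ⟨ext w, hext w, fun x hx => ?_⟩
  have h1 : (T w) ⟨x, hx⟩ = w ⟨x, hx⟩ := by rw [hfix]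
  have h2 : ext w x = Real.exp (κ * (x - p)) • w ⟨x, hx⟩ := by
    simp only [ext, projIcc_of_mem hpq hx]
  rw [h2, ← h1, hT_apply, smul_smul, ← Real.exp_add, add_neg_cancel, Real.exp_zero, one_smul]

/-- The initial value problem for `d₄ + V d₀ = f`. -/
theorem exists_jet {p q : ℝ} (hpq : p ≤ q) {V : ℝ → ℝ} (hV : ContinuousOn V (Icc p q))
    {f : ℝ → ℂ} (hf : IntervalIntegrable f volume p q) (z : Fin 4 → ℂ) :
    ∃ d : ℕ → ℝ → ℂ, IsJet p q d ∧ (∀ j : Fin 4, d j p = z j) ∧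
      ∀ x, d 4 x = f x - V x * d 0 x := by
  obtain ⟨M, hM⟩ := isCompact_Icc.exists_bound_of_continuousOn hV
  have hM0 : 0 ≤ M := (norm_nonneg _).trans (hM p (left_mem_Icc.2 hpq))
  let A : ℝ → (Fin 4 → ℂ) → (Fin 4 → ℂ) := fun t w => ![w 1, w 2, w 3, -(V t * w 0)]
  -- The source `f` is only integrable, so it enters through its continuous primitive in the forcing
  -- term; the linear part `A` stays continuous.
  let F : ℝ → (Fin 4 → ℂ) := fun x => ![z 0, z 1, z 2, z 3 + ∫ t in p..x, f t]
  have hF3 : ContinuousOn (fun x => ∫ t in p..x, f t) (Icc p q) := by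
    have := intervalIntegral.continuousOn_primitive_interval' hf left_mem_uIcc
    rwa [uIcc_of_le hpq] at this
  have hF : ContinuousOn F (Icc p q) := by
    refine continuousOn_pi.2 fun i => ?_
    fin_cases i
    · exact continuousOn_const
    · exact continuousOn_const
    · exact continuousOn_const
    · exact continuousOn_const.add hF3
  have hA : ∀ W : ℝ → Fin 4 → ℂ, Continuous W →
      ContinuousOn (fun t => A t (W t)) (Icc p q) := by
    intro W hW
    have hWi : ∀ i, Continuous fun t => W t i := fun i => (continuous_apply i).comp hW
    refine continuousOn_pi.2 fun i => ?_
    fin_cases i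
    · exact (hWi 1).continuousOn
    · exact (hWi 2).continuousOn
    · exact (hWi 3).continuousOn
    · exact ((Complex.continuous_ofReal.comp_continuousOn hV).mul (hWi 0).continuousOn).neg
  obtain ⟨W, hWc, hW⟩ := exists_volterra_solution hpq (M := M + 1) (by positivity) A F hF hA (by
    intro t ht u w
    have hle : ∀ i, ‖u i - w i‖ ≤ ‖u - w‖ := fun i => norm_le_pi_norm (u - w) i
    have h1 : ‖u - w‖ ≤ (M + 1) * ‖u - w‖ := by nlinarith [norm_nonneg (u - w)]
    refine (pi_norm_le_iff_of_nonneg (by positivity)).2 fun i => ?_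
    fin_cases i
    · exact (hle 1).trans h1
    · exact (hle 2).trans h1
    · exact (hle 3).trans h1
    · have : ((A t u - A t w) 3) = -(V t * (u 0 - w 0)) := by
        simp [A]; ring
      change ‖(A t u - A t w) 3‖ ≤ _
      rw [this, norm_neg, norm_mul, Complex.norm_real]
      have := hM t ht
      have h2 := hle 0
      have h3 := norm_nonneg (u 0 - w 0)
      nlinarith [norm_nonneg (V t), norm_nonneg (u - w)])
  have hint : IntervalIntegrable (fun t => A t (W t)) volume p q :=
    ContinuousOn.intervalIntegrable (by rw [uIcc_of_le hpq]; exact hA W hWc)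
  have hcomp : ∀ x ∈ Icc p q, ∀ i, W x i = F x i + ∫ t in p..x, A t (W t) i := by
    intro x hx i
    have h := hW x hx
    have h' := congrFun h i
    rw [h', Pi.add_apply]
    congr 1
    exact ((ContinuousLinearMap.proj (R := ℝ) (φ := fun _ : Fin 4 => ℂ) i).intervalIntegral_comp_comm
      (intervalIntegrable_sub_interval hpq hint (left_mem_Icc.2 hpq) hx)).symm
  let d : ℕ → ℝ → ℂ := fun j x =>
    match j with
    | 0 => W x 0
    | 1 => W x 1
    | 2 => W x 2
    | 3 => W x 3
    | _ => f x - V x * W x 0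
  have hpp : p ∈ Icc p q := left_mem_Icc.2 hpq
  have hWi : ∀ i, Continuous fun t => W t i := fun i => (continuous_apply i).comp hWc
  have hV0 : IntervalIntegrable (fun t => (V t : ℂ) * W t 0) volume p q := by
    apply ContinuousOn.intervalIntegrable
    rw [uIcc_of_le hpq]
    exact (Complex.continuous_ofReal.comp_continuousOn hV).mul (hWi 0).continuousOn
  refine ⟨d, ⟨fun j hj => ?_⟩, fun j => ?_, fun x => rfl⟩
  · have key : ∀ i : Fin 4, i ≠ 3 → ∀ x ∈ Icc p q, W x i = W p i + ∫ t in p..x, A t (W t) i := by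
      intro i hi x hx
      rw [hcomp x hx i, hcomp p hpp i]
      fin_cases i <;> simp [F] at hi ⊢
    interval_cases j
    · exact ⟨(hWi 1).intervalIntegrable _ _, key 0 (by decide)⟩
    · exact ⟨(hWi 2).intervalIntegrable _ _, key 1 (by decide)⟩
    · exact ⟨(hWi 3).intervalIntegrable _ _, key 2 (by decide)⟩
    · refine ⟨hf.sub hV0, fun x hx => ?_⟩
      change W x 3 = W p 3 + ∫ t in p..x, (f t - V t * W t 0)
      rw [hcomp x hx 3, hcomp p hpp 3, intervalIntegral.integral_sub
        (intervalIntegrable_sub_interval hpq hf hpp hx)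
        (intervalIntegrable_sub_interval hpq hV0 hpp hx)]
      simp [F, A]
      ring
  · have := hcomp p hpp j
    fin_cases j <;> simpa [F, d] using this

/-! ### Fundamental system -/

/-- `d` is a classical solution of `d₄ + V d₀ = 0` on `[p, q]`. -/
structure IsSolution (p q : ℝ) (V : ℝ → ℝ) (d : ℕ → ℝ → ℂ) : Prop where
  jet : IsJet p q d
  eqn : ∀ x ∈ Icc p q, d 4 x + V x * d 0 x = 0

theorem IsSolution.add {p q : ℝ} {V : ℝ → ℝ} {d e : ℕ → ℝ → ℂ} (hpq : p ≤ q)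
    (hd : IsSolution p q V d) (he : IsSolution p q V e) : IsSolution p q V (d + e) :=
  ⟨hd.jet.add hpq he.jet, fun x hx => by
    simp only [Pi.add_apply]; linear_combination hd.eqn x hx + he.eqn x hx⟩

theorem IsSolution.const_smul {p q : ℝ} {V : ℝ → ℝ} {d : ℕ → ℝ → ℂ} (c : ℂ)
    (hd : IsSolution p q V d) : IsSolution p q V (c • d) :=
  ⟨hd.jet.const_smul c, fun x hx => by
    simp only [Pi.smul_apply, smul_eq_mul]; linear_combination c * hd.eqn x hx⟩

theorem IsSolution.continuousOn_four {p q : ℝ} {V : ℝ → ℝ} {d : ℕ → ℝ → ℂ} (hpq : p ≤ q)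
    (hV : ContinuousOn V (Icc p q)) (hd : IsSolution p q V d) : ContinuousOn (d 4) (Icc p q) := by
  have : ContinuousOn (fun x => -((V x : ℂ) * d 0 x)) (Icc p q) :=
    ((Complex.continuous_ofReal.comp_continuousOn hV).mul
      (hd.jet.continuousOn hpq (by norm_num))).neg
  exact this.congr fun x hx => eq_neg_of_add_eq_zero_left (hd.eqn x hx)

/-- A linear parametrization of the solutions of `d₄ + V d₀ = 0` by their data at `p`. -/
theorem exists_fundamental_system {p q : ℝ} (hpq : p ≤ q) {V : ℝ → ℝ}
    (hV : ContinuousOn V (Icc p q)) :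
    ∃ S : (Fin 4 → ℂ) →ₗ[ℂ] (ℕ → ℝ → ℂ), ∀ z, IsSolution p q V (S z) ∧ ∀ j : Fin 4, S z j p = z j := by
  have h : ∀ i : Fin 4, ∃ d : ℕ → ℝ → ℂ, IsSolution p q V d ∧
      ∀ j : Fin 4, d j p = (Pi.single i 1 : Fin 4 → ℂ) j := by
    intro i
    obtain ⟨d, h1, h2, h3⟩ := exists_jet hpq hV (f := fun _ => 0) intervalIntegrable_const (Pi.single i 1)
    exact ⟨d, ⟨h1, fun x _ => by rw [h3]; simp⟩, h2⟩
  choose φ hφ hφp using h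
  refine ⟨∑ i, (LinearMap.proj i : (Fin 4 → ℂ) →ₗ[ℂ] ℂ).smulRight (φ i), fun z => ?_⟩
  have e : (∑ i, (LinearMap.proj i : (Fin 4 → ℂ) →ₗ[ℂ] ℂ).smulRight (φ i)) z
      = ∑ i, z i • φ i := by
    rw [LinearMap.sum_apply]; rfl
  rw [e]
  constructor
  · rw [Fin.sum_univ_four]
    exact ((((hφ 0).const_smul _).add hpq ((hφ 1).const_smul _)).add hpq
      ((hφ 2).const_smul _)).add hpq ((hφ 3).const_smul _)
  · intro j
    simp [Finset.sum_apply, hφp, Pi.single_apply]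

/-- Two jets with the same data at `p` differ by at most the size of the defect of their
difference. -/
theorem jetNorm_sub_le {p q : ℝ} (hpq : p ≤ q) {V : ℝ → ℝ} (hV : ContinuousOn V (Icc p q)) :
    ∃ C : ℝ, 0 < C ∧ ∀ q' ∈ Icc p q, ∀ d : ℕ → ℝ → ℂ, IsJet p q' d → ∀ x ∈ Icc p q',
      jetNorm d x ≤ C * (jetNorm d p + ∫ t in p..q', ‖d 4 t + V t * d 0 t‖) := by
  obtain ⟨M, hM⟩ := isCompact_Icc.exists_bound_of_continuousOn hV
  have hM0 : 0 ≤ M := (norm_nonneg _).trans (hM p (left_mem_Icc.2 hpq))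
  -- The exponent uses the full length `q - p`, so one constant serves all `q'`. The outer regions
  -- `[a, -ε]` and `[ε, b]` vary with ε.
  refine ⟨Real.exp ((M + 1) * (q - p)), Real.exp_pos _, fun q' hq' d hd x hx => ?_⟩
  have := hd.jetNorm_le hq'.1 (hV.mono (Icc_subset_Icc_right hq'.2))
    (fun x hx => hM x ⟨hx.1, hx.2.trans hq'.2⟩) x hx
  refine this.trans ?_
  rw [mul_comm]
  have h0 : 0 ≤ ∫ t in p..q', ‖d 4 t + V t * d 0 t‖ :=
    intervalIntegral.integral_nonneg hq'.1 fun _ _ => norm_nonneg _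
  have h1 := jetNorm_nonneg d p
  gcongr
  exact hx.2.trans hq'.2

/-- A right inverse of `B` on its range is bounded in finite dimension; subtracting it applied to `B
z` lands in the kernel. This turns "almost satisfies the boundary conditions" into "is close to an
exact solution", both for the resonance problem and for the interface conditions. -/
theorem exists_mem_ker_norm_sub_le {E F : Type*} [NormedAddCommGroup E] [NormedSpace ℂ E]
    [NormedAddCommGroup F] [NormedSpace ℂ F] [FiniteDimensional ℂ E] [FiniteDimensional ℂ F]
    (B : E →ₗ[ℂ] F) : ∃ C : ℝ, 0 < C ∧ ∀ z, ∃ w ∈ LinearMap.ker B, ‖z - w‖ ≤ C * ‖B z‖ := by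
  obtain ⟨S, hS⟩ := B.rangeRestrict.exists_rightInverse_of_surjective B.range_rangeRestrict
  set S' := LinearMap.toContinuousLinearMap S with hS'
  refine ⟨‖S'‖ + 1, by positivity, fun z => ⟨z - S (B.rangeRestrict z), ?_, ?_⟩⟩
  · have h1 : B.rangeRestrict (S (B.rangeRestrict z)) = B.rangeRestrict z :=
      LinearMap.congr_fun hS _
    have h2 : B (S (B.rangeRestrict z)) = B z := congrArg Subtype.val h1
    rw [LinearMap.mem_ker, map_sub, h2, sub_self]
  · have h1 := S'.le_opNorm (B.rangeRestrict z)
    have h2 : ‖B.rangeRestrict z‖ = ‖B z‖ := rfl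
    rw [sub_sub_cancel]
    change ‖S' (B.rangeRestrict z)‖ ≤ _
    rw [h2] at h1
    nlinarith [norm_nonneg (B z)]


/-! ### Operators with compact resolvent -/

section Spectral

variable {H : Type*} [NormedAddCommGroup H] [InnerProductSpace ℂ H]

/-- `R = (A + K)⁻¹` is a compact operator, and `A` is symmetric and bounded below by `1 - K`. -/
structure HasCompactResolvent (A : H →ₗ.[ℂ] H) (R : H →L[ℂ] H) (K : ℝ) : Prop where
  compact : IsCompactOperator R
  mem_graph : ∀ u h, (u, h) ∈ A.graph ↔ u = R (h + (K : ℂ) • u)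
  symm : ∀ u h u' h', (u, h) ∈ A.graph → (u', h') ∈ A.graph → inner ℂ h u' = inner ℂ u h'
  lower : ∀ u h, (u, h) ∈ A.graph → (1 - K) * ‖u‖ ^ 2 ≤ (inner ℂ u h).re

/-- An orthonormal basis of eigenvectors of a symmetric operator, with finitely many eigenvalues
below each bound. -/
structure IsEigenbasis (A : H →ₗ.[ℂ] H) {ι : Type*} (e : HilbertBasis ι ℂ H) (ν : ι → ℝ) :
    Prop where
  mem_graph : ∀ i, (e i, (ν i : ℂ) • e i) ∈ A.graph
  symm : ∀ u h u' h', (u, h) ∈ A.graph → (u', h') ∈ A.graph → inner ℂ h u' = inner ℂ u h'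
  finite : ∀ m, {i | ν i < m}.Finite

theorem HasCompactResolvent.injective {A : H →ₗ.[ℂ] H} {R : H →L[ℂ] H} {K : ℝ}
    (hA : HasCompactResolvent A R K) {g : H} (hg : R g = 0) : g = 0 := by
  have h : ((0 : H), g) ∈ A.graph := by
    rw [hA.mem_graph, smul_zero, add_zero, hg]
  exact A.graph_fst_eq_zero_snd h rfl

theorem HasCompactResolvent.apply_mem_graph {A : H →ₗ.[ℂ] H} {R : H →L[ℂ] H} {K : ℝ}
    (hA : HasCompactResolvent A R K) (g : H) : (R g, g - (K : ℂ) • R g) ∈ A.graph := by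
  rw [hA.mem_graph, sub_add_cancel]

theorem HasCompactResolvent.isSymmetric {A : H →ₗ.[ℂ] H} {R : H →L[ℂ] H} {K : ℝ}
    (hA : HasCompactResolvent A R K) : R.IsSymmetric := by
  intro f g
  have h := hA.symm _ _ _ _ (hA.apply_mem_graph f) (hA.apply_mem_graph g)
  simp only [inner_sub_left, inner_sub_right, inner_smul_left, inner_smul_right,
    Complex.conj_ofReal] at h
  change inner ℂ (R f) g = inner ℂ f (R g)
  linear_combination -h

/-- An eigenvalue `μ` of `R` is nonzero by injectivity and real by symmetry, so `ν = 1 / μ - K` is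
an eigenvalue of `A`; the lower bound on the form of `A` then places `ν + K` in `[1, ∞)`. -/
theorem HasCompactResolvent.eigenvector {A : H →ₗ.[ℂ] H} {R : H →L[ℂ] H} {K : ℝ}
    (hA : HasCompactResolvent A R K) {μ : ℂ} {u : H} (hu : u ≠ 0) (h : R u = μ • u) :
    ∃ ν : ℝ, 1 ≤ ν + K ∧ μ = ((ν + K : ℝ) : ℂ)⁻¹ ∧ (u, (ν : ℂ) • u) ∈ A.graph := by
  have hμ : μ ≠ 0 := by
    rintro rfl
    exact hu (hA.injective (by simpa using h))
  have hev : Module.End.HasEigenvalue (R : H →ₗ[ℂ] H) μ :=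
    Module.End.hasEigenvalue_of_hasEigenvector (x := u)
      ⟨Module.End.mem_eigenspace_iff.2 h, hu⟩
  have hreal : (starRingEnd ℂ) μ = μ := hA.isSymmetric.conj_eigenvalue_eq_self hev
  obtain ⟨r, rfl⟩ := Complex.conj_eq_iff_real.1 hreal
  have hr : r ≠ 0 := by rintro rfl; simp at hμ
  have hmem : (u, ((r⁻¹ - K : ℝ) : ℂ) • u) ∈ A.graph := by
    rw [hA.mem_graph, ← add_smul]
    have : ((r⁻¹ - K : ℝ) : ℂ) + K = (r : ℂ)⁻¹ := by push_cast; ring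
    rw [this, map_smul, h, smul_smul, inv_mul_cancel₀ hμ, one_smul]
  refine ⟨r⁻¹ - K, ?_, ?_, hmem⟩
  · have h1 := hA.lower _ _ hmem
    have h2 : (inner ℂ u (((r⁻¹ - K : ℝ) : ℂ) • u)).re = (r⁻¹ - K) * ‖u‖ ^ 2 := by
      rw [inner_smul_right, inner_self_eq_norm_sq_to_K, Complex.re_ofReal_mul]
      norm_cast
    rw [h2] at h1
    have h3 : 0 < ‖u‖ ^ 2 := by positivity
    have := le_of_mul_le_mul_right h1 h3
    linarith
  · simp

/-- Otherwise `R` would map an infinite orthonormal sequence to orthogonal vectors of norm at least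
`c`, with mutual distances at least `c`, and no subsequence could converge. -/
theorem finite_of_isCompactOperator {R : H →L[ℂ] H} (hR : IsCompactOperator R) {ι : Type*}
    {e : ι → H} (he : Orthonormal ℂ e) {ρ : ι → ℂ} (hρ : ∀ i, R (e i) = ρ i • e i) {c : ℝ}
    (hc : 0 < c) : {i | c ≤ ‖ρ i‖}.Finite := by
  by_contra hinf
  have : Infinite {i | c ≤ ‖ρ i‖} := Set.infinite_coe_iff.2 hinf
  let s : ℕ ↪ {i | c ≤ ‖ρ i‖} := Infinite.natEmbedding _
  obtain ⟨Kc, hK, hsub⟩ := hR.image_closedBall_subset_compact 1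
  obtain ⟨y, -, φ, hφ, hy⟩ := hK.tendsto_subseq (x := fun n => R (e (s n)))
    (fun n => hsub ⟨e (s n), by simp [he.1], rfl⟩)
  obtain ⟨N, hN⟩ := (Metric.cauchySeq_iff.1 hy.cauchySeq) c hc
  have h1 := hN N le_rfl (N + 1) (Nat.le_succ N)
  have hne : ((s (φ N)) : ι) ≠ s (φ (N + 1)) := by
    intro h
    exact (hφ (Nat.lt_succ_self N)).ne (s.injective (Subtype.ext h))
  simp only [Function.comp] at h1
  rw [dist_eq_norm, hρ, hρ] at h1
  have h0 : inner ℂ (ρ (s (φ N)) • e (s (φ N))) (ρ (s (φ (N + 1))) • e (s (φ (N + 1)))) = 0 := by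
    rw [inner_smul_left, inner_smul_right, he.2 hne]
    simp
  have h2 := norm_sub_sq (𝕜 := ℂ) (ρ (s (φ N)) • e (s (φ N)))
    (ρ (s (φ (N + 1))) • e (s (φ (N + 1))))
  rw [h0] at h2
  simp only [norm_smul, he.1, mul_one, map_zero, mul_zero, sub_zero] at h2
  have h3 : c ≤ ‖ρ (s (φ N))‖ := (s (φ N)).2
  have h4 : 0 ≤ ‖ρ (s (φ (N + 1)))‖ := norm_nonneg _
  nlinarith [norm_nonneg (ρ (s (φ N)) • e (s (φ N)) - ρ (s (φ (N + 1))) • e (s (φ (N + 1))))]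

/-- The spectral theorem for the compact symmetric operator `R`. Injectivity excludes the eigenvalue
zero, the only one whose eigenspace could be infinite-dimensional, so orthonormal bases of the
eigenspaces combine into a basis of `H`. -/
theorem HasCompactResolvent.exists_isEigenbasis [CompleteSpace H] {A : H →ₗ.[ℂ] H} {R : H →L[ℂ] H}
    {K : ℝ} (hA : HasCompactResolvent A R K) :
    ∃ (ι : Type) (e : HilbertBasis ι ℂ H) (ν : ι → ℝ), IsEigenbasis A e ν := by
  have hfd : ∀ μ : ℂ, FiniteDimensional ℂ (Module.End.eigenspace (R : H →ₗ[ℂ] H) μ) := by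
    intro μ
    by_cases hμ : μ = 0
    · subst hμ
      have : Module.End.eigenspace (R : H →ₗ[ℂ] H) 0 = ⊥ := by
        rw [eq_bot_iff]
        intro x hx
        rw [Module.End.mem_eigenspace_iff, zero_smul] at hx
        exact hA.injective hx
      rw [this]
      infer_instance
    · exact ContinuousLinearMap.finite_dimensional_eigenspace hA.compact μ hμ
  have hon := hA.isSymmetric.orthogonalFamily_eigenspaces.orthonormal_sigma_orthonormal
    (v_family := fun μ => stdOrthonormalBasis ℂ (Module.End.eigenspace (R : H →ₗ[ℂ] H) μ))
    (fun μ => (stdOrthonormalBasis ℂ _).orthonormal)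
  set v : (Σ μ : ℂ, Fin (Module.finrank ℂ (Module.End.eigenspace (R : H →ₗ[ℂ] H) μ))) → H :=
    fun a => (stdOrthonormalBasis ℂ (Module.End.eigenspace (R : H →ₗ[ℂ] H) a.1) a.2 : H) with hv
  have hon' : Orthonormal ℂ v := hon
  have hsp : (Submodule.span ℂ (Set.range v))ᗮ = ⊥ := by
    rw [eq_bot_iff, ← ContinuousLinearMap.orthogonalComplement_iSup_eigenspaces_eq_bot hA.compact
      hA.isSymmetric]
    refine Submodule.orthogonal_le (iSup_le fun μ x hx => ?_)
    have h1 := (stdOrthonormalBasis ℂ (Module.End.eigenspace (R : H →ₗ[ℂ] H) μ)).sum_repr ⟨x, hx⟩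
    have h2 := congrArg Subtype.val h1
    rw [Submodule.coe_sum] at h2
    change _ = x at h2
    rw [← h2]
    exact Submodule.sum_mem _ fun i _ => Submodule.smul_mem _ _
      (Submodule.subset_span ⟨⟨μ, i⟩, rfl⟩)
  have hev : ∀ a, R (v a) = a.1 • v a := fun a =>
    Module.End.mem_eigenspace_iff.1 (stdOrthonormalBasis ℂ _ a.2).2
  have hex := fun a => hA.eigenvector (hon'.ne_zero a) (hev a)
  choose ν hν1 hν2 hν3 using hex
  let e := HilbertBasis.mkOfOrthogonalEqBot hon' hsp
  have he : ⇑e = v := HilbertBasis.coe_mkOfOrthogonalEqBot hon' hsp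
  refine ⟨_, e, ν, fun i => by rw [he]; exact hν3 i, hA.symm, fun m => ?_⟩
  -- `ν i < m` means that the eigenvalue `1 / (ν i + K)` of `R` exceeds `1 / (m + K)`; the maximum
  -- with `1` keeps the threshold positive when `m + K ≤ 0`.
  have hfin := finite_of_isCompactOperator hA.compact hon' hev (c := (max (m + K) 1)⁻¹)
    (by positivity)
  refine hfin.subset fun i hi => ?_
  have hi' : ν i < m := hi
  have h1 := hν1 i
  change _ ≤ ‖i.1‖
  rw [hν2 i, norm_inv, Complex.norm_real, Real.norm_eq_abs, abs_of_pos (by linarith)]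
  gcongr
  exact le_max_of_le_left (by linarith)

theorem IsEigenbasis.inner_eq {A : H →ₗ.[ℂ] H} {ι : Type*} {e : HilbertBasis ι ℂ H} {ν : ι → ℝ}
    (hA : IsEigenbasis A e ν) {u h : H} (hu : (u, h) ∈ A.graph) (i : ι) :
    inner ℂ (e i) h = (ν i : ℂ) * inner ℂ (e i) u := by
  rw [← hA.symm _ _ _ _ (hA.mem_graph i) hu, inner_smul_left, Complex.conj_ofReal]

theorem hasSum_normSq_inner {ι : Type*} (e : HilbertBasis ι ℂ H) (u : H) :
    HasSum (fun i => ‖inner ℂ (e i) u‖ ^ 2) (‖u‖ ^ 2) := by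
  have h := Complex.hasSum_re (e.hasSum_inner_mul_inner u u)
  have e1 : (inner ℂ u u : ℂ).re = ‖u‖ ^ 2 := by
    rw [inner_self_eq_norm_sq_to_K]; norm_cast
  rw [e1] at h
  convert h using 2 with i
  rw [← inner_conj_symm u (e i), Complex.conj_mul']
  norm_cast

theorem IsEigenbasis.hasSum_form {A : H →ₗ.[ℂ] H} {ι : Type*} {e : HilbertBasis ι ℂ H} {ν : ι → ℝ}
    (hA : IsEigenbasis A e ν) {u h : H} (hu : (u, h) ∈ A.graph) :
    HasSum (fun i => ν i * ‖inner ℂ (e i) u‖ ^ 2) (inner ℂ u h).re := by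
  have h := Complex.hasSum_re (e.hasSum_inner_mul_inner u h)
  convert h using 2 with i
  rw [hA.inner_eq hu, ← inner_conj_symm u (e i), mul_left_comm, Complex.conj_mul',
    Complex.re_ofReal_mul]
  norm_cast

theorem IsEigenbasis.mul_normSq_le {A : H →ₗ.[ℂ] H} {ι : Type*} {e : HilbertBasis ι ℂ H}
    {ν : ι → ℝ} (hA : IsEigenbasis A e ν) {u h : H} (hu : (u, h) ∈ A.graph) {t : ℝ}
    (ht : ∀ i, ν i < t → inner ℂ (e i) u = 0) : t * ‖u‖ ^ 2 ≤ (inner ℂ u h).re := by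
  refine hasSum_le (fun i => ?_) ((hasSum_normSq_inner e u).mul_left t) (hA.hasSum_form hu)
  rcases lt_or_ge (ν i) t with hi | hi
  · simp [ht i hi]
  · gcongr

theorem IsEigenbasis.le_mul_normSq {A : H →ₗ.[ℂ] H} {ι : Type*} {e : HilbertBasis ι ℂ H}
    {ν : ι → ℝ} (hA : IsEigenbasis A e ν) {u h : H} (hu : (u, h) ∈ A.graph) {t : ℝ}
    (ht : ∀ i, t < ν i → inner ℂ (e i) u = 0) : (inner ℂ u h).re ≤ t * ‖u‖ ^ 2 := by
  refine hasSum_le (fun i => ?_) (hA.hasSum_form hu) ((hasSum_normSq_inner e u).mul_left t)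
  rcases lt_or_ge t (ν i) with hi | hi
  · simp [ht i hi]
  · gcongr

/-- If no eigenvalue is `δ`-close to `lam`, then `A - lam` is onto and bounded below by `δ`. -/
theorem HasCompactResolvent.exists_solve [CompleteSpace H] {A : H →ₗ.[ℂ] H} {R : H →L[ℂ] H} {K : ℝ}
    (hA : HasCompactResolvent A R K) {ι : Type*} {e : HilbertBasis ι ℂ H} {ν : ι → ℝ}
    (he : IsEigenbasis A e ν) {lam δ : ℝ} (hδ : 0 < δ) (hgap : ∀ i, δ ≤ |ν i - lam|) (f : H) :
    ∃ u, (u, f + (lam : ℂ) • u) ∈ A.graph ∧ δ * ‖u‖ ≤ ‖f‖ := by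
  have hsurj : ∃ u, (u, f + (lam : ℂ) • u) ∈ A.graph := by
    -- The equation reads `u = R (f + (lam + K) u)`. It is explicit when `lam + K = 0`; otherwise
    -- the Fredholm alternative for `R` at `(lam + K)⁻¹` decides.
    by_cases hκ : lam + K = 0
    · refine ⟨R f, ?_⟩
      rw [hA.mem_graph, add_assoc, ← add_smul]
      have : (lam : ℂ) + K = 0 := by exact_mod_cast hκ
      rw [this, zero_smul, add_zero]
    · have hκ' : (lam : ℂ) + K ≠ 0 := by exact_mod_cast hκ
      rcases hA.compact.hasEigenvalue_or_mem_resolventSet (inv_ne_zero hκ') with h | h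
      -- An eigenvector of `R` here would be an eigenvector of `A` for `lam`. The gap makes all its
      -- coefficients in the eigenbasis vanish.
      · exfalso
        obtain ⟨w, hw⟩ := h.exists_hasEigenvector
        obtain ⟨ν', h1, h2, h3⟩ := hA.eigenvector hw.2 (Module.End.mem_eigenspace_iff.1 hw.1)
        have h4 : ν' = lam := by
          have h5 := inv_injective h2
          have : lam + K = ν' + K := by exact_mod_cast h5
          linarith
        subst h4
        refine hw.2 ?_
        have h5 : ∀ i, inner ℂ (e i) w = 0 := by
          intro i
          have h6 := he.inner_eq h3 i
          rw [inner_smul_right] at h6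
          have h7 : ((ν i : ℂ) - ν') * inner ℂ (e i) w = 0 := by linear_combination -h6
          refine (mul_eq_zero.1 h7).resolve_left fun h8 => ?_
          have h9 : ν i - ν' = 0 := by exact_mod_cast h8
          have := hgap i
          rw [h9, abs_zero] at this
          linarith
        have h6 := hasSum_normSq_inner e w
        simp only [h5, norm_zero, ne_eq, OfNat.ofNat_ne_zero, not_false_eq_true, zero_pow] at h6
        have := h6.unique hasSum_zero
        simpa using this
      · have hu := spectrum.mem_resolventSet_iff.1 h
        rw [ContinuousLinearMap.isUnit_iff_bijective] at hu
        obtain ⟨u, hu⟩ := hu.2 (((lam : ℂ) + K)⁻¹ • R f)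
        refine ⟨u, ?_⟩
        rw [hA.mem_graph, add_assoc, ← add_smul, map_add, map_smul]
        have h2 : ((lam : ℂ) + K)⁻¹ • u - R u = ((lam : ℂ) + K)⁻¹ • R f := by
          simpa [Algebra.algebraMap_eq_smul_one] using hu
        have h3 := congrArg (fun x => ((lam : ℂ) + K) • x) h2
        simp only [smul_sub, smul_smul, mul_inv_cancel₀ hκ', one_smul] at h3
        rw [← h3]
        abel
  obtain ⟨u, hu⟩ := hsurj
  refine ⟨u, hu, ?_⟩
  have h1 : ∀ i, inner ℂ (e i) f = ((ν i - lam : ℝ) : ℂ) * inner ℂ (e i) u := by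
    intro i
    have := he.inner_eq hu i
    rw [inner_add_right, inner_smul_right] at this
    push_cast
    linear_combination this
  have h2 : δ ^ 2 * ‖u‖ ^ 2 ≤ ‖f‖ ^ 2 := by
    refine hasSum_le (fun i => ?_) ((hasSum_normSq_inner e u).mul_left (δ ^ 2))
      (hasSum_normSq_inner e f)
    rw [h1, norm_mul, Complex.norm_real, Real.norm_eq_abs, mul_pow]
    gcongr
    exact hgap i
  rw [← mul_pow] at h2
  exact le_of_sq_le_sq h2 (norm_nonneg f)

/-- Comparison of the eigenvalue counts of two operators whose forms differ by at most `η`. -/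
theorem IsEigenbasis.ncard_le {A A' : H →ₗ.[ℂ] H} {ι ι' : Type*}
    {e : HilbertBasis ι ℂ H} {ν : ι → ℝ} {e' : HilbertBasis ι' ℂ H} {ν' : ι' → ℝ}
    (hA : IsEigenbasis A e ν) (hA' : IsEigenbasis A' e' ν') {η s t : ℝ}
    (hcomp : ∀ u h', (u, h') ∈ A'.graph → ∃ h, (u, h) ∈ A.graph ∧
      (inner ℂ u h).re ≤ (inner ℂ u h').re + η * ‖u‖ ^ 2)
    (hst : s + η < t) : {i | ν' i ≤ s}.ncard ≤ {i | ν i < t}.ncard := by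
  by_contra! hlt
  have hfin : {i | ν i < t}.Finite := hA.finite t
  have hfin' : {i | ν' i ≤ s}.Finite :=
    (hA'.finite (s + 1)).subset fun i (hi : ν' i ≤ s) => by
      change ν' i < s + 1
      linarith
  have := hfin.fintype
  have := hfin'.fintype
  -- Min-max by dimension count: `L` sends a combination of low eigenvectors of `A'` to its
  -- components along the low eigenvectors of `A`. If the count inequality failed, `L` would have a
  -- kernel, that is, a nonzero `u` whose form for `A'` is at most `s ‖u‖²` and for `A` at least `t
  -- ‖u‖²`.
  let L : ({i | ν' i ≤ s} → ℂ) →ₗ[ℂ] ({i | ν i < t} → ℂ) :=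
    LinearMap.pi fun j => ∑ i, (LinearMap.proj i).smulRight (inner ℂ (e j) (e' i))
  have hker : LinearMap.ker L ≠ ⊥ := by
    apply LinearMap.ker_ne_bot_of_finrank_lt
    rw [Module.finrank_fintype_fun_eq_card, Module.finrank_fintype_fun_eq_card,
      ← Nat.card_eq_fintype_card, ← Nat.card_eq_fintype_card]
    exact hlt
  obtain ⟨c, hc, hc0⟩ := (Submodule.ne_bot_iff _).1 hker
  set u : H := ∑ i, c i • e' i with hu
  set h' : H := ∑ i, c i • ((ν' i : ℂ) • e' i) with hh'
  have hmem : (u, h') ∈ A'.graph := by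
    have : (u, h') = ∑ i, c i • ((e' i : H), (ν' i : ℂ) • e' i) := by
      simp only [Prod.smul_mk, hu, hh']
      ext
      · rw [Prod.fst_sum]
      · rw [Prod.snd_sum]
    rw [this]
    exact Submodule.sum_mem _ fun i _ => Submodule.smul_mem _ _ (hA'.mem_graph i)
  have hu0 : u ≠ 0 := by
    intro h0
    apply hc0
    have hli : LinearIndependent ℂ (fun i : {i | ν' i ≤ s} => e' i) :=
      e'.orthonormal.linearIndependent.comp _ Subtype.val_injective
    funext i
    exact Fintype.linearIndependent_iff.1 hli c h0 i
  obtain ⟨h, hAh, hcmp⟩ := hcomp u h' hmem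
  have h1 : t * ‖u‖ ^ 2 ≤ (inner ℂ u h).re := by
    refine hA.mul_normSq_le hAh fun j hj => ?_
    have := congrFun (LinearMap.mem_ker.1 hc) ⟨j, hj⟩
    simp only [L, LinearMap.pi_apply, LinearMap.sum_apply, LinearMap.smulRight_apply,
      LinearMap.proj_apply, Pi.zero_apply, smul_eq_mul] at this
    rw [hu, inner_sum]
    simpa only [inner_smul_right] using this
  have h2 : (inner ℂ u h').re ≤ s * ‖u‖ ^ 2 := by
    refine hA'.le_mul_normSq hmem fun j hj => ?_
    rw [hu, inner_sum]
    refine Finset.sum_eq_zero fun i _ => ?_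
    have hne : j ≠ i := by
      rintro rfl
      exact absurd i.2 (not_le.2 hj)
    rw [inner_smul_right, e'.orthonormal.2 hne, mul_zero]
  have h3 : 0 < ‖u‖ ^ 2 := by positivity
  nlinarith

theorem IsEigenbasis.eigenspace_eq_span {A : H →ₗ.[ℂ] H} {ι : Type*} {e : HilbertBasis ι ℂ H}
    {ν : ι → ℝ} (hA : IsEigenbasis A e ν) (x : ℝ) :
    eigenspace A x = Submodule.span ℂ (e '' {i | ν i = x}) := by
  apply le_antisymm
  · intro u hu
    have hu' : (u, (x : ℂ) • u) ∈ A.graph := hu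
    have hfin : {i | ν i = x}.Finite := (hA.finite (x + 1)).subset fun i (hi : ν i = x) => by
      change ν i < x + 1
      linarith
    have h0 : ∀ i, ν i ≠ x → inner ℂ (e i) u = 0 := by
      intro i hi
      have h6 := hA.inner_eq hu' i
      rw [inner_smul_right] at h6
      have h7 : ((ν i : ℂ) - x) * inner ℂ (e i) u = 0 := by linear_combination -h6
      refine (mul_eq_zero.1 h7).resolve_left fun h8 => hi ?_
      have h9 : ν i - x = 0 := by exact_mod_cast h8
      linarith
    have h1 := e.hasSum_repr u
    simp only [HilbertBasis.repr_apply_apply] at h1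
    have h2 : HasSum (fun i => inner ℂ (e i) u • e i) (∑ i ∈ hfin.toFinset, inner ℂ (e i) u • e i) :=
      hasSum_sum_of_ne_finset_zero fun i hi => by
        rw [h0 i (by simpa using hi), zero_smul]
    rw [h1.unique h2]
    exact Submodule.sum_mem _ fun i hi => Submodule.smul_mem _ _
      (Submodule.subset_span ⟨i, by simpa using hi, rfl⟩)
  · rw [Submodule.span_le]
    rintro _ ⟨i, hi, rfl⟩
    have := hA.mem_graph i
    rw [show ν i = x from hi] at this
    exact this

theorem IsEigenbasis.iSup_eigenspace {A : H →ₗ.[ℂ] H} {ι : Type*} {e : HilbertBasis ι ℂ H}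
    {ν : ι → ℝ} (hA : IsEigenbasis A e ν) (P : ℝ → Prop) :
    (⨆ (x : ℝ) (_ : P x), eigenspace A x) = Submodule.span ℂ (e '' {i | P (ν i)}) := by
  apply le_antisymm
  · refine iSup₂_le fun x hx => ?_
    rw [hA.eigenspace_eq_span]
    exact Submodule.span_mono (image_mono fun i (hi : ν i = x) => by
      change P (ν i); rwa [hi])
  · rw [Submodule.span_le]
    rintro _ ⟨i, hi, rfl⟩
    exact Submodule.mem_iSup_of_mem (ν i) (Submodule.mem_iSup_of_mem hi (hA.mem_graph i))

theorem rank_span_image_hilbertBasis {ι : Type*} (e : HilbertBasis ι ℂ H) {s : Set ι}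
    (hs : s.Finite) : Module.rank ℂ (Submodule.span ℂ (e '' s)) = (s.ncard : Cardinal) := by
  have hli : LinearIndependent ℂ (fun i : s => e i) :=
    e.orthonormal.linearIndependent.comp _ Subtype.val_injective
  have h1 : e '' s = Set.range (fun i : s => e i) := by
    ext x; simp
  rw [← Set.ncard_image_of_injective s e.orthonormal.linearIndependent.injective,
    Set.cast_ncard (hs.image e), h1, rank_span hli]

/-- The threshold `m` separates `ν i₀` from all eigenvalues below it. Counting below a fixed `m`,
not below the moving `ν i₀`, gives an expression for the index that can be compared for different
operators. -/
theorem IsEigenbasis.isKthEigenvalue {A : H →ₗ.[ℂ] H} {ι : Type*} {e : HilbertBasis ι ℂ H}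
    {ν : ι → ℝ} (hA : IsEigenbasis A e ν) {m : ℝ} {i₀ : ι} (hm : m ≤ ν i₀)
    (h : ∀ i, i ≠ i₀ → ν i < m ∨ ν i₀ < ν i) :
    IsKthEigenvalue A ({i | ν i < m}.ncard + 1) (ν i₀) := by
  have hlt : {i | ν i < ν i₀} = {i | ν i < m} := by
    ext i
    refine ⟨fun (hi : ν i < ν i₀) => ?_, fun (hi : ν i < m) => hi.trans_le hm⟩
    rcases h i (by rintro rfl; exact lt_irrefl _ hi) with h1 | h1
    · exact h1
    · exact absurd hi h1.not_gt
  have hle : {i | ν i ≤ ν i₀} = insert i₀ {i | ν i < m} := by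
    ext i
    simp only [mem_ofPred_eq, mem_insert_iff]
    constructor
    · intro hi
      by_cases hi0 : i = i₀
      · exact Or.inl hi0
      · rcases h i hi0 with h1 | h1
        · exact Or.inr h1
        · exact absurd hi h1.not_ge
    · rintro (rfl | hi)
      · exact le_rfl
      · exact hi.le.trans hm
  have hfin := hA.finite m
  refine ⟨?_, ?_, ?_⟩
  · rw [Submodule.ne_bot_iff]
    exact ⟨e i₀, hA.mem_graph i₀, e.orthonormal.ne_zero i₀⟩
  · rw [hA.iSup_eigenspace (fun x => x < ν i₀), hlt, rank_span_image_hilbertBasis e hfin]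
    exact_mod_cast Nat.lt_succ_self _
  · rw [hA.iSup_eigenspace (fun x => x ≤ ν i₀), hle, rank_span_image_hilbertBasis e (hfin.insert _),
      Set.ncard_insert_of_notMem (by simpa using hm) hfin]

theorem IsEigenbasis.isSimpleEigenvalue {A : H →ₗ.[ℂ] H} {ι : Type*} {e : HilbertBasis ι ℂ H}
    {ν : ι → ℝ} (hA : IsEigenbasis A e ν) {i₀ : ι} (h : ∀ i, i ≠ i₀ → ν i ≠ ν i₀) :
    IsSimpleEigenvalue A (ν i₀) := by
  have : {i | ν i = ν i₀} = {i₀} := by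
    ext i
    simp only [mem_ofPred_eq, mem_singleton_iff]
    exact ⟨fun hi => by_contra fun hne => h i hne hi, fun hi => by rw [hi]⟩
  rw [IsSimpleEigenvalue, hA.eigenspace_eq_span, this, image_singleton]
  exact finrank_span_singleton (e.orthonormal.ne_zero i₀)

end Spectral


/-! ### The space `L₂(a, b)` -/

theorem inner_eq_intervalIntegral {a b : ℝ} (hab : a ≤ b) {f g : L2 a b} {F G : ℝ → ℂ}
    (hf : f =ᵐ[volume.restrict (Ioo a b)] F) (hg : g =ᵐ[volume.restrict (Ioo a b)] G) :
    inner ℂ f g = ∫ t in a..b, starRingEnd ℂ (F t) * G t := by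
  rw [L2.inner_def, intervalIntegral.integral_of_le hab, integral_Ioc_eq_integral_Ioo]
  refine integral_congr_ae ?_
  filter_upwards [hf, hg] with t h1 h2
  rw [h1, h2, RCLike.inner_apply']

theorem memLp_of_continuousOn {a b : ℝ} {F : ℝ → ℂ} (hF : ContinuousOn F (Icc a b)) :
    MemLp F 2 (volume.restrict (Ioo a b)) := by
  obtain ⟨C, hC⟩ := isCompact_Icc.exists_bound_of_continuousOn hF
  refine MemLp.of_bound ((hF.mono Ioo_subset_Icc_self).aestronglyMeasurable measurableSet_Ioo) C ?_
  exact (ae_restrict_iff' measurableSet_Ioo).2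
    (Filter.Eventually.of_forall fun x hx => hC x (Ioo_subset_Icc_self hx))

theorem norm_sq_eq_intervalIntegral {a b : ℝ} (hab : a ≤ b) {f : L2 a b} {F : ℝ → ℂ}
    (hf : f =ᵐ[volume.restrict (Ioo a b)] F) : ‖f‖ ^ 2 = ∫ t in a..b, ‖F t‖ ^ 2 := by
  have h1 := inner_eq_intervalIntegral hab hf hf
  rw [inner_self_eq_norm_sq_to_K] at h1
  have h2 : ∀ t, starRingEnd ℂ (F t) * F t = ((‖F t‖ ^ 2 : ℝ) : ℂ) := fun t => by
    rw [Complex.conj_mul']; norm_cast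
  simp only [h2] at h1
  rw [intervalIntegral.integral_ofReal] at h1
  exact Complex.ofReal_injective (by rw [← h1]; norm_cast)

theorem intervalIntegrable_of_memLp {a b : ℝ} (hab : a ≤ b) {F : ℝ → ℂ}
    (hF : MemLp F 2 (volume.restrict (Ioo a b))) : IntervalIntegrable F volume a b := by
  rw [intervalIntegrable_iff_integrableOn_Ioo_of_le hab]
  exact hF.integrable (by norm_num)

theorem continuousOn_ofReal_mul {a b : ℝ} {V : ℝ → ℝ} {F : ℝ → ℂ} (hV : ContinuousOn V (Icc a b))
    (hF : ContinuousOn F (Icc a b)) : ContinuousOn (fun x => (V x : ℂ) * F x) (Icc a b) :=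
  (Complex.continuous_ofReal.comp_continuousOn hV).mul hF

/-! ### The operator `d⁴/dx⁴ + V` has compact resolvent -/

/-- The Dirichlet conditions at both endpoints. -/
structure IsDirichletJet (a b : ℝ) (d : ℕ → ℝ → ℂ) : Prop where
  jet : IsJet a b d
  left0 : d 0 a = 0
  left1 : d 1 a = 0
  right0 : d 0 b = 0
  right1 : d 1 b = 0

theorem mem_dirichletOperator_graph {a b : ℝ} (hab : a ≤ b) {V : ℝ → ℝ}
    {u h : L2 a b} : (u, h) ∈ (dirichletOperator a b hab V).graph ↔
    ∃ d, IsDirichletJet a b d ∧ MemLp (d 4) 2 (volume.restrict (Ioo a b)) ∧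
      u =ᵐ[volume.restrict (Ioo a b)] d 0 ∧
      h =ᵐ[volume.restrict (Ioo a b)] fun x => d 4 x + V x * d 0 x := by
  rw [dirichletOperator_graph]
  constructor
  · rintro ⟨d, hd, h1, h2, h3, h4⟩
    exact ⟨d, ⟨hd.jet.isJet hab, h1, h2, h3, h4⟩, hd.jet.memLp, hd.eq_zero, hd.eq_op⟩
  · rintro ⟨d, hd, hm, hu, hh⟩
    exact ⟨d, ⟨⟨fun j hj => (hd.jet.prim j hj).ftc, hm⟩, hu, hh⟩, hd.left0, hd.left1, hd.right0,
      hd.right1⟩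

theorem IsDirichletJet.green {a b : ℝ} (hab : a ≤ b) {d e : ℕ → ℝ → ℂ} (hd : IsDirichletJet a b d)
    (he : IsDirichletJet a b e) :
    ∫ t in a..b, starRingEnd ℂ (e 0 t) * d 4 t =
      ∫ t in a..b, starRingEnd ℂ (e 4 t) * d 0 t := by
  have h := hd.jet.green hab he.jet.conj
  simp only [hd.left0, hd.left1, hd.right0, hd.right1, he.left0, he.left1, he.right0, he.right1,
    map_zero, mul_zero, zero_mul, sub_zero, add_zero, zero_add] at h
  rw [← h]
  congr 1; ext t; ring

theorem IsDirichletJet.green_half {a b : ℝ} (hab : a ≤ b) {d : ℕ → ℝ → ℂ}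
    (hd : IsDirichletJet a b d) :
    ∫ t in a..b, starRingEnd ℂ (d 0 t) * d 4 t = ((∫ t in a..b, ‖d 2 t‖ ^ 2 : ℝ) : ℂ) := by
  have h := hd.jet.green_half hab hd.jet.conj
  simp only [hd.left0, hd.left1, hd.right0, hd.right1,
    map_zero, mul_zero, sub_zero, zero_add] at h
  rw [← intervalIntegral.integral_ofReal]
  convert h using 2
  · ext t; ring
  · ext t; rw [Complex.mul_conj']; norm_cast

theorem dirichletOperator_symm {a b : ℝ} (hab : a ≤ b) {V : ℝ → ℝ} (hV : ContinuousOn V (Icc a b))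
    {u h u' h' : L2 a b} (hu : (u, h) ∈ (dirichletOperator a b hab V).graph)
    (hu' : (u', h') ∈ (dirichletOperator a b hab V).graph) : inner ℂ h u' = inner ℂ u h' := by
  obtain ⟨d, hd, -, h1, h2⟩ := (mem_dirichletOperator_graph hab).1 hu
  obtain ⟨e, he, -, h3, h4⟩ := (mem_dirichletOperator_graph hab).1 hu'
  rw [inner_eq_intervalIntegral hab h2 h3, inner_eq_intervalIntegral hab h1 h4]
  have hcd := hd.jet.continuousOn hab (j := 0) (by norm_num)
  have hce := he.jet.continuousOn hab (j := 0) (by norm_num)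
  have i1 : IntervalIntegrable (fun t => starRingEnd ℂ (d 4 t) * e 0 t) volume a b :=
    ((hd.jet.conj.prim 3 (by norm_num)).int).mul_continuousOn (by rwa [uIcc_of_le hab])
  have i2 : IntervalIntegrable (fun t => starRingEnd ℂ (d 0 t) * e 4 t) volume a b :=
    ((he.jet.prim 3 (by norm_num)).int).continuousOn_mul
      (by rw [uIcc_of_le hab]; exact hd.jet.conj.continuousOn hab (j := 0) (by norm_num))
  have i3 : IntervalIntegrable (fun t => V t * (starRingEnd ℂ (d 0 t) * e 0 t)) volume a b := by
    apply ContinuousOn.intervalIntegrable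
    rw [uIcc_of_le hab]
    exact continuousOn_ofReal_mul hV
      ((hd.jet.conj.continuousOn hab (j := 0) (by norm_num)).mul hce)
  have e1 : ∀ t, starRingEnd ℂ (d 4 t + V t * d 0 t) * e 0 t =
      starRingEnd ℂ (d 4 t) * e 0 t + V t * (starRingEnd ℂ (d 0 t) * e 0 t) := fun t => by
    simp only [map_add, map_mul, Complex.conj_ofReal]; ring
  have e2 : ∀ t, starRingEnd ℂ (d 0 t) * (e 4 t + V t * e 0 t) =
      starRingEnd ℂ (d 0 t) * e 4 t + V t * (starRingEnd ℂ (d 0 t) * e 0 t) := fun t => by ring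
  simp only [e1, e2]
  rw [intervalIntegral.integral_add i1 i3, intervalIntegral.integral_add i2 i3, he.green hab hd]

theorem dirichletOperator_form {a b : ℝ} (hab : a ≤ b) {V : ℝ → ℝ} (hV : ContinuousOn V (Icc a b))
    {d : ℕ → ℝ → ℂ} (hd : IsDirichletJet a b d) {u h : L2 a b}
    (hu : u =ᵐ[volume.restrict (Ioo a b)] d 0)
    (hh : h =ᵐ[volume.restrict (Ioo a b)] fun x => d 4 x + V x * d 0 x) :
    (inner ℂ u h).re = (∫ t in a..b, ‖d 2 t‖ ^ 2) + ∫ t in a..b, V t * ‖d 0 t‖ ^ 2 := by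
  rw [inner_eq_intervalIntegral hab hu hh]
  have i2 : IntervalIntegrable (fun t => starRingEnd ℂ (d 0 t) * d 4 t) volume a b :=
    ((hd.jet.prim 3 (by norm_num)).int).continuousOn_mul
      (by rw [uIcc_of_le hab]; exact hd.jet.conj.continuousOn hab (j := 0) (by norm_num))
  have i3 : IntervalIntegrable (fun t => V t * (starRingEnd ℂ (d 0 t) * d 0 t)) volume a b := by
    apply ContinuousOn.intervalIntegrable
    rw [uIcc_of_le hab]
    exact continuousOn_ofReal_mul hV ((hd.jet.conj.continuousOn hab (j := 0) (by norm_num)).mul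
      (hd.jet.continuousOn hab (by norm_num)))
  have e2 : ∀ t, starRingEnd ℂ (d 0 t) * (d 4 t + V t * d 0 t) =
      starRingEnd ℂ (d 0 t) * d 4 t + V t * (starRingEnd ℂ (d 0 t) * d 0 t) := fun t => by ring
  simp only [e2]
  rw [intervalIntegral.integral_add i2 i3, hd.green_half hab]
  have e3 : ∀ t, (V t : ℂ) * (starRingEnd ℂ (d 0 t) * d 0 t) = ((V t * ‖d 0 t‖ ^ 2 : ℝ) : ℂ) :=
    fun t => by rw [Complex.conj_mul']; norm_cast
  simp only [e3]
  rw [intervalIntegral.integral_ofReal]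
  simp

/-- Two integrations by parts and `V ≥ -M`. This inequality is the source of the lower bound on the
form, of the invertibility of `A + M + 1` and of the compactness of the inverse. -/
theorem dirichletOperator_energy {a b : ℝ} (hab : a ≤ b) {V : ℝ → ℝ} {M : ℝ}
    (hV : ContinuousOn V (Icc a b)) (hM : ∀ x ∈ Icc a b, |V x| ≤ M)
    {d : ℕ → ℝ → ℂ} (hd : IsDirichletJet a b d) {u h : L2 a b}
    (hu : u =ᵐ[volume.restrict (Ioo a b)] d 0)
    (hh : h =ᵐ[volume.restrict (Ioo a b)] fun x => d 4 x + V x * d 0 x) :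
    (∫ t in a..b, ‖d 2 t‖ ^ 2) ≤ (inner ℂ u h).re + M * ‖u‖ ^ 2 := by
  rw [dirichletOperator_form hab hV hd hu hh, norm_sq_eq_intervalIntegral hab hu]
  have hc := hd.jet.continuousOn hab (j := 0) (by norm_num)
  have i1 : IntervalIntegrable (fun t => V t * ‖d 0 t‖ ^ 2) volume a b := by
    apply ContinuousOn.intervalIntegrable
    rw [uIcc_of_le hab]
    exact hV.mul (hc.norm.pow 2)
  have i2 : IntervalIntegrable (fun t => M * ‖d 0 t‖ ^ 2) volume a b := by
    apply ContinuousOn.intervalIntegrable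
    rw [uIcc_of_le hab]
    exact continuousOn_const.mul (hc.norm.pow 2)
  have : 0 ≤ ∫ t in a..b, (V t * ‖d 0 t‖ ^ 2 + M * ‖d 0 t‖ ^ 2) := by
    refine intervalIntegral.integral_nonneg hab fun t ht => ?_
    rw [← add_mul]
    have := neg_le_of_abs_le (hM t ht)
    have : 0 ≤ V t + M := by linarith
    positivity
  rw [intervalIntegral.integral_add i1 i2, intervalIntegral.integral_const_mul] at this
  linarith

/-- The Dirichlet jets are controlled by their second derivative. -/
theorem IsDirichletJet.norm_le {a b : ℝ} (hab : a ≤ b) {d : ℕ → ℝ → ℂ} (hd : IsDirichletJet a b d)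
    {E : ℝ} (hE : ∫ t in a..b, ‖d 2 t‖ ^ 2 ≤ E) :
    ∀ x ∈ Icc a b, ‖d 1 x‖ ≤ (b - a) + E ∧ ‖d 0 x‖ ≤ ((b - a) + E) * (b - a) := by
  have h2c := hd.jet.continuousOn hab (j := 2) (by norm_num)
  have h1c := hd.jet.continuousOn hab (j := 1) (by norm_num)
  have i0 : IntervalIntegrable (fun t => ‖d 2 t‖) volume a b :=
    ContinuousOn.intervalIntegrable (by rw [uIcc_of_le hab]; exact h2c.norm)
  have i1 : IntervalIntegrable (fun t => ‖d 2 t‖ ^ 2) volume a b :=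
    ContinuousOn.intervalIntegrable (by rw [uIcc_of_le hab]; exact h2c.norm.pow 2)
  have i2 : IntervalIntegrable (fun t => 1 + ‖d 2 t‖ ^ 2) volume a b :=
    intervalIntegrable_const.add i1
  -- The crude bound `s ≤ 1 + s²` replaces the Cauchy–Schwarz inequality: a bound on the image of
  -- the unit ball is all that compactness requires.
  have key : ∫ t in a..b, ‖d 2 t‖ ≤ (b - a) + E := by
    have : ∫ t in a..b, ‖d 2 t‖ ≤ ∫ t in a..b, (1 + ‖d 2 t‖ ^ 2) :=
      intervalIntegral.integral_mono_on hab i0 i2 fun t _ => by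
        nlinarith [sq_nonneg (‖d 2 t‖ - 1), norm_nonneg (d 2 t)]
    rw [intervalIntegral.integral_add intervalIntegrable_const i1] at this
    simp only [intervalIntegral.integral_const, smul_eq_mul, mul_one] at this
    linarith
  have hd1 : ∀ x ∈ Icc a b, ‖d 1 x‖ ≤ (b - a) + E := by
    intro x hx
    have h := (hd.jet.prim 1 (by norm_num)).norm_le hx
    rw [hd.left1, norm_zero, zero_add] at h
    refine h.trans (le_trans ?_ key)
    exact intervalIntegral.integral_mono_interval le_rfl hx.1 hx.2
      (Filter.Eventually.of_forall fun _ => norm_nonneg _) i0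
  refine fun x hx => ⟨hd1 x hx, ?_⟩
  have h := (hd.jet.prim 0 (by norm_num)).ftc x hx
  rw [hd.left0, zero_add] at h
  rw [h]
  have h3 := intervalIntegral.norm_integral_le_of_norm_le_const (a := a) (b := x)
    (f := d (0 + 1)) (C := (b - a) + E) fun t ht => by
      rw [uIoc_of_le hx.1] at ht
      exact hd1 t ⟨ht.1.le, ht.2.trans hx.2⟩
  refine h3.trans ?_
  have h4 : 0 ≤ (b - a) + E := (norm_nonneg _).trans (hd1 x hx)
  gcongr
  rw [abs_of_nonneg (by linarith [hx.1])]
  linarith [hx.2]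

/-- Functions in `L₂(a, b)` with a uniformly bounded and Lipschitz representative form a relatively
compact set. -/
theorem exists_isCompact_of_lipschitz {a b : ℝ} (hab : a ≤ b) (C : ℝ) :
    ∃ S : Set (L2 a b), IsCompact S ∧ ∀ (u : L2 a b) (F : ℝ → ℂ),
      u =ᵐ[volume.restrict (Ioo a b)] F → (∀ x ∈ Icc a b, ‖F x‖ ≤ C) →
      (∀ x ∈ Icc a b, ∀ y ∈ Icc a b, ‖F x - F y‖ ≤ C * |x - y|) → u ∈ S := by
  let A : Set (BoundedContinuousFunction (Icc a b) ℂ) :=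
    {g | (∀ x, ‖g x‖ ≤ C) ∧ ∀ x y, ‖g x - g y‖ ≤ C * |(x : ℝ) - y|}
  have hA : IsCompact (closure A) := by
    refine BoundedContinuousFunction.arzela_ascoli (Metric.closedBall 0 C)
      (isCompact_closedBall _ _) A (fun f x hf => by simpa using hf.1 x) ?_
    refine (LipschitzWith.uniformEquicontinuous _ (Real.toNNReal C) fun g => ?_).equicontinuous
    refine LipschitzWith.of_dist_le_mul fun x y => ?_
    rw [dist_eq_norm]
    refine (g.2.2 x y).trans ?_
    rw [Subtype.dist_eq, Real.dist_eq]
    gcongr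
    exact Real.le_coe_toNNReal C
  -- Arzelà–Ascoli gives compactness in the uniform norm on `[a, b]`; `J` carries it continuously
  -- into `L₂(a, b)`.
  let J : BoundedContinuousFunction (Icc a b) ℂ → L2 a b := fun g =>
    BoundedContinuousFunction.toLp 2 (volume.restrict (Ioo a b)) ℂ
      (g.compContinuous ⟨projIcc a b hab, continuous_projIcc⟩)
  have hJ : Continuous J := (ContinuousLinearMap.continuous _).comp
    (BoundedContinuousFunction.continuous_compContinuous _)
  refine ⟨J '' closure A, hA.image hJ, fun u F hu hb hl => ?_⟩
  have hFc : ContinuousOn F (Icc a b) := by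
    have : LipschitzOnWith (Real.toNNReal C) F (Icc a b) :=
      LipschitzOnWith.of_dist_le_mul fun x hx y hy => by
        rw [dist_eq_norm, Real.dist_eq]
        exact (hl x hx y hy).trans (by gcongr; exact Real.le_coe_toNNReal C)
    exact this.continuousOn
  let g : BoundedContinuousFunction (Icc a b) ℂ := BoundedContinuousFunction.mkOfCompact
    ⟨fun x => F x, continuousOn_iff_continuous_domRestrict.1 hFc⟩
  have hg : ∀ x : Icc a b, g x = F x := fun x => rfl
  refine ⟨g, subset_closure ⟨fun x => by rw [hg]; exact hb x x.2,
    fun x y => by rw [hg, hg]; exact hl x x.2 y y.2⟩, ?_⟩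
  apply Lp.ext
  refine (BoundedContinuousFunction.coeFn_toLp 2 _ ℂ _).trans (Filter.EventuallyEq.trans ?_ hu.symm)
  refine (ae_restrict_iff' measurableSet_Ioo).2 (Filter.Eventually.of_forall fun x hx => ?_)
  rw [BoundedContinuousFunction.compContinuous_apply]
  simp only [ContinuousMap.coe_mk]
  rw [hg, projIcc_of_mem hab (Ioo_subset_Icc_self hx)]

/-- The energy inequality says that the form of `A + M + 1` is at least `‖u‖²`; the Cauchy–Schwarz
inequality does the rest. -/
theorem dirichletOperator_injective {a b : ℝ} (hab : a ≤ b) {V : ℝ → ℝ} {M : ℝ}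
    (hV : ContinuousOn V (Icc a b)) (hM : ∀ x ∈ Icc a b, |V x| ≤ M) {u h : L2 a b}
    (hu : (u, h) ∈ (dirichletOperator a b hab V).graph) :
    ‖u‖ ≤ ‖h + ((M + 1 : ℝ) : ℂ) • u‖ := by
  obtain ⟨d, hd, -, h1, h2⟩ := (mem_dirichletOperator_graph hab).1 hu
  have hE := dirichletOperator_energy hab hV hM hd h1 h2
  have h0 : 0 ≤ ∫ t in a..b, ‖d 2 t‖ ^ 2 :=
    intervalIntegral.integral_nonneg hab fun _ _ => by positivity
  have e1 : (inner ℂ u (h + ((M + 1 : ℝ) : ℂ) • u)).re = (inner ℂ u h).re + (M + 1) * ‖u‖ ^ 2 := by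
    rw [inner_add_right, inner_smul_right, inner_self_eq_norm_sq_to_K, Complex.add_re,
      Complex.re_ofReal_mul]
    norm_cast
  have e2 : ‖u‖ ^ 2 ≤ ‖u‖ * ‖h + ((M + 1 : ℝ) : ℂ) • u‖ := by
    calc ‖u‖ ^ 2 ≤ (inner ℂ u (h + ((M + 1 : ℝ) : ℂ) • u)).re := by rw [e1]; linarith
      _ ≤ ‖inner ℂ u (h + ((M + 1 : ℝ) : ℂ) • u)‖ := Complex.re_le_norm _
      _ ≤ _ := norm_inner_le_norm _ _
  rcases (norm_nonneg u).eq_or_lt with h3 | h3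
  · rw [← h3]; positivity
  · rw [sq] at e2
    exact le_of_mul_le_mul_left e2 h3

/-- Shooting from `a`: to a particular solution with zero data at `a` one adds a homogeneous
solution with data `(0, 0, z₀, z₁)` so as to meet the two conditions at `b`. The 2×2 system for `z`
is injective by coercivity, hence solvable. -/
theorem dirichletOperator_surjective {a b : ℝ} (hab : a < b) {V : ℝ → ℝ} {M : ℝ}
    (hV : ContinuousOn V (Icc a b)) (hM : ∀ x ∈ Icc a b, |V x| ≤ M) (f : L2 a b) :
    ∃ u, (u, f - ((M + 1 : ℝ) : ℂ) • u) ∈ (dirichletOperator a b hab.le V).graph := by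
  have hV' : ContinuousOn (fun x => V x + (M + 1)) (Icc a b) := hV.add continuousOn_const
  have hmem : ∀ (g : L2 a b) (d : ℕ → ℝ → ℂ), IsDirichletJet a b d →
      (∀ᵐ x ∂volume.restrict (Ioo a b), d 4 x = g x - (V x + (M + 1) : ℝ) * d 0 x) →
      ∃ u : L2 a b, u =ᵐ[volume.restrict (Ioo a b)] d 0 ∧
        (u, g - ((M + 1 : ℝ) : ℂ) • u) ∈ (dirichletOperator a b hab.le V).graph := by
    intro g d hd hg
    have hc := hd.jet.continuousOn hab.le (j := 0) (by norm_num)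
    have hm := memLp_of_continuousOn hc
    have hm' := memLp_of_continuousOn (continuousOn_ofReal_mul hV' hc)
    have hu : (hm.toLp : L2 a b) =ᵐ[volume.restrict (Ioo a b)] d 0 := hm.coeFn_toLp
    refine ⟨hm.toLp, hu, (mem_dirichletOperator_graph hab.le).2 ⟨d, hd, ?_, hu, ?_⟩⟩
    · exact ((Lp.memLp g).sub hm').ae_eq (by filter_upwards [hg] with x hx; rw [hx]; rfl)
    · filter_upwards [Lp.coeFn_sub g (((M + 1 : ℝ) : ℂ) • (hm.toLp : L2 a b)),
        Lp.coeFn_smul ((M + 1 : ℝ) : ℂ) (hm.toLp : L2 a b), hu, hg] with x h1 h2 h3 h4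
      rw [h1, Pi.sub_apply, h2, Pi.smul_apply, h3, h4, smul_eq_mul]
      push_cast
      ring
  have hfi : IntervalIntegrable f volume a b := intervalIntegrable_of_memLp hab.le (Lp.memLp f)
  obtain ⟨y, hy, hyp, hy4⟩ := exists_jet hab.le hV' hfi 0
  obtain ⟨S, hS⟩ := exists_fundamental_system hab.le hV'
  let ι : (Fin 2 → ℂ) →ₗ[ℂ] (Fin 4 → ℂ) :=
    LinearMap.pi ![0, 0, LinearMap.proj 0, LinearMap.proj 1]
  let B : (Fin 2 → ℂ) →ₗ[ℂ] (Fin 2 → ℂ) := LinearMap.pi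
    ![(LinearMap.proj b).comp ((LinearMap.proj 0).comp (S.comp ι)),
      (LinearMap.proj b).comp ((LinearMap.proj 1).comp (S.comp ι))]
  have hB0 : ∀ z, B z 0 = S (ι z) 0 b := fun z => rfl
  have hB1 : ∀ z, B z 1 = S (ι z) 1 b := fun z => rfl
  have hι0 : ∀ z, S (ι z) 0 a = 0 := fun z => (hS (ι z)).2 0
  have hι1 : ∀ z, S (ι z) 1 a = 0 := fun z => (hS (ι z)).2 1
  have hι2 : ∀ z, S (ι z) 2 a = z 0 := fun z => (hS (ι z)).2 2
  have hι3 : ∀ z, S (ι z) 3 a = z 1 := fun z => (hS (ι z)).2 3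
  have hinj : LinearMap.ker B = ⊥ := by
    rw [LinearMap.ker_eq_bot']
    intro z hz
    have hd : IsDirichletJet a b (S (ι z)) := ⟨(hS (ι z)).1.jet, hι0 z, hι1 z,
      by rw [← hB0, hz]; rfl, by rw [← hB1, hz]; rfl⟩
    obtain ⟨u, hu, hg⟩ := hmem 0 _ hd (by
      refine (ae_restrict_iff' measurableSet_Ioo).2 ?_
      filter_upwards [(ae_restrict_iff' measurableSet_Ioo).1 (Lp.coeFn_zero ℂ 2
        (volume.restrict (Ioo a b)))] with x hx hxI
      rw [hx hxI, Pi.zero_apply, zero_sub]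
      exact eq_neg_of_add_eq_zero_left ((hS (ι z)).1.eqn x (Ioo_subset_Icc_self hxI)))
    have h1 := dirichletOperator_injective hab.le hV hM hg
    rw [sub_add_cancel, norm_zero] at h1
    have h2 : u = 0 := norm_le_zero_iff.1 h1
    have h3 : S (ι z) 0 =ᵐ[volume.restrict (Ioo a b)] 0 := by
      refine hu.symm.trans ?_
      rw [h2]
      exact Lp.coeFn_zero _ _ _
    have h4 : ∀ j < 4, S (ι z) j =ᵐ[volume.restrict (Ioo a b)] 0 := by
      have p := (hS (ι z)).1.jet.prim
      have s0 := ae_eq_zero_of_primitive hab.le (p 0 (by norm_num)).int (p 0 (by norm_num)).ftc h3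
      have s1 := ae_eq_zero_of_primitive hab.le (p 1 (by norm_num)).int (p 1 (by norm_num)).ftc s0
      have s2 := ae_eq_zero_of_primitive hab.le (p 2 (by norm_num)).int (p 2 (by norm_num)).ftc s1
      intro j hj
      interval_cases j <;> assumption
    have h5 : ∀ j < 4, S (ι z) j a = 0 := by
      intro j hj
      have hc := (hS (ι z)).1.jet.continuousOn hab.le hj
      have hz : EqOn (S (ι z) j) 0 (Ioo a b) :=
        Measure.eqOn_open_of_ae_eq (h4 j hj) isOpen_Ioo (hc.mono Ioo_subset_Icc_self)
          continuousOn_const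
      have h6 : EqOn (S (ι z) j) 0 (Icc a b) := by
        have := hz.of_subset_closure (t := Icc a b) hc continuousOn_const Ioo_subset_Icc_self
          (by rw [closure_Ioo hab.ne])
        exact this
      exact h6 (left_mem_Icc.2 hab.le)
    funext i
    fin_cases i
    · exact (hι2 z).symm.trans (h5 2 (by norm_num))
    · exact (hι3 z).symm.trans (h5 3 (by norm_num))
  have hsurj : Function.Surjective B :=
    LinearMap.injective_iff_surjective.1 (LinearMap.ker_eq_bot.1 hinj)
  obtain ⟨z, hz⟩ := hsurj ![-y 0 b, -y 1 b]
  have hz0 : S (ι z) 0 b = -y 0 b := by rw [← hB0, hz]; rfl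
  have hz1 : S (ι z) 1 b = -y 1 b := by rw [← hB1, hz]; rfl
  have hd : IsDirichletJet a b (y + S (ι z)) := by
    refine ⟨hy.add hab.le (hS _).1.jet, ?_, ?_, ?_, ?_⟩ <;> simp only [Pi.add_apply]
    · rw [hι0]; simpa using hyp 0
    · rw [hι1]; simpa using hyp 1
    · rw [hz0]; ring
    · rw [hz1]; ring
  obtain ⟨u, -, hu⟩ := hmem f _ hd (by
    refine (ae_restrict_iff' measurableSet_Ioo).2 (Filter.Eventually.of_forall fun x hx => ?_)
    simp only [Pi.add_apply]
    have := (hS (ι z)).1.eqn x (Ioo_subset_Icc_self hx)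
    rw [hy4]
    linear_combination this)
  exact ⟨u, hu⟩

/-- The inverse of `A + M + 1` is chosen pointwise; uniqueness makes it linear. It maps the unit
ball into functions with bounded energy, which are uniformly bounded and Lipschitz. -/
theorem dirichletOperator_hasCompactResolvent {a b : ℝ} (hab : a < b) {V : ℝ → ℝ}
    (hV : ContinuousOn V (Icc a b)) :
    ∃ (R : L2 a b →L[ℂ] L2 a b) (K : ℝ), HasCompactResolvent (dirichletOperator a b hab.le V) R K := by
  obtain ⟨M, hM⟩ := isCompact_Icc.exists_bound_of_continuousOn hV
  have hM0 : 0 ≤ M := (norm_nonneg _).trans (hM a (left_mem_Icc.2 hab.le))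
  choose R hR using dirichletOperator_surjective hab hV hM
  set A := dirichletOperator a b hab.le V with hA
  have huniq : ∀ f u, (u, f - ((M + 1 : ℝ) : ℂ) • u) ∈ A.graph → u = R f := by
    intro f u hu
    have h1 := A.graph.sub_mem hu (hR f)
    have h2 := dirichletOperator_injective hab.le hV hM h1
    have h3 : f - ((M + 1 : ℝ) : ℂ) • u - (f - ((M + 1 : ℝ) : ℂ) • R f)
        + ((M + 1 : ℝ) : ℂ) • (u - R f) = 0 := by
      rw [smul_sub]; abel
    rw [h3, norm_zero] at h2
    exact sub_eq_zero.1 (norm_le_zero_iff.1 h2)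
  have hadd : ∀ f g, R (f + g) = R f + R g := by
    intro f g
    refine (huniq _ _ ?_).symm
    have := A.graph.add_mem (hR f) (hR g)
    convert this using 1
    simp only [Prod.mk_add_mk, smul_add]
    congr 1
    abel
  have hsmul : ∀ (c : ℂ) f, R (c • f) = c • R f := by
    intro c f
    refine (huniq _ _ ?_).symm
    have := A.graph.smul_mem c (hR f)
    convert this using 1
    simp only [Prod.smul_mk, smul_sub, smul_comm c]
  have hnorm : ∀ f, ‖R f‖ ≤ 1 * ‖f‖ := by
    intro f
    have := dirichletOperator_injective hab.le hV hM (hR f)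
    rwa [sub_add_cancel, ← one_mul ‖f‖] at this
  let Rl : L2 a b →L[ℂ] L2 a b :=
    LinearMap.mkContinuous { toFun := R, map_add' := hadd, map_smul' := hsmul } 1 hnorm
  have hRl : ∀ f, Rl f = R f := fun f => rfl
  have hlow : ∀ u h, (u, h) ∈ A.graph → (1 - (M + 1)) * ‖u‖ ^ 2 ≤ (inner ℂ u h).re := by
    intro u h hu
    obtain ⟨d, hd, -, h1, h2⟩ := (mem_dirichletOperator_graph hab.le).1 hu
    have hE := dirichletOperator_energy hab.le hV hM hd h1 h2
    have h0 : 0 ≤ ∫ t in a..b, ‖d 2 t‖ ^ 2 :=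
      intervalIntegral.integral_nonneg hab.le fun _ _ => by positivity
    linarith
  refine ⟨Rl, M + 1, ?_, ?_, fun u h u' h' => dirichletOperator_symm hab.le hV, hlow⟩
  · obtain ⟨S, hS, hmem⟩ := exists_isCompact_of_lipschitz hab.le
      (max ((b - a) + 1) (((b - a) + 1) * (b - a)))
    refine ⟨S, hS, Filter.mem_of_superset (Metric.closedBall_mem_nhds 0 one_pos) fun f hf => ?_⟩
    have hf1 : ‖f‖ ≤ 1 := by simpa using hf
    obtain ⟨d, hd, -, h1, h2⟩ := (mem_dirichletOperator_graph hab.le).1 (hR f)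
    have hE := dirichletOperator_energy hab.le hV hM hd h1 h2
    -- The terms in `M` cancel: the energy is at most `Re ⟨R f, f⟩ - ‖R f‖²`, and `‖R f‖ ≤ ‖f‖ ≤ 1`.
    have hE1 : ∫ t in a..b, ‖d 2 t‖ ^ 2 ≤ 1 := by
      have e1 : (inner ℂ (R f) (f - ((M + 1 : ℝ) : ℂ) • R f)).re =
          (inner ℂ (R f) f).re - (M + 1) * ‖R f‖ ^ 2 := by
        rw [inner_sub_right, inner_smul_right, inner_self_eq_norm_sq_to_K, Complex.sub_re,
          Complex.re_ofReal_mul]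
        norm_cast
      rw [e1] at hE
      have e2 : (inner ℂ (R f) f).re ≤ ‖R f‖ * ‖f‖ :=
        (Complex.re_le_norm _).trans (norm_inner_le_norm _ _)
      have e3 := hnorm f
      nlinarith [norm_nonneg f, norm_nonneg (R f), sq_nonneg ‖R f‖]
    have hb := hd.norm_le hab.le hE1
    refine hmem (R f) (d 0) h1 (fun x hx => ((hb x hx).2).trans (le_max_right _ _))
      fun x hx y hy => ?_
    rw [(hd.jet.prim 0 (by norm_num)).sub_eq hab.le hy hx, abs_sub_comm, abs_sub_comm]
    refine intervalIntegral.norm_integral_le_of_norm_le_const fun t ht => ?_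
    have ht' : t ∈ Icc a b := uIcc_subset_Icc hy hx (uIoc_subset_uIcc ht)
    exact (hb t ht').1.trans (le_max_left _ _)
  · intro u h
    rw [hRl]
    constructor
    · intro hu
      refine huniq _ _ ?_
      rwa [add_sub_cancel_right]
    · intro hu
      have := hR (h + ((M + 1 : ℝ) : ℂ) • u)
      rwa [← hu, add_sub_cancel_right] at this


/-! ### Jets as vectors -/

/-- The values of `d 0, …, d 3` at `x`. -/
def jetVec (d : ℕ → ℝ → ℂ) (x : ℝ) : Fin 4 → ℂ := fun j => d j x

theorem norm_jetVec_le (d : ℕ → ℝ → ℂ) (x : ℝ) : ‖jetVec d x‖ ≤ jetNorm d x :=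
  (pi_norm_le_iff_of_nonneg (jetNorm_nonneg d x)).2 fun j => norm_le_jetNorm d x j.2

theorem jetNorm_le_norm_jetVec (d : ℕ → ℝ → ℂ) (x : ℝ) : jetNorm d x ≤ 4 * ‖jetVec d x‖ := by
  have h : ∀ j : Fin 4, ‖d j x‖ ≤ ‖jetVec d x‖ := fun j => norm_le_pi_norm (jetVec d x) j
  have h0 := h 0
  have h1 := h 1
  have h2 := h 2
  have h3 := h 3
  simp only [Fin.isValue, Fin.val_zero, Fin.val_one, Fin.val_two] at h0 h1 h2
  have e3 : ((3 : Fin 4) : ℕ) = 3 := rfl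
  rw [e3] at h3
  unfold jetNorm
  linarith

theorem jetNorm_add_le (d e : ℕ → ℝ → ℂ) (x : ℝ) :
    jetNorm (d + e) x ≤ jetNorm d x + jetNorm e x := by
  unfold jetNorm
  simp only [Pi.add_apply]
  linarith [norm_add_le (d 0 x) (e 0 x), norm_add_le (d 1 x) (e 1 x), norm_add_le (d 2 x) (e 2 x),
    norm_add_le (d 3 x) (e 3 x)]

theorem IsSolution.jetNorm_le {p q C : ℝ} {V : ℝ → ℝ}
    (hC : ∀ q' ∈ Icc p q, ∀ d : ℕ → ℝ → ℂ, IsJet p q' d → ∀ x ∈ Icc p q',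
      jetNorm d x ≤ C * (jetNorm d p + ∫ t in p..q', ‖d 4 t + V t * d 0 t‖)) (hpq : p ≤ q)
    {d : ℕ → ℝ → ℂ} (hd : IsSolution p q V d) : ∀ x ∈ Icc p q, jetNorm d x ≤ C * jetNorm d p := by
  intro x hx
  have h := hC q (right_mem_Icc.2 hpq) d hd.jet x hx
  have h0 : ∫ t in p..q, ‖d 4 t + V t * d 0 t‖ = 0 := by
    rw [intervalIntegral.integral_congr (g := fun _ => (0 : ℝ)) (fun t ht => ?_)]
    · simp
    · rw [uIcc_of_le hpq] at ht
      simp only [hd.eqn t ht, norm_zero]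
  rwa [h0, add_zero] at h

/-! ### Resonance solutions -/

theorem IsResonanceSolution.isJet {α : ℝ} {Ψ : ℝ → ℝ} (hΨ : Continuous Ψ) {w : ℕ → ℝ → ℂ}
    (hw : IsResonanceSolution α Ψ w) : IsJet (-1) 1 w := by
  refine isJet_of_hasDerivWithinAt (by norm_num) hw.hasDeriv ?_
  have : ContinuousOn (fun x => -((α : ℂ) * (Ψ x : ℂ) * w 0 x)) (Icc (-1) 1) :=
    ((continuous_const.mul (Complex.continuous_ofReal.comp hΨ)).continuousOn.mul
      fun x hx => (hw.hasDeriv 0 (by norm_num) x hx).continuousWithinAt).neg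
  exact this.congr fun x hx => eq_neg_of_add_eq_zero_left (hw.eqn x hx)

/-- An almost solution of the resonance problem is close to a solution. -/
theorem exists_resonanceSolution_near (α : ℝ) {Ψ : ℝ → ℝ} (hΨ : Continuous Ψ) :
    ∃ C : ℝ, 0 < C ∧ ∀ w : ℕ → ℝ → ℂ, IsJet (-1) 1 w → ∃ w', IsResonanceSolution α Ψ w' ∧
      ∀ ξ ∈ Icc (-1 : ℝ) 1, jetNorm (w - w') ξ ≤ C * (‖w 2 (-1)‖ + ‖w 3 (-1)‖ + ‖w 2 1‖ + ‖w 3 1‖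
        + ∫ ξ in (-1 : ℝ)..1, ‖w 4 ξ + (α * Ψ ξ : ℝ) * w 0 ξ‖) := by
  have h11 : (-1 : ℝ) ≤ 1 := by norm_num
  have hV : ContinuousOn (fun ξ => α * Ψ ξ) (Icc (-1) 1) := (continuous_const.mul hΨ).continuousOn
  obtain ⟨S, hS⟩ := exists_fundamental_system h11 hV
  obtain ⟨C₀, hC₀, hC⟩ := jetNorm_sub_le h11 hV
  -- `B` sends the data at `-1` of an exact solution to its four boundary values `w''(±1)`,
  -- `w'''(±1)`; its kernel parametrizes the solutions of the resonance problem.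
  let B : (Fin 4 → ℂ) →ₗ[ℂ] (Fin 4 → ℂ) := LinearMap.pi
    ![LinearMap.proj 2, LinearMap.proj 3, (LinearMap.proj 1).comp ((LinearMap.proj 2).comp S),
      (LinearMap.proj 1).comp ((LinearMap.proj 3).comp S)]
  have hB0 : ∀ z, B z 0 = z 2 := fun z => rfl
  have hB1 : ∀ z, B z 1 = z 3 := fun z => rfl
  have hB2 : ∀ z, B z 2 = S z 2 1 := fun z => rfl
  have hB3 : ∀ z, B z 3 = S z 3 1 := fun z => rfl
  have hvec : ∀ z, jetVec (S z) (-1) = z := fun z => funext (hS z).2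
  obtain ⟨C₁, hC₁, hker⟩ := exists_mem_ker_norm_sub_le B
  refine ⟨C₀ + 4 * C₀ * C₁ * (1 + C₀), by positivity, fun w hw => ?_⟩
  set G := ∫ ξ in (-1 : ℝ)..1, ‖w 4 ξ + (α * Ψ ξ : ℝ) * w 0 ξ‖ with hG
  have hG0 : 0 ≤ G := intervalIntegral.integral_nonneg h11 fun _ _ => norm_nonneg _
  set b := ‖w 2 (-1)‖ + ‖w 3 (-1)‖ + ‖w 2 1‖ + ‖w 3 1‖ with hb
  have n1 := norm_nonneg (w 2 (-1))
  have n2 := norm_nonneg (w 3 (-1))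
  have n3 := norm_nonneg (w 2 1)
  have n4 := norm_nonneg (w 3 1)
  set z := jetVec w (-1) with hz
  -- Two corrections: from `w` to the exact solution `S z` with the same data at `-1`, at the cost
  -- of the defect; then from `z` to the kernel of `B`, at the cost of the boundary values.
  obtain ⟨z', hz', hzz'⟩ := hker z
  have hE : ∀ ξ ∈ Icc (-1 : ℝ) 1, jetNorm (w - S z) ξ ≤ C₀ * G := by
    intro ξ hξ
    have h1 := hC 1 (right_mem_Icc.2 h11) (w - S z) (hw.sub h11 (hS z).1.jet) ξ hξ
    have h2 : jetNorm (w - S z) (-1) = 0 := by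
      have := jetNorm_le_norm_jetVec (w - S z) (-1)
      have h3 : jetVec (w - S z) (-1) = 0 := by
        have : jetVec (w - S z) (-1) = jetVec w (-1) - jetVec (S z) (-1) := rfl
        rw [this, hvec, hz, sub_self]
      rw [h3, norm_zero, mul_zero] at this
      exact le_antisymm this (jetNorm_nonneg _ _)
    have h3 : ∫ t in (-1 : ℝ)..1, ‖(w - S z) 4 t + (α * Ψ t : ℝ) * (w - S z) 0 t‖ = G := by
      refine intervalIntegral.integral_congr fun t ht => ?_
      rw [uIcc_of_le h11] at ht
      have := (hS z).1.eqn t ht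
      simp only [Pi.sub_apply]
      congr 1
      linear_combination -this
    rwa [h2, zero_add, h3] at h1
  have hBz : ‖B z‖ ≤ b + C₀ * G := by
    refine (pi_norm_le_iff_of_nonneg (by positivity)).2 fun i => ?_
    have hE1 := hE 1 (right_mem_Icc.2 h11)
    have key : ∀ j < 4, ‖S z j 1‖ ≤ ‖w j 1‖ + C₀ * G := by
      intro j hj
      have h1 := (norm_le_jetNorm (w - S z) 1 hj).trans hE1
      have h2 : S z j 1 = w j 1 - (w - S z) j 1 := by simp
      rw [h2]
      exact (norm_sub_le _ _).trans (by gcongr)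
    have p : 0 ≤ C₀ * G := by positivity
    have k2 := key 2 (by norm_num)
    have k3 := key 3 (by norm_num)
    fin_cases i
    · change ‖w 2 (-1)‖ ≤ _
      linarith
    · change ‖w 3 (-1)‖ ≤ _
      linarith
    · change ‖S z 2 1‖ ≤ _
      linarith
    · change ‖S z 3 1‖ ≤ _
      linarith
  refine ⟨S z', ?_, fun ξ hξ => ?_⟩
  · have hBz' : B z' = 0 := hz'
    have hsol := (hS z').1
    refine ⟨hsol.jet.hasDerivWithinAt (by norm_num) (hsol.continuousOn_four h11 hV), fun ξ hξ => ?_,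
      ⟨?_, ?_⟩, ?_, ?_⟩
    · have := hsol.eqn ξ hξ
      push_cast at this
      exact this
    · have h1 := (hS z').2 2
      have h2 := congrFun hBz' 0
      rw [hB0] at h2
      exact h1.trans h2
    · have h1 := (hS z').2 3
      have h2 := congrFun hBz' 1
      rw [hB1] at h2
      exact h1.trans h2
    · exact congrFun hBz' 2
    · exact congrFun hBz' 3
  · have e : w - S z' = (w - S z) + S (z - z') := by rw [map_sub]; abel
    rw [e]
    have h1 := (hS (z - z')).1.jetNorm_le hC h11 ξ hξ
    have h2 := jetNorm_le_norm_jetVec (S (z - z')) (-1)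
    rw [hvec] at h2
    have h3 := hE ξ hξ
    calc jetNorm ((w - S z) + S (z - z')) ξ ≤ C₀ * G + C₀ * (4 * (C₁ * (b + C₀ * G))) := by
          refine (jetNorm_add_le _ _ _).trans (add_le_add h3 (h1.trans ?_))
          gcongr
          refine h2.trans ?_
          gcongr
          exact hzz'.trans (by gcongr)
      _ ≤ (C₀ + 4 * C₀ * C₁ * (1 + C₀)) * (b + G) := by
          have hb0 : 0 ≤ b := by positivity
          have : 0 ≤ C₀ * b + 4 * C₀ * C₁ * (G + C₀ * b) := by positivity
          nlinarith

/-- Derivatives on a nondegenerate interval are unique. The nondegeneracy hypothesis speaks of the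
values of eigenfunctions only, and this passes proportionality on to the derivatives. -/
theorem eq_const_mul_of_hasDerivWithinAt {p q : ℝ} (hpq : p < q) {f g : ℕ → ℝ → ℂ} {n : ℕ}
    (hf : ∀ j < n, ∀ x ∈ Icc p q, HasDerivWithinAt (f j) (f (j + 1) x) (Icc p q) x)
    (hg : ∀ j < n, ∀ x ∈ Icc p q, HasDerivWithinAt (g j) (g (j + 1) x) (Icc p q) x) {c : ℂ}
    (h0 : ∀ x ∈ Icc p q, f 0 x = c * g 0 x) : ∀ j ≤ n, ∀ x ∈ Icc p q, f j x = c * g j x := by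
  intro j
  induction j with
  | zero => exact fun _ => h0
  | succ j ih =>
    intro hj x hx
    have h1 := hf j hj x hx
    have h2 := ((hg j hj x hx).const_mul c).congr (fun y hy => ih (by omega) y hy)
      (ih (by omega) x hx)
    exact (uniqueDiffOn_Icc hpq x hx).eq_deriv _ h1 h2

theorem IsResonanceSolution.const_mul {α : ℝ} {Ψ : ℝ → ℝ} {w : ℕ → ℝ → ℂ} (c : ℂ)
    (hw : IsResonanceSolution α Ψ w) : IsResonanceSolution α Ψ (fun j x => c * w j x) where
  hasDeriv j hj x hx := (hw.hasDeriv j hj x hx).const_mul c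
  eqn x hx := by linear_combination c * hw.eqn x hx
  bc_left := by simp [hw.bc_left]
  bc_right := by simp [hw.bc_right]

theorem IsResonanceSolution.conj {α : ℝ} {Ψ : ℝ → ℝ} {w : ℕ → ℝ → ℂ}
    (hw : IsResonanceSolution α Ψ w) :
    IsResonanceSolution α Ψ (fun j x => starRingEnd ℂ (w j x)) where
  hasDeriv j hj x hx :=
    Complex.conjCLE.toContinuousLinearMap.hasFDerivAt.comp_hasDerivWithinAt x (hw.hasDeriv j hj x hx)
  eqn x hx := by
    have := congrArg (starRingEnd ℂ) (hw.eqn x hx)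
    simpa using this
  bc_left := by simp [hw.bc_left]
  bc_right := by simp [hw.bc_right]

/-- A nondegenerate resonance has a real eigenfunction `φ` with `φ'(-1) = 1`, and all solutions are
multiples of it. -/
theorem exists_normalized_resonance {α : ℝ} {Ψ : ℝ → ℝ} (hα : α ∈ resonantSet Ψ)
    (hres : NondegenerateResonance α Ψ) :
    ∃ φ, IsResonanceEigenfunction α Ψ φ ∧ φ 1 (-1) = 1 ∧
      (∀ w, IsResonanceSolution α Ψ w → ∃ c : ℂ, ∀ j ≤ 4, ∀ ξ ∈ Icc (-1 : ℝ) 1,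
        w j ξ = c * φ j ξ) ∧
      ∀ j ≤ 4, ∀ ξ ∈ Icc (-1 : ℝ) 1, starRingEnd ℂ (φ j ξ) = φ j ξ := by
  obtain ⟨w, hw⟩ := hα
  have hw1 : w 1 (-1) ≠ 0 := left_ne_zero_of_mul (hres.2 w hw)
  have h11 : (-1 : ℝ) < 1 := by norm_num
  set φ : ℕ → ℝ → ℂ := fun j x => (w 1 (-1))⁻¹ * w j x with hφ
  have hφs : IsResonanceSolution α Ψ φ := hw.1.const_mul _
  have hφe : IsResonanceEigenfunction α Ψ φ := by
    obtain ⟨ξ, hξ, h⟩ := hw.2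
    exact ⟨hφs, ξ, hξ, mul_ne_zero (inv_ne_zero hw1) h⟩
  have hφ1 : φ 1 (-1) = 1 := inv_mul_cancel₀ hw1
  have hall : ∀ w, IsResonanceSolution α Ψ w → ∃ c : ℂ, ∀ j ≤ 4, ∀ ξ ∈ Icc (-1 : ℝ) 1,
      w j ξ = c * φ j ξ := by
    intro u hu
    by_cases h : ∃ ξ ∈ Icc (-1 : ℝ) 1, u 0 ξ ≠ 0
    · obtain ⟨c, hc⟩ := hres.1 φ u hφe ⟨hu, h⟩
      exact ⟨c, eq_const_mul_of_hasDerivWithinAt h11 hu.hasDeriv hφs.hasDeriv hc⟩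
    · push Not at h
      exact ⟨0, eq_const_mul_of_hasDerivWithinAt h11 hu.hasDeriv hφs.hasDeriv
        fun x hx => by rw [h x hx, zero_mul]⟩
  refine ⟨φ, hφe, hφ1, hall, ?_⟩
  -- The conjugate of `φ` is again a solution with derivative `1` at `-1`, so the factor is `1` and
  -- `φ` is real.
  obtain ⟨c, hc⟩ := hall _ hφs.conj
  have h1 := hc 1 (by norm_num) (-1) (left_mem_Icc.2 h11.le)
  rw [hφ1, map_one, mul_one] at h1
  intro j hj ξ hξ
  have := hc j hj ξ hξ
  rwa [← h1, one_mul] at this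


/-! ### The inner region -/

/-- The jet `ξ ↦ s ^ j d_j(s ξ)`. -/
noncomputable def rescale (s : ℝ) (d : ℕ → ℝ → ℂ) : ℕ → ℝ → ℂ :=
  fun j x => (s : ℂ) ^ j * d j (s * x)

theorem exists_norm_le_of_continuousOn {p q : ℝ} {f : ℝ → ℝ} (hf : ContinuousOn f (Icc p q)) :
    ∃ M : ℝ, 0 ≤ M ∧ ∀ x ∈ Icc p q, |f x| ≤ M := by
  obtain ⟨M, hM⟩ := isCompact_Icc.exists_bound_of_continuousOn hf
  exact ⟨max M 0, le_max_right _ _, fun x hx => (hM x hx).trans (le_max_left _ _)⟩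

/-- The profiles and coefficients of the singular part of the potential, with the regular part
`Q` of the potential near the origin. -/
structure InnerData where
  (α β γ₁ γ₂ r : ℝ)
  (Ψ Φ Υ₁ Υ₂ Q : ℝ → ℝ)
  cΨ : Continuous Ψ
  cΦ : Continuous Φ
  cΥ₁ : Continuous Υ₁
  cΥ₂ : Continuous Υ₂
  r_pos : 0 < r
  cQ : ContinuousOn Q (Icc (-r) r)

namespace InnerData

variable (D : InnerData)

/-- The full potential near the origin. -/
noncomputable def potential (ε x : ℝ) : ℝ :=
  D.Q x + regularization D.α D.β D.γ₁ D.γ₂ D.Ψ D.Φ D.Υ₁ D.Υ₂ ε x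

theorem continuous_regularization (ε : ℝ) :
    Continuous (regularization D.α D.β D.γ₁ D.γ₂ D.Ψ D.Φ D.Υ₁ D.Υ₂ ε) := by
  have h1 := D.cΨ
  have h2 := D.cΦ
  have h3 := D.cΥ₁
  have h4 := D.cΥ₂
  have hdiv : Continuous fun x : ℝ => x / ε := continuous_id.div_const ε
  unfold regularization
  fun_prop

theorem continuousOn_potential {ε : ℝ} (hε : ε ≤ D.r) :
    ContinuousOn (D.potential ε) (Icc (-ε) ε) :=
  (D.cQ.mono (Icc_subset_Icc (by linarith) hε)).add (D.continuous_regularization ε).continuousOn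

/-- `d` is a jet on `[-ε, ε]` whose boundary values and defect in the equation are at most `Y`. -/
structure Admissible (ε Y : ℝ) (d : ℕ → ℝ → ℂ) : Prop where
  pos : 0 < ε
  le_one : ε ≤ 1
  le_r : ε ≤ D.r
  jet : IsJet (-ε) ε d
  left : ‖jetVec d (-ε)‖ ≤ Y
  right : ‖jetVec d ε‖ ≤ Y
  defect : ∫ x in (-ε)..ε, ‖d 4 x + D.potential ε x * d 0 x‖ ≤ Y

variable {D}

theorem Admissible.nonneg {ε Y : ℝ} {d : ℕ → ℝ → ℂ} (h : D.Admissible ε Y d) : 0 ≤ Y :=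
  (norm_nonneg _).trans h.left

theorem Admissible.isJet_rescale {ε Y : ℝ} {d : ℕ → ℝ → ℂ} (h : D.Admissible ε Y d) :
    IsJet (-1) 1 (rescale ε d) :=
  IsJet.rescale h.pos (by have := h.jet; simpa using this)

theorem Admissible.norm_rescale_le {ε Y : ℝ} {d : ℕ → ℝ → ℂ} (h : D.Admissible ε Y d) {j : ℕ}
    (hj : j < 4) : ‖rescale ε d j (-1)‖ ≤ ε ^ j * Y ∧ ‖rescale ε d j 1‖ ≤ ε ^ j * Y := by
  have h0 := h.pos.le
  have h1 : ‖d j (-ε)‖ ≤ Y := (norm_le_pi_norm (jetVec d (-ε)) ⟨j, hj⟩).trans h.left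
  have h2 : ‖d j ε‖ ≤ Y := (norm_le_pi_norm (jetVec d ε) ⟨j, hj⟩).trans h.right
  simp only [rescale, norm_mul, norm_pow, Complex.norm_real, Real.norm_eq_abs, abs_of_nonneg h0,
    mul_neg, mul_one]
  constructor <;> gcongr

variable (D)

/-- Multiplied by ε⁴ and written in ξ = x/ε, the potential becomes αΨ + εβΦ + ε²γ₁Υ₁ + ε³γ₂Υ₂ + ε⁴Q.
The change of variable turns ε⁴ times the defect into a term of integral at most ε³Y. Moving the `Υ`
and `Q` terms to the right costs ε²m; moving the `Φ` term as well costs εm. -/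
theorem exists_defect_le : ∃ M : ℝ, 1 ≤ M ∧ ∀ ε Y d m, D.Admissible ε Y d →
    (∀ ξ ∈ Icc (-1 : ℝ) 1, ‖rescale ε d 0 ξ‖ ≤ m) →
    (∫ ξ in (-1 : ℝ)..1, ‖rescale ε d 4 ξ + (D.α * D.Ψ ξ : ℝ) * rescale ε d 0 ξ
      + (ε * (D.β * D.Φ ξ) : ℝ) * rescale ε d 0 ξ‖) ≤ M * (ε ^ 3 * Y + ε ^ 2 * m) ∧
    (∫ ξ in (-1 : ℝ)..1, ‖rescale ε d 4 ξ + (D.α * D.Ψ ξ : ℝ) * rescale ε d 0 ξ‖)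
      ≤ M * (ε ^ 2 * Y + ε * m) := by
  obtain ⟨B₀, hB₀, h₀⟩ := exists_norm_le_of_continuousOn (p := -1) (q := 1) D.cΦ.continuousOn
  obtain ⟨B₁, hB₁, h₁⟩ := exists_norm_le_of_continuousOn (p := -1) (q := 1) D.cΥ₁.continuousOn
  obtain ⟨B₂, hB₂, h₂⟩ := exists_norm_le_of_continuousOn (p := -1) (q := 1) D.cΥ₂.continuousOn
  obtain ⟨B₃, hB₃, h₃⟩ := exists_norm_le_of_continuousOn D.cQ
  set c := |D.β| * B₀ + |D.γ₁| * B₁ + |D.γ₂| * B₂ + B₃ with hc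
  have hc0 : 0 ≤ c := by positivity
  refine ⟨1 + 4 * c, by linarith, fun ε Y d m h hm => ?_⟩
  have hε := h.pos
  have hε1 := h.le_one
  have hY := h.nonneg
  have h11 : (-1 : ℝ) ≤ 1 := by norm_num
  have hm0 : 0 ≤ m := (norm_nonneg _).trans (hm 1 (right_mem_Icc.2 h11))
  set w := rescale ε d with hw
  have hwj : IsJet (-1) 1 w := h.isJet_rescale
  have hw0c := hwj.continuousOn h11 (j := 0) (by norm_num)
  have hw4 := (hwj.prim 3 (by norm_num)).int
  have hi : ∀ f : ℝ → ℝ, ContinuousOn f (Icc (-1) 1) →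
      IntervalIntegrable (fun ξ => (f ξ : ℂ) * w 0 ξ) volume (-1) 1 := fun f hf =>
    ContinuousOn.intervalIntegrable (by rw [uIcc_of_le h11]; exact continuousOn_ofReal_mul hf hw0c)
  have iΨ := hi (fun ξ => D.α * D.Ψ ξ) (continuous_const.mul D.cΨ).continuousOn
  have iΦ := hi (fun ξ => ε * (D.β * D.Φ ξ))
    (continuous_const.mul (continuous_const.mul D.cΦ)).continuousOn
  set g : ℝ → ℂ := fun x => d 4 x + D.potential ε x * d 0 x with hg
  have hgi : IntervalIntegrable g volume (-ε) ε := by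
    refine ((h.jet.prim 3 (by norm_num)).int).add (ContinuousOn.intervalIntegrable ?_)
    rw [uIcc_of_le (by linarith)]
    exact continuousOn_ofReal_mul (D.continuousOn_potential h.le_r)
      (h.jet.continuousOn (by linarith) (by norm_num))
  have hgi' : IntervalIntegrable (fun ξ => ‖g (ε * ξ)‖) volume (-1) 1 := by
    have := (hgi.comp_mul_left (c := ε)).norm
    simpa [neg_div, hε.ne'] using this
  have hgI : ε * ∫ ξ in (-1 : ℝ)..1, ‖g (ε * ξ)‖ ≤ Y := by
    rw [intervalIntegral.integral_comp_mul_left (fun x => ‖g x‖) hε.ne', smul_eq_mul,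
      mul_inv_cancel_left₀ hε.ne']
    simpa using h.defect
  have hmem : ∀ ξ ∈ Icc (-1 : ℝ) 1, ε * ξ ∈ Icc (-D.r) D.r := fun ξ hξ =>
    ⟨by nlinarith [hξ.1, hξ.2, h.le_r], by nlinarith [hξ.1, hξ.2, h.le_r]⟩
  have hid : ∀ ξ, w 4 ξ + (D.α * D.Ψ ξ : ℝ) * w 0 ξ + (ε * (D.β * D.Φ ξ) : ℝ) * w 0 ξ =
      (ε : ℂ) ^ 4 * g (ε * ξ) - (ε ^ 2 * (D.γ₁ * D.Υ₁ ξ + ε * (D.γ₂ * D.Υ₂ ξ)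
        + ε ^ 2 * D.Q (ε * ξ)) : ℝ) * w 0 ξ := by
    intro ξ
    have e : ε * ξ / ε = ξ := by field_simp
    have hεC : (ε : ℂ) ≠ 0 := by exact_mod_cast hε.ne'
    simp only [hw, rescale, hg, potential, regularization, e]
    push_cast
    field_simp
    ring
  have hbound : ∀ ξ ∈ Icc (-1 : ℝ) 1,
      ‖w 4 ξ + (D.α * D.Ψ ξ : ℝ) * w 0 ξ + (ε * (D.β * D.Φ ξ) : ℝ) * w 0 ξ‖ ≤
      ε ^ 4 * ‖g (ε * ξ)‖ + ε ^ 2 * c * m := by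
    intro ξ hξ
    rw [hid]
    refine (norm_sub_le _ _).trans (add_le_add (le_of_eq ?_) ?_)
    · rw [norm_mul, norm_pow, Complex.norm_real, Real.norm_of_nonneg hε.le]
    · rw [norm_mul, Complex.norm_real, Real.norm_eq_abs, abs_mul, abs_of_nonneg (by positivity)]
      gcongr
      · have a1 : |D.γ₁ * D.Υ₁ ξ| ≤ |D.γ₁| * B₁ := by
          rw [abs_mul]; exact mul_le_mul_of_nonneg_left (h₁ ξ hξ) (abs_nonneg _)
        have a2 : |ε * (D.γ₂ * D.Υ₂ ξ)| ≤ |D.γ₂| * B₂ := by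
          rw [abs_mul, abs_mul, abs_of_pos hε]
          have := mul_le_mul_of_nonneg_left (h₂ ξ hξ) (abs_nonneg D.γ₂)
          nlinarith [abs_nonneg D.γ₂, abs_nonneg (D.Υ₂ ξ), mul_nonneg (abs_nonneg D.γ₂)
            (abs_nonneg (D.Υ₂ ξ))]
        have a3 : |ε ^ 2 * D.Q (ε * ξ)| ≤ B₃ := by
          rw [abs_mul, abs_of_nonneg (by positivity)]
          have := h₃ _ (hmem ξ hξ)
          have h2 : ε ^ 2 ≤ 1 := by nlinarith
          nlinarith [abs_nonneg (D.Q (ε * ξ))]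
        have a4 : 0 ≤ |D.β| * B₀ := by positivity
        calc _ ≤ |D.γ₁ * D.Υ₁ ξ + ε * (D.γ₂ * D.Υ₂ ξ)| + |ε ^ 2 * D.Q (ε * ξ)| := abs_add_le _ _
          _ ≤ |D.γ₁ * D.Υ₁ ξ| + |ε * (D.γ₂ * D.Υ₂ ξ)| + |ε ^ 2 * D.Q (ε * ξ)| := by
            gcongr; exact abs_add_le _ _
          _ ≤ c := by rw [hc]; linarith
      · exact hm ξ hξ
  have int1 : (∫ ξ in (-1 : ℝ)..1, ‖w 4 ξ + (D.α * D.Ψ ξ : ℝ) * w 0 ξ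
      + (ε * (D.β * D.Φ ξ) : ℝ) * w 0 ξ‖) ≤ ε ^ 3 * Y + 2 * (ε ^ 2 * c * m) := by
    refine (intervalIntegral.integral_mono_on h11 ((hw4.add iΨ).add iΦ).norm
      ((hgi'.const_mul (ε ^ 4)).add intervalIntegrable_const) hbound).trans ?_
    rw [intervalIntegral.integral_add (hgi'.const_mul (ε ^ 4)) intervalIntegrable_const,
      intervalIntegral.integral_const_mul, intervalIntegral.integral_const, smul_eq_mul]
    have : ε ^ 4 * (∫ ξ in (-1 : ℝ)..1, ‖g (ε * ξ)‖) ≤ ε ^ 3 * Y := by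
      calc _ = ε ^ 3 * (ε * ∫ ξ in (-1 : ℝ)..1, ‖g (ε * ξ)‖) := by ring
        _ ≤ _ := by gcongr
    linarith
  have int2 : (∫ ξ in (-1 : ℝ)..1, ‖w 4 ξ + (D.α * D.Ψ ξ : ℝ) * w 0 ξ‖) ≤
      (∫ ξ in (-1 : ℝ)..1, ‖w 4 ξ + (D.α * D.Ψ ξ : ℝ) * w 0 ξ
      + (ε * (D.β * D.Φ ξ) : ℝ) * w 0 ξ‖) + 2 * (ε * c * m) := by
    have e1 : 2 * (ε * c * m) = ∫ _ξ in (-1 : ℝ)..1, ε * c * m := by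
      rw [intervalIntegral.integral_const, smul_eq_mul]; ring
    rw [e1, ← intervalIntegral.integral_add ((hw4.add iΨ).add iΦ).norm intervalIntegrable_const]
    refine intervalIntegral.integral_mono_on h11 (hw4.add iΨ).norm
      (((hw4.add iΨ).add iΦ).norm.add intervalIntegrable_const) fun ξ hξ => ?_
    have e2 : w 4 ξ + (D.α * D.Ψ ξ : ℝ) * w 0 ξ = (w 4 ξ + (D.α * D.Ψ ξ : ℝ) * w 0 ξ
      + (ε * (D.β * D.Φ ξ) : ℝ) * w 0 ξ) - (ε * (D.β * D.Φ ξ) : ℝ) * w 0 ξ := by ring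
    refine (congrArg norm e2).le.trans ((norm_sub_le _ _).trans ?_)
    gcongr
    rw [norm_mul, Complex.norm_real, Real.norm_eq_abs, abs_mul, abs_mul, abs_of_pos hε]
    gcongr
    · have := mul_le_mul_of_nonneg_left (h₀ ξ hξ) (abs_nonneg D.β)
      have p1 : 0 ≤ |D.γ₁| * B₁ := by positivity
      have p2 : 0 ≤ |D.γ₂| * B₂ := by positivity
      linarith
    · exact hm ξ hξ
  have hcm : 0 ≤ c * m := by positivity
  have q1 : ε ^ 3 * Y ≤ ε ^ 2 * Y := by
    have : ε ^ 3 ≤ ε ^ 2 := pow_le_pow_of_le_one hε.le hε1 (by norm_num)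
    gcongr
  have q2 : ε ^ 2 * (c * m) ≤ ε * (c * m) := by
    have : ε ^ 2 ≤ ε := by nlinarith
    gcongr
  have r1 : 0 ≤ c * (ε ^ 3 * Y) := by positivity
  have r2 : 0 ≤ c * (ε ^ 2 * Y) := by positivity
  have r3 : 0 ≤ ε ^ 2 * m := by positivity
  have r4 : 0 ≤ ε * m := by positivity
  have r5 : 0 ≤ ε * (c * m) := by positivity
  have r6 : 0 ≤ ε ^ 2 * (c * m) := by positivity
  constructor
  · refine int1.trans ?_
    nlinarith
  · refine int2.trans ((add_le_add_left int1 _).trans ?_)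
    nlinarith

/-- In the inner region an admissible jet is close to a resonance solution. -/
theorem exists_near_resonance : ∃ C : ℝ, 1 ≤ C ∧ ∀ ε Y d, D.Admissible ε Y d →
    ∃ (m : ℝ) (w : ℕ → ℝ → ℂ), 0 ≤ m ∧ IsResonanceSolution D.α D.Ψ w ∧
    (∀ ξ ∈ Icc (-1 : ℝ) 1, jetNorm (rescale ε d) ξ ≤ m) ∧
    (∃ ξ ∈ Icc (-1 : ℝ) 1, jetNorm (rescale ε d) ξ = m) ∧
    (∀ ξ ∈ Icc (-1 : ℝ) 1, jetNorm (rescale ε d - w) ξ ≤ C * (ε ^ 2 * Y + ε * m)) ∧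
    (∫ ξ in (-1 : ℝ)..1, ‖rescale ε d 4 ξ + (D.α * D.Ψ ξ : ℝ) * rescale ε d 0 ξ
      + (ε * (D.β * D.Φ ξ) : ℝ) * rescale ε d 0 ξ‖) ≤ C * (ε ^ 3 * Y + ε ^ 2 * m) := by
  obtain ⟨M, hM, hdef⟩ := D.exists_defect_le
  obtain ⟨C₁, hC₁, hnear⟩ := exists_resonanceSolution_near D.α D.cΨ
  have h11 : (-1 : ℝ) ≤ 1 := by norm_num
  refine ⟨max M (C₁ * (4 + M)), le_max_of_le_left hM, fun ε Y d h => ?_⟩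
  have hε := h.pos
  have hε1 := h.le_one
  have hY := h.nonneg
  have hwj := h.isJet_rescale
  -- The size `m` of the rescaled jet is not yet known to be small. It is recorded as an attained
  -- maximum so that the term `ε * m` of the error can later be absorbed at `ξ₀`.
  obtain ⟨ξ₀, hξ₀, hmax⟩ := isCompact_Icc.exists_isMaxOn (nonempty_Icc.2 h11)
    (hwj.continuousOn_jetNorm h11)
  set m := jetNorm (rescale ε d) ξ₀ with hm
  have hm0 : 0 ≤ m := jetNorm_nonneg _ _
  obtain ⟨w, hw, hclose⟩ := hnear _ hwj
  obtain ⟨d1, d2⟩ := hdef ε Y d m h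
    fun ξ hξ => (norm_le_jetNorm _ _ (by norm_num)).trans (hmax hξ)
  refine ⟨m, w, hm0, hw, fun ξ hξ => hmax hξ, ⟨ξ₀, hξ₀, rfl⟩, fun ξ hξ => ?_, ?_⟩
  · refine (hclose ξ hξ).trans ?_
    obtain ⟨a1, a2⟩ := h.norm_rescale_le (j := 2) (by norm_num)
    obtain ⟨a3, a4⟩ := h.norm_rescale_le (j := 3) (by norm_num)
    have q1 : ε ^ 3 * Y ≤ ε ^ 2 * Y := by
      have : ε ^ 3 ≤ ε ^ 2 := pow_le_pow_of_le_one hε.le hε1 (by norm_num)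
      gcongr
    calc _ ≤ C₁ * (ε ^ 2 * Y + ε ^ 2 * Y + ε ^ 2 * Y + ε ^ 2 * Y + M * (ε ^ 2 * Y + ε * m)) := by
          gcongr
          · exact a3.trans q1
          · exact a4.trans q1
      _ ≤ C₁ * (4 + M) * (ε ^ 2 * Y + ε * m) := by
          have : 0 ≤ ε * m := by positivity
          nlinarith
      _ ≤ _ := by
          gcongr
          exact le_max_right _ _
  · refine d1.trans ?_
    gcongr
    exact le_max_left _ _

end InnerData


/-! ### The interface conditions -/

/-- The boundary form of `d⁴/dx⁴`. -/
noncomputable def lagrangeForm (x y : Fin 4 → ℂ) : ℂ :=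
  x 3 * starRingEnd ℂ (y 0) - x 2 * starRingEnd ℂ (y 1) + x 1 * starRingEnd ℂ (y 2)
    - x 0 * starRingEnd ℂ (y 3)

/-- The map whose kernel describes `f(±0) = f'(±0) = 0`. -/
def decouplingMap : ((Fin 4 → ℂ) × (Fin 4 → ℂ)) →ₗ[ℂ] (Fin 4 → ℂ) where
  toFun p := ![p.1 0, p.1 1, p.2 0, p.2 1]
  map_add' p q := by ext i; fin_cases i <;> rfl
  map_smul' c p := by ext i; fin_cases i <;> rfl

/-- The map whose kernel describes `f(±0) = 0`, `f'(+0) = θ f'(-0)` and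
`θ f''(+0) - f''(-0) = κ f'(-0)`. -/
def couplingMap (θ κ : ℂ) : ((Fin 4 → ℂ) × (Fin 4 → ℂ)) →ₗ[ℂ] (Fin 4 → ℂ) where
  toFun p := ![p.1 0, p.2 0, p.2 1 - θ * p.1 1, θ * p.2 2 - p.1 2 - κ * p.1 1]
  map_add' p q := by
    ext i
    fin_cases i
    · rfl
    · rfl
    · simp; ring
    · simp; ring
  map_smul' c p := by
    ext i
    fin_cases i
    · rfl
    · rfl
    · simp; ring
    · simp; ring

theorem norm_fin_four_le {x : Fin 4 → ℂ} {M : ℝ} (h0 : ‖x 0‖ ≤ M) (h1 : ‖x 1‖ ≤ M)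
    (h2 : ‖x 2‖ ≤ M) (h3 : ‖x 3‖ ≤ M) : ‖x‖ ≤ M := by
  refine (pi_norm_le_iff_of_nonneg ((norm_nonneg _).trans h0)).2 fun i => ?_
  fin_cases i <;> assumption

theorem fin_four_eq_zero_iff {x : Fin 4 → ℂ} :
    x = 0 ↔ x 0 = 0 ∧ x 1 = 0 ∧ x 2 = 0 ∧ x 3 = 0 := by
  constructor
  · rintro rfl
    simp
  · rintro ⟨h0, h1, h2, h3⟩
    ext i
    fin_cases i <;> assumption

/-- When `(x', y')` satisfies the conditions, every surviving product in the difference of the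
boundary forms contains a component of the map evaluated at `(x, y)`. -/
theorem norm_lagrangeForm_sub_le_of_decouplingMap {x y x' y' : Fin 4 → ℂ}
    (h : decouplingMap (x', y') = 0) :
    ‖lagrangeForm y y' - lagrangeForm x x'‖ ≤
      2 * ‖decouplingMap (x, y)‖ * (‖x'‖ + ‖y'‖) := by
  obtain ⟨h0, h1, h2, h3⟩ := fin_four_eq_zero_iff.1 h
  change x' 0 = 0 at h0
  change x' 1 = 0 at h1
  change y' 0 = 0 at h2
  change y' 1 = 0 at h3
  have e : lagrangeForm y y' - lagrangeForm x x' = y 1 * starRingEnd ℂ (y' 2)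
      - y 0 * starRingEnd ℂ (y' 3) - x 1 * starRingEnd ℂ (x' 2) + x 0 * starRingEnd ℂ (x' 3) := by
    simp only [lagrangeForm, h0, h1, h2, h3, map_zero]
    ring
  have b : ∀ i, ‖decouplingMap (x, y) i‖ ≤ ‖decouplingMap (x, y)‖ := norm_le_pi_norm _
  have b0 : ‖x 0‖ ≤ _ := b 0
  have b1 : ‖x 1‖ ≤ _ := b 1
  have b2 : ‖y 0‖ ≤ _ := b 2
  have b3 : ‖y 1‖ ≤ _ := b 3
  have c1 := norm_le_pi_norm x' 2
  have c2 := norm_le_pi_norm x' 3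
  have c3 := norm_le_pi_norm y' 2
  have c4 := norm_le_pi_norm y' 3
  rw [e]
  calc _ ≤ ‖y 1‖ * ‖y' 2‖ + ‖y 0‖ * ‖y' 3‖ + ‖x 1‖ * ‖x' 2‖ + ‖x 0‖ * ‖x' 3‖ := by
        refine (norm_add_le _ _).trans (add_le_add ((norm_sub_le _ _).trans
          (add_le_add ((norm_sub_le _ _).trans (add_le_add ?_ ?_)) ?_)) ?_) <;>
        simp
    _ ≤ ‖decouplingMap (x, y)‖ * ‖y'‖ + ‖decouplingMap (x, y)‖ * ‖y'‖
        + ‖decouplingMap (x, y)‖ * ‖x'‖ + ‖decouplingMap (x, y)‖ * ‖x'‖ := by gcongr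
    _ = _ := by ring

/-- Eliminating `y' 1` and `x' 2` by the conditions regroups the difference of the boundary forms
into products with the four components of the map at `(x, y)`. This uses that `θ` and `κ` are real,
as it must: it is the symmetry of the limit operator. -/
theorem norm_lagrangeForm_sub_le_of_couplingMap {θ κ : ℂ} (hθ : starRingEnd ℂ θ = θ)
    (hκ : starRingEnd ℂ κ = κ) {x y x' y' : Fin 4 → ℂ} (h : couplingMap θ κ (x', y') = 0) :
    ‖lagrangeForm y y' - lagrangeForm x x'‖ ≤
      2 * ‖couplingMap θ κ (x, y)‖ * (‖x'‖ + ‖y'‖) := by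
  obtain ⟨h0, h1, h2, h3⟩ := fin_four_eq_zero_iff.1 h
  change x' 0 = 0 at h0
  change y' 0 = 0 at h1
  change y' 1 - θ * x' 1 = 0 at h2
  change θ * y' 2 - x' 2 - κ * x' 1 = 0 at h3
  have h2' : y' 1 = θ * x' 1 := by linear_combination h2
  have h3' : x' 2 = θ * y' 2 - κ * x' 1 := by linear_combination -h3
  have e : lagrangeForm y y' - lagrangeForm x x' =
      starRingEnd ℂ (y' 2) * (y 1 - θ * x 1) - y 0 * starRingEnd ℂ (y' 3)
      - starRingEnd ℂ (x' 1) * (θ * y 2 - x 2 - κ * x 1) + x 0 * starRingEnd ℂ (x' 3) := by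
    simp only [lagrangeForm, h0, h1, h2', h3', map_zero, map_sub, map_mul, hθ, hκ]
    ring
  have b : ∀ i, ‖couplingMap θ κ (x, y) i‖ ≤ ‖couplingMap θ κ (x, y)‖ := norm_le_pi_norm _
  have b0 : ‖x 0‖ ≤ _ := b 0
  have b1 : ‖y 0‖ ≤ _ := b 1
  have b2 : ‖y 1 - θ * x 1‖ ≤ _ := b 2
  have b3 : ‖θ * y 2 - x 2 - κ * x 1‖ ≤ _ := b 3
  have c1 := norm_le_pi_norm x' 1
  have c2 := norm_le_pi_norm x' 3
  have c3 := norm_le_pi_norm y' 2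
  have c4 := norm_le_pi_norm y' 3
  rw [e]
  set N := ‖couplingMap θ κ (x, y)‖
  calc _ ≤ ‖y' 2‖ * ‖y 1 - θ * x 1‖ + ‖y 0‖ * ‖y' 3‖ + ‖x' 1‖ * ‖θ * y 2 - x 2 - κ * x 1‖
        + ‖x 0‖ * ‖x' 3‖ := by
        refine (norm_add_le _ _).trans (add_le_add ((norm_sub_le _ _).trans
          (add_le_add ((norm_sub_le _ _).trans (add_le_add ?_ ?_)) ?_)) ?_) <;>
        simp
    _ ≤ ‖y'‖ * N + N * ‖y'‖ + ‖x'‖ * N + N * ‖x'‖ := by gcongr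
    _ = _ := by ring

/-- `J` describes the interface conditions at the origin, is isotropic for the boundary form, and
almost vanishes on the boundary values of admissible jets on `[-ε, ε]`. -/
structure IsInterfaceMap (D : InnerData) (J : ((Fin 4 → ℂ) × (Fin 4 → ℂ)) →ₗ[ℂ] (Fin 4 → ℂ))
    (C ε₀ : ℝ) : Prop where
  iff : ∀ l r : ℕ → ℝ → ℂ,
    InterfaceConditions D.α D.β D.Ψ D.Φ l r ↔ J (jetVec l 0, jetVec r 0) = 0
  isotropic : ∀ x y x' y', J (x', y') = 0 →
    ‖lagrangeForm y y' - lagrangeForm x x'‖ ≤ 2 * ‖J (x, y)‖ * (‖x'‖ + ‖y'‖)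
  estimate : ∀ ε Y d, D.Admissible ε Y d → ε < ε₀ →
    ‖J (jetVec d (-ε), jetVec d ε)‖ ≤ C * ε * Y ∧ ∀ x ∈ Icc (-ε) ε, ‖d 0 x‖ ≤ C * ε * Y

theorem InnerData.Admissible.norm_le_of_rescale {D : InnerData} {ε Y M : ℝ} {d : ℕ → ℝ → ℂ}
    (h : D.Admissible ε Y d) (hM : ∀ ξ ∈ Icc (-1 : ℝ) 1, ‖rescale ε d 0 ξ‖ ≤ M) :
    ∀ x ∈ Icc (-ε) ε, ‖d 0 x‖ ≤ M := by
  intro x hx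
  have hε := h.pos
  have := hM (x / ε) ⟨by rw [le_div_iff₀ hε]; linarith [hx.1], by rw [div_le_iff₀ hε]; linarith [hx.2]⟩
  simpa [rescale, mul_div_cancel₀ _ hε.ne'] using this

/-- The only resonance solution is zero, so `m ≤ C (ε² Y + ε m)`; for `C ε ≤ 1 / 2` the last term is
absorbed and `m = O(ε² Y)`. Returning to the variable `x` costs a factor `1 / ε` for the first
derivative, which leaves `O(ε Y)`. -/
theorem exists_isInterfaceMap_of_notMem (D : InnerData) (hα : D.α ∉ resonantSet D.Ψ) :
    ∃ C ε₀, 0 < C ∧ 0 < ε₀ ∧ IsInterfaceMap D decouplingMap C ε₀ := by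
  obtain ⟨C, hC, hnear⟩ := D.exists_near_resonance
  have h11 : (-1 : ℝ) < 1 := by norm_num
  refine ⟨2 * C, 1 / (2 * C), by positivity, by positivity, ?_, fun _ _ _ _ =>
    norm_lagrangeForm_sub_le_of_decouplingMap, fun ε Y d h hε₀ => ?_⟩
  · intro l r
    unfold InterfaceConditions
    rw [if_neg hα, fin_four_eq_zero_iff]
    exact Iff.rfl
  · obtain ⟨m, w, hm, hw, hle, ⟨ξ₀, hξ₀, hmax⟩, hclose, -⟩ := hnear ε Y d h
    have hε := h.pos
    have hε1 := h.le_one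
    have hY := h.nonneg
    have hCε : C * ε ≤ 1 / 2 := by
      rw [lt_div_iff₀ (by positivity)] at hε₀
      linarith
    have hw0 : ∀ ξ ∈ Icc (-1 : ℝ) 1, w 0 ξ = 0 := by
      intro ξ hξ
      by_contra hne
      exact hα ⟨w, hw, ξ, hξ, hne⟩
    -- `w` is treated as zero times itself, so that all its derivatives vanish too.
    have hwj := eq_const_mul_of_hasDerivWithinAt h11 hw.hasDeriv hw.hasDeriv (c := 0)
      fun x hx => by rw [hw0 x hx, zero_mul]
    have hm2 : m ≤ 2 * C * ε ^ 2 * Y := by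
      have h1 := hclose ξ₀ hξ₀
      have h2 : jetNorm (rescale ε d - w) ξ₀ = m := by
        have hz : ∀ j ≤ 4, w j ξ₀ = 0 := fun j hj => (hwj j hj ξ₀ hξ₀).trans (zero_mul _)
        rw [← hmax]
        simp only [jetNorm, Pi.sub_apply, hz 0 (by norm_num), hz 1 (by norm_num),
          hz 2 (by norm_num), hz 3 (by norm_num), sub_zero]
      rw [h2] at h1
      nlinarith
    have hm1 : m ≤ 2 * C * ε * Y := by
      refine hm2.trans ?_
      have : ε ^ 2 ≤ ε := by nlinarith
      gcongr
    have h0 := h.norm_le_of_rescale fun ξ hξ => (norm_le_jetNorm _ ξ (by norm_num)).trans (hle ξ hξ)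
    have hd1 : ∀ ξ ∈ Icc (-1 : ℝ) 1, ‖d 1 (ε * ξ)‖ ≤ 2 * C * ε * Y := by
      intro ξ hξ
      have h1 := ((norm_le_jetNorm (rescale ε d) ξ (j := 1) (by norm_num)).trans (hle ξ hξ)).trans
        hm2
      simp only [rescale, norm_mul, pow_one, Complex.norm_real, Real.norm_eq_abs,
        abs_of_pos hε] at h1
      have h2 : ε * ‖d 1 (ε * ξ)‖ ≤ ε * (2 * C * ε * Y) := by linarith
      exact le_of_mul_le_mul_left h2 hε
    have hd1l := hd1 (-1) (left_mem_Icc.2 h11.le)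
    have hd1r := hd1 1 (right_mem_Icc.2 h11.le)
    rw [mul_neg, mul_one] at hd1l
    rw [mul_one] at hd1r
    have hεε : -ε ≤ ε := by linarith
    refine ⟨norm_fin_four_le ?_ hd1l ?_ hd1r, fun x hx => (h0 x hx).trans hm1⟩
    · exact (h0 _ (left_mem_Icc.2 hεε)).trans hm1
    · exact (h0 _ (right_mem_Icc.2 hεε)).trans hm1

/-- Green's formula against the resonance function gives the third coupling condition. -/
theorem green_resonance {α β ε : ℝ} {Ψ Φ : ℝ → ℝ} (hΨ : Continuous Ψ) (hΦ : Continuous Φ)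
    {w φ : ℕ → ℝ → ℂ} (hw : IsJet (-1) 1 w) (hφ : IsResonanceSolution α Ψ φ) (hφ1 : φ 1 (-1) = 1) :
    φ 1 1 * w 2 1 - w 2 (-1) - ε * β * vartheta Φ (φ 0) * w 1 (-1) =
      w 3 1 * φ 0 1 - w 3 (-1) * φ 0 (-1)
      - (∫ ξ in (-1 : ℝ)..1, (w 4 ξ + (α * Ψ ξ : ℝ) * w 0 ξ + (ε * (β * Φ ξ) : ℝ) * w 0 ξ) * φ 0 ξ)
      + ε * β * ∫ ξ in (-1 : ℝ)..1, Φ ξ * φ 0 ξ * (w 0 ξ - w 1 (-1) * φ 0 ξ) := by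
  have h11 : (-1 : ℝ) ≤ 1 := by norm_num
  have hφj := hφ.isJet hΨ
  have hg := hw.green h11 hφj
  have c0 := hw.continuousOn h11 (j := 0) (by norm_num)
  have cφ := hφj.continuousOn h11 (j := 0) (by norm_num)
  have cΦ : ContinuousOn (fun ξ => (Φ ξ : ℂ)) (Icc (-1) 1) :=
    (Complex.continuous_ofReal.comp hΦ).continuousOn
  have cΨ : ContinuousOn (fun ξ => (Ψ ξ : ℂ)) (Icc (-1) 1) :=
    (Complex.continuous_ofReal.comp hΨ).continuousOn
  have int : ∀ f : ℝ → ℂ, ContinuousOn f (Icc (-1) 1) → IntervalIntegrable f volume (-1) 1 :=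
    fun f hf => ContinuousOn.intervalIntegrable (by rwa [uIcc_of_le h11])
  have i4 : IntervalIntegrable (fun ξ => w 4 ξ * φ 0 ξ) volume (-1) 1 :=
    (hw.prim 3 (by norm_num)).int.mul_continuousOn (by rwa [uIcc_of_le h11])
  have iΨ := int (fun ξ => α * (Ψ ξ * w 0 ξ * φ 0 ξ))
    (continuousOn_const.mul ((cΨ.mul c0).mul cφ))
  have iΦ := int (fun ξ => ε * β * (Φ ξ * w 0 ξ * φ 0 ξ))
    (continuousOn_const.mul ((cΦ.mul c0).mul cφ))
  have iΦ0 := int (fun ξ => Φ ξ * w 0 ξ * φ 0 ξ) ((cΦ.mul c0).mul cφ)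
  have iφ := int (fun ξ => w 1 (-1) * (Φ ξ * φ 0 ξ ^ 2))
    (continuousOn_const.mul (cΦ.mul (cφ.pow 2)))
  have e1 : ∫ ξ in (-1 : ℝ)..1, φ 4 ξ * w 0 ξ
      = -∫ ξ in (-1 : ℝ)..1, (α * (Ψ ξ * w 0 ξ * φ 0 ξ) : ℂ) := by
    rw [← intervalIntegral.integral_neg]
    refine intervalIntegral.integral_congr fun ξ hξ => ?_
    rw [uIcc_of_le h11] at hξ
    linear_combination w 0 ξ * hφ.eqn ξ hξ
  have e2 : (∫ ξ in (-1 : ℝ)..1,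
      (w 4 ξ + (α * Ψ ξ : ℝ) * w 0 ξ + (ε * (β * Φ ξ) : ℝ) * w 0 ξ) * φ 0 ξ) =
      (∫ ξ in (-1 : ℝ)..1, w 4 ξ * φ 0 ξ) + (∫ ξ in (-1 : ℝ)..1, (α * (Ψ ξ * w 0 ξ * φ 0 ξ) : ℂ))
      + ∫ ξ in (-1 : ℝ)..1, (ε * β * (Φ ξ * w 0 ξ * φ 0 ξ) : ℂ) := by
    rw [← intervalIntegral.integral_add i4 iΨ, ← intervalIntegral.integral_add (i4.add iΨ) iΦ]
    congr 1
    ext ξ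
    push_cast
    ring
  have e3 : (∫ ξ in (-1 : ℝ)..1, Φ ξ * φ 0 ξ * (w 0 ξ - w 1 (-1) * φ 0 ξ)) =
      (∫ ξ in (-1 : ℝ)..1, (Φ ξ * w 0 ξ * φ 0 ξ : ℂ)) - w 1 (-1) * vartheta Φ (φ 0) := by
    rw [vartheta, ← intervalIntegral.integral_const_mul, ← intervalIntegral.integral_sub iΦ0 iφ]
    congr 1
    ext ξ
    ring
  rw [e2, e3, hg, e1, intervalIntegral.integral_const_mul, hφ.bc_left.1, hφ.bc_left.2,
    hφ.bc_right.1, hφ.bc_right.2, hφ1]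
  rw [intervalIntegral.integral_const_mul]
  ring

theorem norm_intervalIntegral_mul_le {f g : ℝ → ℂ} {N : ℝ}
    (hf : IntervalIntegrable f volume (-1) 1) (hg : ContinuousOn g (Icc (-1) 1))
    (hN : ∀ ξ ∈ Icc (-1 : ℝ) 1, ‖g ξ‖ ≤ N) :
    ‖∫ ξ in (-1 : ℝ)..1, f ξ * g ξ‖ ≤ (∫ ξ in (-1 : ℝ)..1, ‖f ξ‖) * N := by
  have h11 : (-1 : ℝ) ≤ 1 := by norm_num
  refine (intervalIntegral.norm_integral_le_integral_norm h11).trans ?_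
  rw [← intervalIntegral.integral_mul_const]
  refine intervalIntegral.integral_mono_on h11
    (hf.mul_continuousOn (by rwa [uIcc_of_le h11])).norm (hf.norm.mul_const N) fun ξ hξ => ?_
  rw [norm_mul]
  exact mul_le_mul_of_nonneg_left (hN ξ hξ) (norm_nonneg _)

/-- The rescaled jet `W` is within `O(ε² Y)` of `c φ`, with `c = O(ε Y)` read off from `W'(-1) = ε
d'(-ε)`. This yields the conditions on values and first derivatives. It is too weak for second
derivatives, which carry a factor ε² in `W`; there Green's formula against `φ` gains one more power
of ε. -/
theorem exists_isInterfaceMap_of_mem (D : InnerData) (hα : D.α ∈ resonantSet D.Ψ)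
    (hres : NondegenerateResonance D.α D.Ψ) :
    ∃ J C ε₀, 0 < C ∧ 0 < ε₀ ∧ IsInterfaceMap D J C ε₀ := by
  obtain ⟨K, hK, hnear⟩ := D.exists_near_resonance
  obtain ⟨φ, hφ, hφ1, hall, hreal⟩ := exists_normalized_resonance hα hres
  have h11 : (-1 : ℝ) ≤ 1 := by norm_num
  have hφj := hφ.1.isJet D.cΨ
  have cφ := hφj.continuousOn h11 (j := 0) (by norm_num)
  obtain ⟨N, hN0, hN⟩ := exists_norm_le_of_continuousOn (hφj.continuousOn_jetNorm h11)
  replace hN : ∀ ξ ∈ Icc (-1 : ℝ) 1, jetNorm φ ξ ≤ N := fun ξ hξ => (le_abs_self _).trans (hN ξ hξ)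
  have hNφ : ∀ ξ ∈ Icc (-1 : ℝ) 1, ‖φ 0 ξ‖ ≤ N := fun ξ hξ =>
    (norm_le_jetNorm φ ξ (by norm_num)).trans (hN ξ hξ)
  obtain ⟨B, hB0, hB⟩ := exists_norm_le_of_continuousOn (p := -1) (q := 1) D.cΦ.continuousOn
  have hl : (-1 : ℝ) ∈ Icc (-1 : ℝ) 1 := left_mem_Icc.2 h11
  have hr : (1 : ℝ) ∈ Icc (-1 : ℝ) 1 := right_mem_Icc.2 h11
  have hθ : ‖φ 1 1‖ ≤ N := (norm_le_jetNorm φ 1 (by norm_num)).trans (hN 1 hr)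
  set ϑ := vartheta D.Φ (φ 0) with hϑ
  have hϑr : starRingEnd ℂ ϑ = ϑ := by
    rw [hϑ, vartheta, ← intervalIntegral.intervalIntegral_conj]
    refine intervalIntegral.integral_congr fun ξ hξ => ?_
    rw [uIcc_of_le h11] at hξ
    simp [hreal 0 (by norm_num) ξ hξ]
  -- `C₁` will bound `m / (ε Y)`, `C₂` the distance from `W` to `c φ` divided by `ε² Y`, and `C₃`
  -- the condition on second derivatives divided by `ε Y`.
  set C₁ := 2 * N + 1 with hC₁
  set C₂ := K * (1 + C₁) with hC₂
  set C₃ := 2 * N + C₂ * N + |D.β| * (2 * (B * N * (C₂ * (1 + N)))) with hC₃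
  have hC₁0 : 0 < C₁ := by positivity
  have hC₂0 : 0 < C₂ := by positivity
  have hC₃0 : 0 ≤ C₃ := by positivity
  refine ⟨couplingMap (φ 1 1) (D.β * ϑ), C₁ + C₂ * (1 + N) + C₃, 1 / (2 * K * (N + 1)),
    by positivity, by positivity, ?_, fun _ _ _ _ => norm_lagrangeForm_sub_le_of_couplingMap
      (hreal 1 (by norm_num) 1 hr) (by rw [map_mul, Complex.conj_ofReal, hϑr]), ?_⟩
  · intro l r
    unfold InterfaceConditions
    rw [if_pos hα, fin_four_eq_zero_iff]
    change (l 0 0 = 0 ∧ r 0 0 = 0 ∧ _) ↔ l 0 0 = 0 ∧ r 0 0 = 0 ∧ r 1 0 - φ 1 1 * l 1 0 = 0 ∧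
      φ 1 1 * r 2 0 - l 2 0 - D.β * ϑ * l 1 0 = 0
    refine and_congr_right fun _ => and_congr_right fun _ => ⟨fun h => ?_, fun h w hw => ?_⟩
    · have := h φ hφ
      simpa only [theta, hφ1, div_one] using this
    -- `theta` and the normalized `vartheta` do not change when the eigenfunction is scaled, so the
    -- conditions for `φ` imply those for every eigenfunction.
    · obtain ⟨c, hc⟩ := hall w hw.1
      have hc0 : c ≠ 0 := by
        rintro rfl
        obtain ⟨ξ, hξ, hne⟩ := hw.2
        exact hne (by rw [hc 0 (by norm_num) ξ hξ, zero_mul])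
      have h1 : w 1 (-1) = c := by rw [hc 1 (by norm_num) _ hl, hφ1, mul_one]
      have h2 : theta w = φ 1 1 := by
        rw [theta, h1, hc 1 (by norm_num) _ hr, mul_div_cancel_left₀ _ hc0]
      have h3 : vartheta D.Φ (fun ξ => w 0 ξ / w 1 (-1)) = ϑ := by
        refine intervalIntegral.integral_congr fun ξ hξ => ?_
        rw [uIcc_of_le h11] at hξ
        simp only [h1, hc 0 (by norm_num) ξ hξ, mul_div_cancel_left₀ _ hc0]
      rw [h2, h3]
      exact h
  · intro ε Y d h hε₀
    obtain ⟨m, w, hm, hw, hle, ⟨ξ₀, hξ₀, hmax⟩, hclose, hdef⟩ := hnear ε Y d h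
    have hε := h.pos
    have hε1 := h.le_one
    have hY := h.nonneg
    have hKε : K * ε * (N + 1) ≤ 1 / 2 := by
      rw [lt_div_iff₀ (by positivity)] at hε₀
      linarith
    obtain ⟨c, hc⟩ := hall w hw
    set W := rescale ε d with hW
    have hWj : IsJet (-1) 1 W := h.isJet_rescale
    set E := K * (ε ^ 2 * Y + ε * m) with hE
    have hE0 : 0 ≤ E := by positivity
    have hcj : ∀ j < 4, ∀ ξ ∈ Icc (-1 : ℝ) 1, ‖W j ξ - c * φ j ξ‖ ≤ E := by
      intro j hj ξ hξ
      rw [← hc j hj.le ξ hξ]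
      exact (norm_le_jetNorm (W - w) ξ hj).trans (hclose ξ hξ)
    have hc1 : ‖W 1 (-1) - c‖ ≤ E := by
      have := hcj 1 (by norm_num) _ hl
      rwa [hφ1, mul_one] at this
    obtain ⟨b1, -⟩ := h.norm_rescale_le (j := 1) (by norm_num)
    obtain ⟨b3, b3'⟩ := h.norm_rescale_le (j := 3) (by norm_num)
    rw [pow_one] at b1
    have hcle : ‖c‖ ≤ ε * Y + E := by
      have : c = W 1 (-1) - (W 1 (-1) - c) := by ring
      rw [this]
      exact (norm_sub_le _ _).trans (add_le_add b1 hc1)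
    have hmle : m ≤ ‖c‖ * N + E := by
      have h1 := jetNorm_add_le w (W - w) ξ₀
      rw [add_sub_cancel, hmax] at h1
      have h2 : jetNorm w ξ₀ = ‖c‖ * jetNorm φ ξ₀ := by
        simp only [jetNorm, hc _ (show 0 ≤ 4 by norm_num) ξ₀ hξ₀,
          hc _ (show 1 ≤ 4 by norm_num) ξ₀ hξ₀, hc _ (show 2 ≤ 4 by norm_num) ξ₀ hξ₀,
          hc _ (show 3 ≤ 4 by norm_num) ξ₀ hξ₀, norm_mul]
        ring
      rw [h2] at h1
      have h3 := mul_le_mul_of_nonneg_left (hN ξ₀ hξ₀) (norm_nonneg c)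
      linarith [hclose ξ₀ hξ₀]
    have hm1 : m ≤ C₁ * ε * Y := by
      have h1 : m ≤ ε * Y * N + E * (N + 1) := by nlinarith
      -- The choice of `ε₀` enters here: half of `m` is absorbed on the left, which leaves `m ≤ (2 N
      -- + 1) ε Y`.
      have h2 : E * (N + 1) ≤ 1 / 2 * (ε * Y + m) := by
        calc E * (N + 1) = K * ε * (N + 1) * (ε * Y + m) := by rw [hE]; ring
          _ ≤ _ := by gcongr
      rw [hC₁]
      linarith
    have hE1 : E ≤ C₂ * ε ^ 2 * Y := by
      calc E ≤ K * (ε ^ 2 * Y + ε * (C₁ * ε * Y)) := by rw [hE]; gcongr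
        _ = _ := by rw [hC₂]; ring
    have hdef1 : (∫ ξ in (-1 : ℝ)..1, ‖W 4 ξ + (D.α * D.Ψ ξ : ℝ) * W 0 ξ
        + (ε * (D.β * D.Φ ξ) : ℝ) * W 0 ξ‖) ≤ C₂ * ε ^ 3 * Y := by
      refine hdef.trans ?_
      calc _ ≤ K * (ε ^ 3 * Y + ε ^ 2 * (C₁ * ε * Y)) := by gcongr
        _ = _ := by rw [hC₂]; ring
    have hεY : 0 ≤ ε * Y := by positivity
    have key : ∀ c' : ℝ, c' ≤ C₁ + C₂ * (1 + N) + C₃ →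
        c' * ε * Y ≤ (C₁ + C₂ * (1 + N) + C₃) * ε * Y := fun c' hc' => by gcongr
    have h0 : ∀ x ∈ Icc (-ε) ε, ‖d 0 x‖ ≤ (C₁ + C₂ * (1 + N) + C₃) * ε * Y := fun x hx =>
      ((h.norm_le_of_rescale fun ξ hξ =>
        (norm_le_jetNorm _ ξ (by norm_num)).trans (hle ξ hξ)) x hx).trans
        (hm1.trans (key _ (by nlinarith [mul_nonneg hC₂0.le hN0])))
    have hεε : -ε ≤ ε := by linarith
    have hW0 : ∀ j, W j 1 = (ε : ℂ) ^ j * d j ε := fun j => by simp [hW, rescale]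
    have hW1 : ∀ j, W j (-1) = (ε : ℂ) ^ j * d j (-ε) := fun j => by simp [hW, rescale]
    have nε : ‖(ε : ℂ)‖ = ε := by rw [Complex.norm_real, Real.norm_of_nonneg hε.le]
    refine ⟨norm_fin_four_le (h0 _ (left_mem_Icc.2 hεε)) (h0 _ (right_mem_Icc.2 hεε)) ?_ ?_, h0⟩
    · change ‖d 1 ε - φ 1 1 * d 1 (-ε)‖ ≤ _
      -- The unknown factor `c` cancels because `φ'(-1) = 1`.
      have h1 : (ε : ℂ) * (d 1 ε - φ 1 1 * d 1 (-ε))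
          = (W 1 1 - c * φ 1 1) - φ 1 1 * (W 1 (-1) - c) := by
        rw [hW0, hW1]; ring
      have h2 : ε * ‖d 1 ε - φ 1 1 * d 1 (-ε)‖ ≤ ε * (C₂ * (1 + N) * ε * Y) := by
        calc _ = ‖(ε : ℂ) * (d 1 ε - φ 1 1 * d 1 (-ε))‖ := by rw [norm_mul, nε]
          _ ≤ E + N * E := by
            rw [h1]
            refine (norm_sub_le _ _).trans (add_le_add (hcj 1 (by norm_num) _ hr) ?_)
            rw [norm_mul]
            gcongr
          _ = (1 + N) * E := by ring
          _ ≤ (1 + N) * (C₂ * ε ^ 2 * Y) := by gcongr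
          _ = _ := by ring
      exact (le_of_mul_le_mul_left h2 hε).trans (key _ (by linarith))
    · change ‖φ 1 1 * d 2 ε - d 2 (-ε) - D.β * ϑ * d 1 (-ε)‖ ≤ _
      -- The left side is ε² times the required quantity. On the right every term is `O(ε³ Y)`:
      -- third derivatives carry ε³, the defect that keeps the `Φ` term is `O(ε³ Y)`, and the last
      -- integral has the factor ε times `W - W'(-1) φ = O(ε² Y)`.
      have hg := green_resonance (β := D.β) (ε := ε) D.cΨ D.cΦ hWj hφ.1 hφ1
      have h1 : (ε : ℂ) ^ 2 * (φ 1 1 * d 2 ε - d 2 (-ε) - D.β * ϑ * d 1 (-ε)) =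
          φ 1 1 * W 2 1 - W 2 (-1) - ε * D.β * vartheta D.Φ (φ 0) * W 1 (-1) := by
        rw [hW0, hW1, hW1, ← hϑ]; ring
      have cW := hWj.continuousOn h11 (j := 0) (by norm_num)
      have int0 : IntervalIntegrable (fun ξ => W 4 ξ + (D.α * D.Ψ ξ : ℝ) * W 0 ξ
          + (ε * (D.β * D.Φ ξ) : ℝ) * W 0 ξ) volume (-1) 1 := by
        refine ((hWj.prim 3 (by norm_num)).int.add ?_).add ?_
        · refine ContinuousOn.intervalIntegrable ?_
          rw [uIcc_of_le h11]
          exact continuousOn_ofReal_mul (V := fun ξ => D.α * D.Ψ ξ)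
            (continuous_const.mul D.cΨ).continuousOn cW
        · refine ContinuousOn.intervalIntegrable ?_
          rw [uIcc_of_le h11]
          exact continuousOn_ofReal_mul (V := fun ξ => ε * (D.β * D.Φ ξ))
            (continuous_const.mul (continuous_const.mul D.cΦ)).continuousOn cW
      have t1 := (norm_intervalIntegral_mul_le int0 cφ hNφ).trans
        (mul_le_mul_of_nonneg_right hdef1 hN0)
      have t2 : ‖∫ ξ in (-1 : ℝ)..1, D.Φ ξ * φ 0 ξ * (W 0 ξ - W 1 (-1) * φ 0 ξ)‖ ≤
          B * N * (C₂ * ε ^ 2 * Y * (1 + N)) * |1 - (-1)| := by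
        refine intervalIntegral.norm_integral_le_of_norm_le_const fun ξ hξ => ?_
        rw [uIoc_of_le h11] at hξ
        have hξ' := Ioc_subset_Icc_self hξ
        have e : W 0 ξ - W 1 (-1) * φ 0 ξ = (W 0 ξ - c * φ 0 ξ) - (W 1 (-1) - c) * φ 0 ξ := by ring
        have u1 : ‖W 0 ξ - W 1 (-1) * φ 0 ξ‖ ≤ C₂ * ε ^ 2 * Y * (1 + N) := by
          rw [e]
          calc _ ≤ E + E * N := by
                refine (norm_sub_le _ _).trans (add_le_add (hcj 0 (by norm_num) ξ hξ') ?_)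
                rw [norm_mul]
                exact mul_le_mul hc1 (hNφ ξ hξ') (norm_nonneg _) hE0
            _ = E * (1 + N) := by ring
            _ ≤ _ := by gcongr
        rw [norm_mul, norm_mul, Complex.norm_real]
        gcongr
        · exact hB ξ hξ'
        · exact hNφ ξ hξ'
      have e2 : |(1 : ℝ) - (-1)| = 2 := by norm_num
      rw [e2] at t2
      have h2 : ε ^ 2 * ‖φ 1 1 * d 2 ε - d 2 (-ε) - D.β * ϑ * d 1 (-ε)‖ ≤ ε ^ 2 * (C₃ * ε * Y) := by
        calc _ = ‖(ε : ℂ) ^ 2 * (φ 1 1 * d 2 ε - d 2 (-ε) - D.β * ϑ * d 1 (-ε))‖ := by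
              rw [norm_mul, norm_pow, nε]
          _ ≤ ε ^ 3 * Y * N + ε ^ 3 * Y * N + C₂ * ε ^ 3 * Y * N
              + ε * |D.β| * (B * N * (C₂ * ε ^ 2 * Y * (1 + N)) * 2) := by
            rw [h1, hg]
            refine (norm_add_le _ _).trans (add_le_add ((norm_sub_le _ _).trans (add_le_add
              ((norm_sub_le _ _).trans (add_le_add ?_ ?_)) t1)) ?_)
            · rw [norm_mul]
              exact mul_le_mul b3' (hNφ _ hr) (norm_nonneg _) (by positivity)
            · rw [norm_mul]
              exact mul_le_mul b3 (hNφ _ hl) (norm_nonneg _) (by positivity)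
            · rw [norm_mul, norm_mul, nε, Complex.norm_real, Real.norm_eq_abs]
              gcongr
          _ = _ := by rw [hC₃]; ring
      have hε2 : 0 < ε ^ 2 := by positivity
      exact (le_of_mul_le_mul_left h2 hε2).trans (key _ (by nlinarith [mul_nonneg hC₂0.le hN0]))

theorem exists_isInterfaceMap (D : InnerData)
    (hres : D.α ∈ resonantSet D.Ψ → NondegenerateResonance D.α D.Ψ) :
    ∃ J C ε₀, 0 < C ∧ 0 < ε₀ ∧ IsInterfaceMap D J C ε₀ := by
  by_cases hα : D.α ∈ resonantSet D.Ψ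
  · exact exists_isInterfaceMap_of_mem D hα (hres hα)
  · exact ⟨_, exists_isInterfaceMap_of_notMem D hα⟩


/-! ### The outer regions -/

theorem IsSolution.norm_jetVec_sub_le {p q M K : ℝ} {V : ℝ → ℝ} {d : ℕ → ℝ → ℂ} (hpq : p ≤ q)
    (hd : IsSolution p q V d) (hM : ∀ x ∈ Icc p q, |V x| ≤ M)
    (hK : ∀ x ∈ Icc p q, jetNorm d x ≤ K) {x y : ℝ} (hx : x ∈ Icc p q) (hy : y ∈ Icc p q) :
    ‖jetVec d x - jetVec d y‖ ≤ (1 + M) * K * |x - y| := by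
  have hM0 : 0 ≤ M := (abs_nonneg _).trans (hM x hx)
  have hK0 : 0 ≤ K := (jetNorm_nonneg _ _).trans (hK x hx)
  refine (pi_norm_le_iff_of_nonneg (by positivity)).2 fun j => ?_
  change ‖d j x - d j y‖ ≤ _
  rw [(hd.jet.prim j j.2).sub_eq hpq hy hx]
  refine intervalIntegral.norm_integral_le_of_norm_le_const fun t ht => ?_
  have ht' : t ∈ Icc p q := uIcc_subset_Icc hy hx (uIoc_subset_uIcc ht)
  rcases Nat.lt_or_ge ((j : ℕ) + 1) 4 with h | h
  · refine ((norm_le_jetNorm d t h).trans (hK t ht')).trans ?_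
    nlinarith
  · have hj : (j : ℕ) + 1 = 4 := by have := j.2; omega
    have e : d 4 t = -(V t * d 0 t) := eq_neg_of_add_eq_zero_left (hd.eqn t ht')
    rw [hj, e, norm_neg, norm_mul, Complex.norm_real, Real.norm_eq_abs]
    calc _ ≤ M * K := mul_le_mul (hM t ht') ((norm_le_jetNorm d t (by norm_num)).trans (hK t ht'))
          (norm_nonneg _) hM0
      _ ≤ _ := by nlinarith

/-- The jet of `x ↦ (c - x) ^ n`. -/
noncomputable def powerJet (c : ℝ) (n : ℕ) : ℕ → ℝ → ℂ :=
  fun j x => (-1) ^ j * n.descFactorial j * ((c - x : ℝ) : ℂ) ^ (n - j)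

theorem isJet_powerJet {p c : ℝ} (hpc : p ≤ c) (n : ℕ) : IsJet p c (powerJet c n) := by
  have hcont : ∀ j, Continuous (powerJet c n j) := fun j => by
    unfold powerJet
    fun_prop
  refine isJet_of_hasDerivWithinAt hpc (fun j _ x _ => ?_) (hcont 4).continuousOn
  have h1 : HasDerivAt (fun x : ℝ => ((c - x : ℝ) : ℂ)) (-1) x := by
    have := ((hasDerivAt_id x).const_sub c).ofReal_comp
    simpa using this
  have h2 := ((h1.pow (n - j)).const_mul ((-1) ^ j * (n.descFactorial j : ℂ))).hasDerivWithinAt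
    (s := Icc p c)
  refine h2.congr_deriv ?_
  simp only [powerJet, Nat.descFactorial_succ, Nat.sub_sub]
  push_cast
  ring

/-- Interior estimate: the initial values of a jet are controlled by its `L¹` norm and by the
defect in the equation. -/
theorem norm_initial_le {p c : ℝ} (hpc : p < c) {V : ℝ → ℝ} (hV : ContinuousOn V (Icc p c)) :
    ∃ C : ℝ, 0 < C ∧ ∀ d, IsJet p c d → d 0 p = 0 → d 1 p = 0 →
      ‖(d 2 p, d 3 p)‖ ≤ C * ((∫ t in p..c, ‖d 4 t + V t * d 0 t‖) + ∫ t in p..c, ‖d 0 t‖) := by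
  obtain ⟨M, hM0, hM⟩ := exists_norm_le_of_continuousOn hV
  obtain ⟨K, hK⟩ : ∃ K : ℝ, 0 ≤ K ∧ ∀ n ∈ ({4, 5} : Finset ℕ), ∀ x ∈ Icc p c,
      ‖powerJet c n 0 x‖ ≤ K ∧ ‖powerJet c n 4 x‖ ≤ K := by
    have hcont : ∀ n j, ContinuousOn (fun x => ‖powerJet c n j x‖) (Icc p c) := fun n j => by
      unfold powerJet
      fun_prop
    obtain ⟨K₁, h1, hK₁⟩ := exists_norm_le_of_continuousOn (hcont 4 0)
    obtain ⟨K₂, h2, hK₂⟩ := exists_norm_le_of_continuousOn (hcont 4 4)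
    obtain ⟨K₃, h3, hK₃⟩ := exists_norm_le_of_continuousOn (hcont 5 0)
    obtain ⟨K₄, h4, hK₄⟩ := exists_norm_le_of_continuousOn (hcont 5 4)
    refine ⟨K₁ + K₂ + K₃ + K₄, by positivity, fun n hn x hx => ?_⟩
    have a1 := (le_abs_self _).trans (hK₁ x hx)
    have a2 := (le_abs_self _).trans (hK₂ x hx)
    have a3 := (le_abs_self _).trans (hK₃ x hx)
    have a4 := (le_abs_self _).trans (hK₄ x hx)
    simp only [Finset.mem_insert, Finset.mem_singleton] at hn
    rcases hn with rfl | rfl <;> constructor <;> linarith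
  obtain ⟨hK0, hK⟩ := hK
  set L := c - p with hL
  have hL0 : 0 < L := by rw [hL]; linarith
  refine ⟨(1 + M) * K * ((1 + L) / L ^ 4 + (5 * L + 4) / L ^ 5) + 1, by positivity,
    fun d hd h0 h1 => ?_⟩
  have c0 := hd.continuousOn hpc.le (j := 0) (by norm_num)
  have i4 := (hd.prim 3 (by norm_num)).int
  have i0 : IntervalIntegrable (d 0) volume p c :=
    ContinuousOn.intervalIntegrable (by rwa [uIcc_of_le hpc.le])
  have iV : IntervalIntegrable (fun t => V t * d 0 t) volume p c :=
    ContinuousOn.intervalIntegrable (by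
      rw [uIcc_of_le hpc.le]; exact continuousOn_ofReal_mul hV c0)
  set F := ∫ t in p..c, ‖d 4 t + V t * d 0 t‖
  set G := ∫ t in p..c, ‖d 0 t‖
  have hF0 : 0 ≤ F := intervalIntegral.integral_nonneg hpc.le fun _ _ => norm_nonneg _
  have hG0 : 0 ≤ G := intervalIntegral.integral_nonneg hpc.le fun _ _ => norm_nonneg _
  have hd4 : ∫ t in p..c, ‖d 4 t‖ ≤ F + M * G := by
    rw [← intervalIntegral.integral_const_mul, ← intervalIntegral.integral_add
      (i4.add iV).norm (i0.norm.const_mul M)]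
    refine intervalIntegral.integral_mono_on hpc.le i4.norm
      ((i4.add iV).norm.add (i0.norm.const_mul M)) fun t ht => ?_
    have e : d 4 t = (d 4 t + V t * d 0 t) - V t * d 0 t := by ring
    refine (congrArg norm e).le.trans ((norm_sub_le _ _).trans ?_)
    rw [norm_mul, Complex.norm_real]
    gcongr
    exact hM t ht
  -- Green's formula against `(c - x) ^ n`. For `n ≥ 4` the boundary terms at `c` vanish, and `d 0 p
  -- = d 1 p = 0` leaves one linear relation between `d 2 p` and `d 3 p`.
  have key : ∀ n ∈ ({4, 5} : Finset ℕ),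
      ‖d 3 p * (L : ℂ) ^ n + d 2 p * (n * (L : ℂ) ^ (n - 1))‖ ≤ (1 + M) * K * (F + G) := by
    intro n hn
    have he := isJet_powerJet hpc.le n
    have hg := hd.green hpc.le he
    have hz : ∀ j < 4, powerJet c n j c = 0 := by
      intro j hj
      simp only [Finset.mem_insert, Finset.mem_singleton] at hn
      have : n - j ≠ 0 := by omega
      simp [powerJet, this]
    rw [hz 0 (by norm_num), hz 1 (by norm_num), hz 2 (by norm_num), hz 3 (by norm_num), h0, h1] at hg
    have e0 : powerJet c n 0 p = (L : ℂ) ^ n := by simp [powerJet, hL]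
    have e1 : powerJet c n 1 p = -(n * (L : ℂ) ^ (n - 1)) := by simp [powerJet, hL]
    rw [e0, e1] at hg
    have e : d 3 p * (L : ℂ) ^ n + d 2 p * (n * (L : ℂ) ^ (n - 1)) =
        (∫ t in p..c, powerJet c n 4 t * d 0 t) - ∫ t in p..c, d 4 t * powerJet c n 0 t := by
      rw [hg]; ring
    have b1 : ‖∫ t in p..c, powerJet c n 4 t * d 0 t‖ ≤ K * G := by
      refine intervalIntegral.norm_integral_le_of_norm_le hpc.le
        (g := fun t => K * ‖d 0 t‖) ?_ (i0.norm.const_mul K) |>.trans_eq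
        (intervalIntegral.integral_const_mul _ _)
      refine Filter.Eventually.of_forall fun t ht => ?_
      rw [norm_mul]
      gcongr
      exact (hK n hn t (Ioc_subset_Icc_self ht)).2
    have b2 : ‖∫ t in p..c, d 4 t * powerJet c n 0 t‖ ≤ K * (F + M * G) := by
      refine (intervalIntegral.norm_integral_le_of_norm_le hpc.le
        (g := fun t => K * ‖d 4 t‖) ?_ (i4.norm.const_mul K)).trans ?_
      · refine Filter.Eventually.of_forall fun t ht => ?_
        rw [norm_mul, mul_comm]
        gcongr
        exact (hK n hn t (Ioc_subset_Icc_self ht)).1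
      · rw [intervalIntegral.integral_const_mul]
        gcongr
    rw [e]
    refine (norm_sub_le _ _).trans ((add_le_add b1 b2).trans ?_)
    have : 0 ≤ M * F := by positivity
    nlinarith
  have k4 := key 4 (by simp)
  have k5 := key 5 (by simp)
  norm_num at k4 k5
  set A₄ := d 3 p * (L : ℂ) ^ 4 + d 2 p * (4 * (L : ℂ) ^ 3)
  set A₅ := d 3 p * (L : ℂ) ^ 5 + d 2 p * (5 * (L : ℂ) ^ 4)
  set X := (1 + M) * K * (F + G) with hX
  have hX0 : 0 ≤ X := by positivity
  have nL : ‖(L : ℂ)‖ = L := by rw [Complex.norm_real, Real.norm_of_nonneg hL0.le]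
  have d2 : ‖d 2 p‖ ≤ (1 + L) / L ^ 4 * X := by
    -- The relations for `n = 4` and `n = 5` are independent; the 2×2 system is solved explicitly.
    have e : (L : ℂ) ^ 4 * d 2 p = A₅ - L * A₄ := by simp only [A₄, A₅]; ring
    have : L ^ 4 * ‖d 2 p‖ ≤ X + L * X := by
      calc _ = ‖(L : ℂ) ^ 4 * d 2 p‖ := by rw [norm_mul, norm_pow, nL]
        _ ≤ ‖A₅‖ + L * ‖A₄‖ := by
          rw [e]
          exact (norm_sub_le _ _).trans_eq (by rw [norm_mul, nL])
        _ ≤ _ := by gcongr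
    rw [div_mul_eq_mul_div, le_div_iff₀ (by positivity)]
    linarith
  have d3 : ‖d 3 p‖ ≤ (5 * L + 4) / L ^ 5 * X := by
    have e : (L : ℂ) ^ 5 * d 3 p = 5 * L * A₄ - 4 * A₅ := by simp only [A₄, A₅]; ring
    have : L ^ 5 * ‖d 3 p‖ ≤ 5 * L * X + 4 * X := by
      calc _ = ‖(L : ℂ) ^ 5 * d 3 p‖ := by rw [norm_mul, norm_pow, nL]
        _ ≤ 5 * L * ‖A₄‖ + 4 * ‖A₅‖ := by
          rw [e]
          exact (norm_sub_le _ _).trans_eq (by rw [norm_mul, norm_mul, norm_mul, nL]; norm_num)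
        _ ≤ _ := by gcongr
    rw [div_mul_eq_mul_div, le_div_iff₀ (by positivity)]
    linarith
  have p1 : 0 ≤ (1 + L) / L ^ 4 * X := by positivity
  have p2 : 0 ≤ (5 * L + 4) / L ^ 5 * X := by positivity
  have e : ((1 + M) * K * ((1 + L) / L ^ 4 + (5 * L + 4) / L ^ 5) + 1) * (F + G)
      = (1 + L) / L ^ 4 * X + (5 * L + 4) / L ^ 5 * X + (F + G) := by rw [hX]; ring
  rw [e]
  exact norm_prod_le_iff.2 ⟨by simp only; linarith, by simp only; linarith⟩

/-- `l` parametrizes the solutions on `[p, 0]` that vanish at `p` with their first derivative, and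
jets on `[p, s]` that almost solve the equation are close to them. -/
structure IsLeftFamily (p : ℝ) (V : ℝ → ℝ) (l : (ℂ × ℂ) →ₗ[ℂ] (ℕ → ℝ → ℂ)) (C : ℝ) : Prop where
  pos : 0 < C
  sol : ∀ z, IsSolution p 0 V (l z)
  zero : ∀ z, l z 0 p = 0
  one : ∀ z, l z 1 p = 0
  le : ∀ z, ∀ x ∈ Icc p 0, jetNorm (l z) x ≤ C * ‖z‖
  lipschitz : ∀ z, ∀ x ∈ Icc p 0, ‖jetVec (l z) x - jetVec (l z) 0‖ ≤ C * ‖z‖ * |x|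
  norm_le : ∀ z, ‖z‖ ≤ C * ∫ t in p..0, ‖l z 0 t‖
  near : ∀ s ∈ Icc (p / 2) 0, ∀ d, IsJet p s d → d 0 p = 0 → d 1 p = 0 → ∃ z,
    ‖z‖ ≤ C * ((∫ t in p..s, ‖d 4 t + V t * d 0 t‖) + ∫ t in p..s, ‖d 0 t‖) ∧
    ∀ x ∈ Icc p s, jetNorm (d - l z) x ≤ C * ∫ t in p..s, ‖d 4 t + V t * d 0 t‖

theorem integral_norm_mono_right {p c s : ℝ} {f : ℝ → ℂ} (hpc : p ≤ c) (hcs : c ≤ s)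
    (hf : IntervalIntegrable f volume p s) : ∫ t in p..c, ‖f t‖ ≤ ∫ t in p..s, ‖f t‖ :=
  intervalIntegral.integral_mono_interval le_rfl hpc hcs
    (Filter.Eventually.of_forall fun _ => norm_nonneg _) hf.norm

theorem IsJet.intervalIntegrable_zero {p q : ℝ} (hpq : p ≤ q) {d : ℕ → ℝ → ℂ} (hd : IsJet p q d) :
    IntervalIntegrable (d 0) volume p q :=
  ContinuousOn.intervalIntegrable (by
    rw [uIcc_of_le hpq]; exact hd.continuousOn hpq (by norm_num))

theorem IsJet.intervalIntegrable_op {p q : ℝ} (hpq : p ≤ q) {V : ℝ → ℝ}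
    (hV : ContinuousOn V (Icc p q)) {d : ℕ → ℝ → ℂ} (hd : IsJet p q d) :
    IntervalIntegrable (fun t => d 4 t + V t * d 0 t) volume p q :=
  (hd.prim 3 (by norm_num)).int.add (ContinuousOn.intervalIntegrable (by
    rw [uIcc_of_le hpq]
    exact continuousOn_ofReal_mul hV (hd.continuousOn hpq (by norm_num))))

/-- The parameter is `z = (d 2 p, d 3 p)`. An almost solution is compared by Grönwall with the exact
solution that has the same data at `p`, with a constant independent of `s`. -/
theorem exists_isLeftFamily {p : ℝ} (hp : p < 0) {V : ℝ → ℝ} (hV : ContinuousOn V (Icc p 0)) :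
    ∃ l C, IsLeftFamily p V l C := by
  obtain ⟨S, hS⟩ := exists_fundamental_system hp.le hV
  obtain ⟨C₀, hC₀, hC⟩ := jetNorm_sub_le hp.le hV
  obtain ⟨M, hM0, hM⟩ := exists_norm_le_of_continuousOn hV
  have hpc : p < p / 2 := by linarith
  obtain ⟨C₁, hC₁, hinit⟩ := norm_initial_le hpc (hV.mono (Icc_subset_Icc_right (by linarith)))
  let T : (ℂ × ℂ) →ₗ[ℂ] (Fin 4 → ℂ) := LinearMap.pi
    ![0, 0, LinearMap.fst ℂ ℂ ℂ, LinearMap.snd ℂ ℂ ℂ]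
  have hT : ∀ z, T z = ![0, 0, z.1, z.2] := fun z => by
    ext i
    fin_cases i <;> rfl
  set l := S.comp T with hl
  have l0 : ∀ z, l z 0 p = 0 := fun z => ((hS (T z)).2 0).trans (by rw [hT]; rfl)
  have l1 : ∀ z, l z 1 p = 0 := fun z => ((hS (T z)).2 1).trans (by rw [hT]; rfl)
  have l2 : ∀ z, l z 2 p = z.1 := fun z => ((hS (T z)).2 2).trans (by rw [hT]; rfl)
  have l3 : ∀ z, l z 3 p = z.2 := fun z => ((hS (T z)).2 3).trans (by rw [hT]; rfl)
  have hsol : ∀ z, IsSolution p 0 V (l z) := fun z => (hS (T z)).1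
  have hle : ∀ z, ∀ x ∈ Icc p 0, jetNorm (l z) x ≤ 2 * C₀ * ‖z‖ := by
    intro z x hx
    refine ((hsol z).jetNorm_le hC hp.le x hx).trans ?_
    have : jetNorm (l z) p ≤ 2 * ‖z‖ := by
      simp only [jetNorm, l0, l1, l2, l3, norm_zero]
      linarith [norm_fst_le z, norm_snd_le z]
    calc _ ≤ C₀ * (2 * ‖z‖) := by gcongr
      _ = _ := by ring
  set K := 2 * C₀ + (1 + M) * (2 * C₀) + C₁ + C₀ with hK
  have w1 : 2 * C₀ ≤ K := by rw [hK]; nlinarith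
  have w2 : (1 + M) * (2 * C₀) ≤ K := by rw [hK]; nlinarith
  have w3 : C₁ ≤ K := by rw [hK]; nlinarith
  have w4 : C₀ ≤ K := by rw [hK]; nlinarith
  -- The interior estimate is applied on the fixed interval `[p, p / 2]`, contained in every `[p,
  -- s]`, so its constant does not depend on `s`.
  have hinit' : ∀ s ∈ Icc (p / 2) 0, ∀ d, IsJet p s d → d 0 p = 0 → d 1 p = 0 →
      ‖(d 2 p, d 3 p)‖ ≤ C₁ * ((∫ t in p..s, ‖d 4 t + V t * d 0 t‖) + ∫ t in p..s, ‖d 0 t‖) := by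
    intro s hs d hd h0 h1
    have hps : p ≤ s := hpc.le.trans hs.1
    refine (hinit d (hd.mono le_rfl hpc.le hs.1) h0 h1).trans ?_
    gcongr
    · exact integral_norm_mono_right hpc.le hs.1
        (hd.intervalIntegrable_op hps (hV.mono (Icc_subset_Icc_right hs.2)))
    · exact integral_norm_mono_right hpc.le hs.1 (hd.intervalIntegrable_zero hps)
  refine ⟨l, K, by positivity, hsol, l0, l1, fun z x hx => (hle z x hx).trans (by gcongr), ?_, ?_, ?_⟩
  · intro z x hx
    have := (hsol z).norm_jetVec_sub_le hp.le hM (hle z) hx (right_mem_Icc.2 hp.le)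
    rw [sub_zero] at this
    calc _ ≤ _ := this
      _ = (1 + M) * (2 * C₀) * ‖z‖ * |x| := by ring
      _ ≤ _ := by gcongr
  · intro z
    have := hinit' 0 (right_mem_Icc.2 (by linarith)) (l z) (hsol z).jet (l0 z) (l1 z)
    rw [l2, l3] at this
    have e : ∫ t in p..0, ‖l z 4 t + V t * l z 0 t‖ = 0 := by
      rw [intervalIntegral.integral_congr (g := fun _ => (0 : ℝ)) (fun t ht => ?_)]
      · simp
      · rw [uIcc_of_le hp.le] at ht
        simp only [(hsol z).eqn t ht, norm_zero]
    rw [e, zero_add] at this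
    refine this.trans ?_
    have : 0 ≤ ∫ t in p..0, ‖l z 0 t‖ :=
      intervalIntegral.integral_nonneg hp.le fun _ _ => norm_nonneg _
    gcongr
  · intro s hs d hd h0 h1
    have hps : p ≤ s := hpc.le.trans hs.1
    have p1 : 0 ≤ ∫ t in p..s, ‖d 4 t + V t * d 0 t‖ :=
      intervalIntegral.integral_nonneg hps fun _ _ => norm_nonneg _
    have p2 : 0 ≤ ∫ t in p..s, ‖d 0 t‖ :=
      intervalIntegral.integral_nonneg hps fun _ _ => norm_nonneg _
    refine ⟨(d 2 p, d 3 p), (hinit' s hs d hd h0 h1).trans (by gcongr), fun x hx => ?_⟩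
    set z : ℂ × ℂ := (d 2 p, d 3 p) with hz
    have hj := hd.sub hps ((hsol z).jet.mono le_rfl hps hs.2)
    have h2 := hC s ⟨hps, hs.2⟩ _ hj x hx
    have h3 : jetNorm (d - l z) p = 0 := by
      simp [jetNorm, h0, h1, l0, l1, l2, l3, hz]
    have h4 : ∫ t in p..s, ‖(d - l z) 4 t + V t * (d - l z) 0 t‖
        = ∫ t in p..s, ‖d 4 t + V t * d 0 t‖ := by
      refine intervalIntegral.integral_congr fun t ht => ?_
      rw [uIcc_of_le hps] at ht
      have := (hsol z).eqn t ⟨ht.1, ht.2.trans hs.2⟩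
      simp only [Pi.sub_apply]
      congr 1
      linear_combination -this
    rw [h3, h4, zero_add] at h2
    exact h2.trans (by gcongr)


/-! ### Reflection and the right outer region. -/

theorem jetNorm_reflect (d : ℕ → ℝ → ℂ) (x : ℝ) : jetNorm (reflect d) x = jetNorm d (-x) := by
  simp [jetNorm, reflect]

theorem reflect_reflect (d : ℕ → ℝ → ℂ) : reflect (reflect d) = d := by
  funext j x
  simp [reflect, ← mul_assoc, ← mul_pow]

/-- `reflect` as a linear map. -/
noncomputable def reflectMap : (ℕ → ℝ → ℂ) →ₗ[ℂ] (ℕ → ℝ → ℂ) where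
  toFun := reflect
  map_add' d e := by funext j x; simp only [reflect, Pi.add_apply]; ring
  map_smul' c d := by
    funext j x
    simp only [reflect, Pi.smul_apply, smul_eq_mul, RingHom.id_apply]
    ring

theorem norm_jetVec_reflect_sub (d : ℕ → ℝ → ℂ) (x y : ℝ) :
    ‖jetVec (reflect d) x - jetVec (reflect d) y‖ ≤ ‖jetVec d (-x) - jetVec d (-y)‖ := by
  refine (pi_norm_le_iff_of_nonneg (norm_nonneg _)).2 fun j => ?_
  refine le_trans (le_of_eq ?_) (norm_le_pi_norm (jetVec d (-x) - jetVec d (-y)) j)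
  simp only [jetVec, reflect, Pi.sub_apply, ← mul_sub, norm_mul, norm_pow, norm_neg, norm_one,
    one_pow, one_mul]

theorem integral_norm_reflect (d : ℕ → ℝ → ℂ) (V : ℝ → ℝ) (p q : ℝ) :
    (∫ t in (-q)..(-p), ‖reflect d 4 t + V (-t) * reflect d 0 t‖)
      = ∫ t in p..q, ‖d 4 t + V t * d 0 t‖ := by
  have e := intervalIntegral.integral_comp_neg (a := -q) (b := -p) fun t => ‖d 4 t + V t * d 0 t‖
  rw [neg_neg, neg_neg] at e
  rw [← e]
  refine intervalIntegral.integral_congr fun t _ => ?_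
  norm_num [reflect]

theorem integral_norm_reflect_zero (d : ℕ → ℝ → ℂ) (p q : ℝ) :
    (∫ t in (-q)..(-p), ‖reflect d 0 t‖) = ∫ t in p..q, ‖d 0 t‖ := by
  have e := intervalIntegral.integral_comp_neg (a := -q) (b := -p) fun t => ‖d 0 t‖
  rw [neg_neg, neg_neg] at e
  rw [← e]
  refine intervalIntegral.integral_congr fun t _ => ?_
  simp [reflect]

/-- `r` parametrizes the solutions on `[0, q]` that vanish at `q` with their first derivative, and
jets on `[s, q]` that almost solve the equation are close to them. -/
structure IsRightFamily (q : ℝ) (V : ℝ → ℝ) (r : (ℂ × ℂ) →ₗ[ℂ] (ℕ → ℝ → ℂ)) (C : ℝ) : Prop where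
  pos : 0 < C
  sol : ∀ z, IsSolution 0 q V (r z)
  zero : ∀ z, r z 0 q = 0
  one : ∀ z, r z 1 q = 0
  le : ∀ z, ∀ x ∈ Icc 0 q, jetNorm (r z) x ≤ C * ‖z‖
  lipschitz : ∀ z, ∀ x ∈ Icc 0 q, ‖jetVec (r z) x - jetVec (r z) 0‖ ≤ C * ‖z‖ * |x|
  norm_le : ∀ z, ‖z‖ ≤ C * ∫ t in 0..q, ‖r z 0 t‖
  near : ∀ s ∈ Icc 0 (q / 2), ∀ d, IsJet s q d → d 0 q = 0 → d 1 q = 0 → ∃ z,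
    ‖z‖ ≤ C * ((∫ t in s..q, ‖d 4 t + V t * d 0 t‖) + ∫ t in s..q, ‖d 0 t‖) ∧
    ∀ x ∈ Icc s q, jetNorm (d - r z) x ≤ C * ∫ t in s..q, ‖d 4 t + V t * d 0 t‖

/-- The operator d⁴/dx⁴ is invariant under x ↦ -x, so the left family for the potential `V (-x)` on
`[-q, 0]` reflects to the right family for `V`. -/
theorem exists_isRightFamily {q : ℝ} (hq : 0 < q) {V : ℝ → ℝ} (hV : ContinuousOn V (Icc 0 q)) :
    ∃ r C, IsRightFamily q V r C := by
  have hV' : ContinuousOn (fun x => V (-x)) (Icc (-q) 0) :=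
    hV.comp continuous_neg.continuousOn fun x hx => ⟨by linarith [hx.2], by linarith [hx.1]⟩
  obtain ⟨l, C, h⟩ := exists_isLeftFamily (neg_lt_zero.2 hq) hV'
  have hmem : ∀ {x s : ℝ}, x ∈ Icc s q → -x ∈ Icc (-q) (-s) := fun hx =>
    ⟨by linarith [hx.2], by linarith [hx.1]⟩
  have hmem0 : ∀ {x : ℝ}, x ∈ Icc 0 q → -x ∈ Icc (-q) 0 := fun hx => by simpa using hmem hx
  refine ⟨reflectMap.comp l, C, h.pos, fun z => ⟨?_, fun x hx => ?_⟩, fun z => ?_, fun z => ?_,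
    fun z x hx => ?_, fun z x hx => ?_, fun z => ?_, fun s hs d hd h0 h1 => ?_⟩
  · have := (h.sol z).jet.reflect (by linarith)
    rwa [neg_zero, neg_neg] at this
  · have := (h.sol z).eqn (-x) (hmem0 hx)
    rw [neg_neg] at this
    change reflect (l z) 4 x + V x * reflect (l z) 0 x = 0
    simp only [reflect, pow_zero, one_mul]
    linear_combination this
  · change reflect (l z) 0 q = 0
    simp [reflect, h.zero]
  · change reflect (l z) 1 q = 0
    simp [reflect, h.one]
  · exact (jetNorm_reflect (l z) x).trans_le (h.le z _ (hmem0 hx))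
  · have h1 := norm_jetVec_reflect_sub (l z) x 0
    have h2 := h.lipschitz z (-x) (hmem0 hx)
    rw [neg_zero] at h1
    rw [abs_neg] at h2
    exact h1.trans h2
  · refine (h.norm_le z).trans_eq ?_
    have := integral_norm_reflect_zero (reflect (l z)) 0 q
    rw [reflect_reflect, neg_zero] at this
    rw [this]
    rfl
  · obtain ⟨z, hz, hnear⟩ := h.near (-s) ⟨by linarith [hs.2], by linarith [hs.1]⟩ (reflect d)
      (hd.reflect (by linarith [hs.2, hs.1])) (by simp [reflect, h0]) (by simp [reflect, h1])
    rw [integral_norm_reflect, integral_norm_reflect_zero] at hz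
    refine ⟨z, hz, fun x hx => ?_⟩
    have := hnear (-x) (hmem hx)
    rw [integral_norm_reflect, ← jetNorm_reflect] at this
    have e : reflect (reflect d - l z) = d - reflectMap (l z) := by
      change reflectMap (reflect d - l z) = _
      rw [map_sub]
      congr 1
      exact reflect_reflect d
    rwa [e] at this

/-! ### Estimates for the perturbed equation -/

/-- The glued function of a pair of outer solutions. -/
noncomputable def glue (l r : (ℂ × ℂ) →ₗ[ℂ] (ℕ → ℝ → ℂ))
    (z : (ℂ × ℂ) × (ℂ × ℂ)) (x : ℝ) : ℂ :=
  if x < 0 then l z.1 0 x else r z.2 0 x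

theorem norm_apply_zero_le {f : ℕ → ℝ → ℂ} {x M : ℝ} (h0 : f 0 0 = 0)
    (hM : ‖jetVec f x - jetVec f 0‖ ≤ M) : ‖f 0 x‖ ≤ M := by
  have := (norm_le_pi_norm (jetVec f x - jetVec f 0) 0).trans hM
  simpa [jetVec, h0] using this

/-- The data of the perturbed problem: the outer solution families and the interface map. -/
structure IsMatching (D : InnerData) (a b : ℝ) (l r : (ℂ × ℂ) →ₗ[ℂ] (ℕ → ℝ → ℂ))
    (J : ((Fin 4 → ℂ) × (Fin 4 → ℂ)) →ₗ[ℂ] (Fin 4 → ℂ)) (C ε₀ : ℝ) : Prop where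
  ha : a < 0
  hb : 0 < b
  hQ : ContinuousOn D.Q (Icc a b)
  potential_eq : ∀ ε, 0 < ε → ∀ x, ε ≤ |x| → D.potential ε x = D.Q x
  ε₀_pos : 0 < ε₀
  C_pos : 0 < C
  left : IsLeftFamily a D.Q l C
  right : IsRightFamily b D.Q r C
  interface : IsInterfaceMap D J C ε₀
  small : ε₀ ≤ -a / 2 ∧ ε₀ ≤ b / 2 ∧ ε₀ ≤ 1 ∧ ε₀ ≤ D.r

namespace IsMatching

variable {D : InnerData} {a b C ε₀ : ℝ} {l r : (ℂ × ℂ) →ₗ[ℂ] (ℕ → ℝ → ℂ)}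
  {J : ((Fin 4 → ℂ) × (Fin 4 → ℂ)) →ₗ[ℂ] (Fin 4 → ℂ)}

theorem continuousOn_potential (h : IsMatching D a b l r J C ε₀) (ε : ℝ) :
    ContinuousOn (D.potential ε) (Icc a b) :=
  h.hQ.add (D.continuous_regularization ε).continuousOn

/-- `F` and `G` are the `L¹` norms of the defect and of the function. The outer families approximate
`d` up to the defect and bound its traces at `±ε` by a multiple of `F + G`; with these traces `d` is
admissible in the inner region, and the interface map applies. -/
theorem exists_outer_estimate (h : IsMatching D a b l r J C ε₀) :
    ∃ K : ℝ, 0 < K ∧ ∀ ε, 0 < ε → ε < ε₀ → ∀ d,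
    IsDirichletJet a b d → ∀ F G, F = (∫ x in a..b, ‖d 4 x + D.potential ε x * d 0 x‖) →
    G = (∫ x in a..b, ‖d 0 x‖) → ∃ z : (ℂ × ℂ) × (ℂ × ℂ), ‖z‖ ≤ K * (F + G) ∧
    (∀ x ∈ Icc a (-ε), jetNorm (d - l z.1) x ≤ K * F) ∧
    (∀ x ∈ Icc ε b, jetNorm (d - r z.2) x ≤ K * F) ∧
    ‖jetVec d (-ε)‖ ≤ K * (F + G) ∧ ‖jetVec d ε‖ ≤ K * (F + G) ∧
    (∀ x ∈ Icc (-ε) ε, ‖d 0 x‖ ≤ K * ε * (F + G)) ∧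
    ‖J (jetVec d (-ε), jetVec d ε)‖ ≤ K * ε * (F + G) := by
  have hC := h.C_pos
  obtain ⟨s1, s2, s3, s4⟩ := h.small
  have hab : a ≤ b := (h.ha.trans h.hb).le
  set K₁ := C + C * C + 1 with hK₁
  have hK₁0 : 1 ≤ K₁ := by rw [hK₁]; nlinarith
  refine ⟨K₁ + C * K₁, by positivity, fun ε hε hεε d hd F G hF hG => ?_⟩
  have haε : a ≤ -ε := by linarith
  have hεb : ε ≤ b := by linarith
  have hεε' : -ε ≤ ε := by linarith
  have mε : -ε ∈ Icc a b := ⟨haε, by linarith⟩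
  have mε' : ε ∈ Icc a b := ⟨by linarith, hεb⟩
  have iop := hd.jet.intervalIntegrable_op hab (h.continuousOn_potential ε)
  have i0 := hd.jet.intervalIntegrable_zero hab
  have sub : ∀ {f : ℝ → ℂ} {p q : ℝ}, IntervalIntegrable f volume a b → a ≤ p → p ≤ q → q ≤ b →
      ∫ x in p..q, ‖f x‖ ≤ ∫ x in a..b, ‖f x‖ := fun hf h1 h2 h3 =>
    intervalIntegral.integral_mono_interval h1 h2 h3
      (Filter.Eventually.of_forall fun _ => norm_nonneg _) hf.norm
  have hF0 : 0 ≤ F := hF ▸ intervalIntegral.integral_nonneg hab fun _ _ => norm_nonneg _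
  have hG0 : 0 ≤ G := hG ▸ intervalIntegral.integral_nonneg hab fun _ _ => norm_nonneg _
  have hFl : ∫ x in a..(-ε), ‖d 4 x + D.Q x * d 0 x‖ ≤ F := by
    rw [hF]
    refine le_trans (le_of_eq ?_) (sub iop le_rfl haε (by linarith))
    refine intervalIntegral.integral_congr fun x hx => ?_
    rw [uIcc_of_le haε] at hx
    simp only [h.potential_eq ε hε x (by rw [le_abs']; exact Or.inl hx.2)]
  have hFr : ∫ x in ε..b, ‖d 4 x + D.Q x * d 0 x‖ ≤ F := by
    rw [hF]
    refine le_trans (le_of_eq ?_) (sub iop (by linarith) hεb le_rfl)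
    refine intervalIntegral.integral_congr fun x hx => ?_
    rw [uIcc_of_le hεb] at hx
    simp only [h.potential_eq ε hε x (by rw [le_abs']; exact Or.inr hx.1)]
  have hGl : ∫ x in a..(-ε), ‖d 0 x‖ ≤ G := hG ▸ sub i0 le_rfl haε (by linarith)
  have hGr : ∫ x in ε..b, ‖d 0 x‖ ≤ G := hG ▸ sub i0 (by linarith) hεb le_rfl
  obtain ⟨z₁, hz₁, hn₁⟩ := h.left.near (-ε) ⟨by linarith, by linarith⟩ d
    (hd.jet.mono le_rfl haε (by linarith)) hd.left0 hd.left1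
  obtain ⟨z₂, hz₂, hn₂⟩ := h.right.near ε ⟨hε.le, by linarith⟩ d
    (hd.jet.mono (by linarith) hεb le_rfl) hd.right0 hd.right1
  replace hz₁ : ‖z₁‖ ≤ C * (F + G) := hz₁.trans (by gcongr)
  replace hz₂ : ‖z₂‖ ≤ C * (F + G) := hz₂.trans (by gcongr)
  replace hn₁ : ∀ x ∈ Icc a (-ε), jetNorm (d - l z₁) x ≤ C * F := fun x hx =>
    (hn₁ x hx).trans (by gcongr)
  replace hn₂ : ∀ x ∈ Icc ε b, jetNorm (d - r z₂) x ≤ C * F := fun x hx =>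
    (hn₂ x hx).trans (by gcongr)
  have hFG : 0 ≤ F + G := by positivity
  have hCG : 0 ≤ C * G := by positivity
  have hv₁ : ‖jetVec d (-ε)‖ ≤ K₁ * (F + G) := by
    have m : -ε ∈ Icc a (-ε) := right_mem_Icc.2 haε
    have t1 := jetNorm_add_le (d - l z₁) (l z₁) (-ε)
    rw [sub_add_cancel] at t1
    have t2 := h.left.le z₁ (-ε) ⟨haε, by linarith⟩
    have t3 : C * ‖z₁‖ ≤ C * (C * (F + G)) := by gcongr
    have := (norm_jetVec_le d (-ε)).trans t1
    rw [hK₁]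
    linarith [hn₁ _ m]
  have hv₂ : ‖jetVec d ε‖ ≤ K₁ * (F + G) := by
    have m : ε ∈ Icc ε b := left_mem_Icc.2 hεb
    have t1 := jetNorm_add_le (d - r z₂) (r z₂) ε
    rw [sub_add_cancel] at t1
    have t2 := h.right.le z₂ ε ⟨hε.le, hεb⟩
    have t3 : C * ‖z₂‖ ≤ C * (C * (F + G)) := by gcongr
    have := (norm_jetVec_le d ε).trans t1
    rw [hK₁]
    linarith [hn₂ _ m]
  have hadm : D.Admissible ε (K₁ * (F + G)) d := by
    refine ⟨hε, by linarith, by linarith, hd.jet.mono haε hεε' hεb, hv₁, hv₂, ?_⟩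
    have := sub iop haε hεε' hεb
    rw [← hF] at this
    nlinarith
  obtain ⟨e1, e2⟩ := h.interface.estimate ε _ d hadm hεε
  have p1 : 0 ≤ C * K₁ := by positivity
  have hCK : C ≤ K₁ := by rw [hK₁]; nlinarith
  have fin1 : C * ε * (K₁ * (F + G)) ≤ (K₁ + C * K₁) * ε * (F + G) := by
    have : 0 ≤ K₁ * ε * (F + G) := by positivity
    nlinarith
  refine ⟨(z₁, z₂), ?_, fun x hx => (hn₁ x hx).trans ?_, fun x hx => (hn₂ x hx).trans ?_,
    hv₁.trans ?_, hv₂.trans ?_, fun x hx => (e2 x hx).trans fin1, e1.trans fin1⟩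
  · refine norm_prod_le_iff.2 ⟨hz₁.trans ?_, hz₂.trans ?_⟩ <;> gcongr <;> linarith
  all_goals gcongr; linarith

/-- Both outer solutions vanish at the origin and are Lipschitz, so the glued function is `O(ε)` on
the inner interval. -/
theorem norm_glue_le (h : IsMatching D a b l r J C ε₀) {ε : ℝ} (hεε : ε < ε₀) {z : (ℂ × ℂ) × (ℂ × ℂ)}
    (hl : l z.1 0 0 = 0) (hr : r z.2 0 0 = 0) {x : ℝ} (hx : x ∈ Icc (-ε) ε) :
    ‖glue l r z x‖ ≤ C * ‖z‖ * ε := by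
  have hC := h.C_pos
  have := h.ha
  have := h.hb
  obtain ⟨s1, s2, s3, s4⟩ := h.small
  have hxε : |x| ≤ ε := abs_le.2 hx
  unfold glue
  split_ifs with hx0
  · have := h.left.lipschitz z.1 x ⟨by linarith [hx.1], hx0.le⟩
    refine (norm_apply_zero_le hl this).trans ?_
    gcongr
    exact norm_fst_le z
  · have := h.right.lipschitz z.2 x ⟨by linarith, by linarith [hx.2]⟩
    refine (norm_apply_zero_le hr this).trans ?_
    gcongr
    exact norm_snd_le z

/-- A jet with small defect is close to a multiple of the limit eigenfunction. -/
theorem exists_near_glue (h : IsMatching D a b l r J C ε₀)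
    {ζ : (ℂ × ℂ) × (ℂ × ℂ)} (hl : l ζ.1 0 0 = 0) (hr : r ζ.2 0 0 = 0)
    (hker : ∀ z : (ℂ × ℂ) × (ℂ × ℂ), J (jetVec (l z.1) 0, jetVec (r z.2) 0) = 0 →
      ∃ c : ℂ, z = c • ζ) :
    ∃ K : ℝ, 0 < K ∧ ∀ ε, 0 < ε → ε < ε₀ → ∀ d, IsDirichletJet a b d → ∀ F G,
      F = (∫ x in a..b, ‖d 4 x + D.potential ε x * d 0 x‖) →
      G = (∫ x in a..b, ‖d 0 x‖) → ∃ c : ℂ, ∀ x ∈ Icc a b,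
      ‖d 0 x - c * glue l r ζ x‖ ≤ K * (F + ε * G) := by
  obtain ⟨K, hK, hout⟩ := h.exists_outer_estimate
  have hC := h.C_pos
  obtain ⟨s1, s2, s3, s4⟩ := h.small
  have hab : a ≤ b := (h.ha.trans h.hb).le
  -- The interface conditions as a map on the outer parameters; by `hker` its kernel consists of
  -- multiples of `ζ`.
  let B : ((ℂ × ℂ) × (ℂ × ℂ)) →ₗ[ℂ] (Fin 4 → ℂ) :=
    { toFun := fun z => J (jetVec (l z.1) 0, jetVec (r z.2) 0)
      map_add' := fun z w => by
        have e1 : jetVec (l (z + w).1) 0 = jetVec (l z.1) 0 + jetVec (l w.1) 0 := by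
          rw [Prod.fst_add, map_add]; rfl
        have e2 : jetVec (r (z + w).2) 0 = jetVec (r z.2) 0 + jetVec (r w.2) 0 := by
          rw [Prod.snd_add, map_add]; rfl
        rw [e1, e2, ← map_add, Prod.mk_add_mk]
      map_smul' := fun c z => by
        have e1 : jetVec (l (c • z).1) 0 = c • jetVec (l z.1) 0 := by
          rw [Prod.smul_fst, map_smul]; rfl
        have e2 : jetVec (r (c • z).2) 0 = c • jetVec (r z.2) 0 := by
          rw [Prod.smul_snd, map_smul]; rfl
        rw [e1, e2, RingHom.id_apply, ← map_smul, Prod.smul_mk] }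
  obtain ⟨C₁, hC₁, hnear⟩ := exists_mem_ker_norm_sub_le B
  set N := ‖LinearMap.toContinuousLinearMap J‖ with hN
  have hJ : ∀ p, ‖J p‖ ≤ N * ‖p‖ := (LinearMap.toContinuousLinearMap J).le_opNorm
  have hN0 : 0 ≤ N := norm_nonneg _
  set A := 2 * (N * (K + C * K) + K) with hA
  have hA0 : 0 < A := by positivity
  set R := K + C * (C₁ * A) + 2 * K + C * (K + C₁ * A) * 2 with hR
  refine ⟨R, by positivity, fun ε hε hεε d hd F G hF hG => ?_⟩
  have hε1 : ε ≤ 1 := by linarith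
  have haε : a ≤ -ε := by linarith
  have hεb : ε ≤ b := by linarith
  have hF0 : 0 ≤ F := hF ▸ intervalIntegral.integral_nonneg hab fun _ _ => norm_nonneg _
  have hG0 : 0 ≤ G := hG ▸ intervalIntegral.integral_nonneg hab fun _ _ => norm_nonneg _
  obtain ⟨z, hz, hzl, hzr, -, -, hin, hJε⟩ := hout ε hε hεε d hd F G hF hG
  have hεF : ε * F ≤ F := by nlinarith
  have hεG : 0 ≤ ε * G := by positivity
  have hBz : ‖B z‖ ≤ A * (F + ε * G) := by
    -- `J` is small on the traces of `d` at `±ε`. Replacing them by the traces of the outer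
    -- solutions at `0` costs the outer error `K F` and a Lipschitz error of order ε.
    have e : B z = J (jetVec d (-ε), jetVec d ε) - J (jetVec d (-ε) - jetVec (l z.1) 0,
        jetVec d ε - jetVec (r z.2) 0) := by
      rw [← map_sub, Prod.mk_sub_mk, sub_sub_cancel, sub_sub_cancel]
      rfl
    have b1 : ‖jetVec d (-ε) - jetVec (l z.1) 0‖ ≤ K * F + C * (K * (F + G)) * ε := by
      have t1 := (norm_jetVec_le (d - l z.1) (-ε)).trans (hzl (-ε) (right_mem_Icc.2 haε))
      have t2 := h.left.lipschitz z.1 (-ε) ⟨haε, by linarith⟩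
      rw [abs_neg, abs_of_pos hε] at t2
      have e2 : jetVec d (-ε) - jetVec (l z.1) 0 = jetVec (d - l z.1) (-ε)
          + (jetVec (l z.1) (-ε) - jetVec (l z.1) 0) := by
        have : jetVec (d - l z.1) (-ε) = jetVec d (-ε) - jetVec (l z.1) (-ε) := rfl
        rw [this]; abel
      rw [e2]
      refine (norm_add_le _ _).trans (add_le_add t1 (t2.trans ?_))
      gcongr
      exact (norm_fst_le z).trans hz
    have b2 : ‖jetVec d ε - jetVec (r z.2) 0‖ ≤ K * F + C * (K * (F + G)) * ε := by
      have t1 := (norm_jetVec_le (d - r z.2) ε).trans (hzr ε (left_mem_Icc.2 hεb))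
      have t2 := h.right.lipschitz z.2 ε ⟨hε.le, hεb⟩
      rw [abs_of_pos hε] at t2
      have e2 : jetVec d ε - jetVec (r z.2) 0 = jetVec (d - r z.2) ε
          + (jetVec (r z.2) ε - jetVec (r z.2) 0) := by
        have : jetVec (d - r z.2) ε = jetVec d ε - jetVec (r z.2) ε := rfl
        rw [this]; abel
      rw [e2]
      refine (norm_add_le _ _).trans (add_le_add t1 (t2.trans ?_))
      gcongr
      exact (norm_snd_le z).trans hz
    have b3 : ‖(jetVec d (-ε) - jetVec (l z.1) 0, jetVec d ε - jetVec (r z.2) 0)‖ ≤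
        K * F + C * (K * (F + G)) * ε := norm_prod_le_iff.2 ⟨b1, b2⟩
    rw [e]
    calc _ ≤ K * ε * (F + G) + N * (K * F + C * (K * (F + G)) * ε) :=
          (norm_sub_le _ _).trans (add_le_add hJε ((hJ _).trans (by gcongr)))
      _ = K * (ε * F + ε * G) + N * K * F + N * (C * K) * (ε * F + ε * G) := by ring
      _ ≤ K * (F + ε * G) + N * K * (F + ε * G) + N * (C * K) * (F + ε * G) := by
          gcongr
          linarith
      _ ≤ A * (F + ε * G) := by
          have : 0 ≤ (N * (K + C * K) + K) * (F + ε * G) := by positivity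
          rw [hA]
          linarith
  obtain ⟨w, hw, hzw⟩ := hnear z
  obtain ⟨c, rfl⟩ := hker w hw
  replace hzw : ‖z - c • ζ‖ ≤ C₁ * A * (F + ε * G) := by
    refine hzw.trans ?_
    rw [mul_assoc]
    gcongr
  refine ⟨c, fun x hx => ?_⟩
  have hX : 0 ≤ F + ε * G := by positivity
  have p1 : 0 ≤ C * (C₁ * A) * (F + ε * G) := by positivity
  have p2 : 0 ≤ K * (F + ε * G) := by positivity
  have p3 : 0 ≤ C * (K + C₁ * A) * (F + ε * G) := by positivity
  have pF : K * F ≤ K * (F + ε * G) := by gcongr; linarith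
  rcases le_or_gt x (-ε) with hx1 | hx1
  · have hx0 : x < 0 := by linarith
    have e : d 0 x - c * glue l r ζ x = (d - l z.1) 0 x + l (z - c • ζ).1 0 x := by
      rw [glue, if_pos hx0, Prod.fst_sub, Prod.smul_fst, map_sub, map_smul]
      simp only [Pi.sub_apply, Pi.smul_apply, smul_eq_mul]
      ring
    have t1 := (norm_le_jetNorm (d - l z.1) x (j := 0) (by norm_num)).trans (hzl x ⟨hx.1, hx1⟩)
    have t2 := (norm_le_jetNorm (l (z - c • ζ).1) x (j := 0) (by norm_num)).trans
      (h.left.le _ x ⟨hx.1, hx0.le⟩)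
    have t3 : C * ‖(z - c • ζ).1‖ ≤ C * (C₁ * A * (F + ε * G)) := by
      gcongr
      exact (norm_fst_le _).trans hzw
    rw [e]
    refine (norm_add_le _ _).trans ?_
    rw [hR]
    linarith
  rcases le_or_gt ε x with hx2 | hx2
  · have hx0 : ¬ x < 0 := by linarith
    have e : d 0 x - c * glue l r ζ x = (d - r z.2) 0 x + r (z - c • ζ).2 0 x := by
      rw [glue, if_neg hx0, Prod.snd_sub, Prod.smul_snd, map_sub, map_smul]
      simp only [Pi.sub_apply, Pi.smul_apply, smul_eq_mul]
      ring
    have t1 := (norm_le_jetNorm (d - r z.2) x (j := 0) (by norm_num)).trans (hzr x ⟨hx2, hx.2⟩)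
    have t2 := (norm_le_jetNorm (r (z - c • ζ).2) x (j := 0) (by norm_num)).trans
      (h.right.le _ x ⟨by linarith, hx.2⟩)
    have t3 : C * ‖(z - c • ζ).2‖ ≤ C * (C₁ * A * (F + ε * G)) := by
      gcongr
      exact (norm_snd_le _).trans hzw
    rw [e]
    refine (norm_add_le _ _).trans ?_
    rw [hR]
    linarith
  -- In the inner interval no comparison is needed: `d 0` and the glued function are small
  -- separately.
  · have hxε : x ∈ Icc (-ε) ε := ⟨hx1.le, hx2.le⟩
    have t1 : ‖d 0 x‖ ≤ K * (F + ε * G) := by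
      refine (hin x hxε).trans ?_
      have e : K * ε * (F + G) = K * (ε * F + ε * G) := by ring
      rw [e]
      gcongr
    have t2 : ‖c‖ * ‖ζ‖ ≤ (K + C₁ * A) * (F + G) := by
      rw [← norm_smul]
      have e : c • ζ = z - (z - c • ζ) := by abel
      rw [e]
      refine (norm_sub_le _ _).trans ((add_le_add hz hzw).trans ?_)
      have : ε * G ≤ G := by nlinarith
      calc _ ≤ K * (F + G) + C₁ * A * (F + G) := by gcongr
        _ = _ := by ring
    have t3 : ‖c * glue l r ζ x‖ ≤ C * (K + C₁ * A) * (F + ε * G) := by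
      rw [norm_mul]
      calc ‖c‖ * ‖glue l r ζ x‖ ≤ ‖c‖ * (C * ‖ζ‖ * ε) := by
            gcongr
            exact h.norm_glue_le hεε hl hr hxε
        _ = C * ε * (‖c‖ * ‖ζ‖) := by ring
        _ ≤ C * ε * ((K + C₁ * A) * (F + G)) := by gcongr
        _ = C * (K + C₁ * A) * (ε * F + ε * G) := by ring
        _ ≤ _ := by gcongr
    refine (norm_sub_le _ _).trans ((add_le_add t1 t3).trans ?_)
    rw [hR]
    linarith

end IsMatching


/-! ### Almost orthogonality of the defect to the limit eigenfunction. -/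

theorem IsSolution.green {p q : ℝ} (hpq : p ≤ q) {V : ℝ → ℝ} (hV : ContinuousOn V (Icc p q))
    {d e : ℕ → ℝ → ℂ} (hd : IsJet p q d) (he : IsSolution p q V e) :
    ∫ t in p..q, starRingEnd ℂ (e 0 t) * (d 4 t + V t * d 0 t) =
      lagrangeForm (jetVec d q) (jetVec e q) - lagrangeForm (jetVec d p) (jetVec e p) := by
  have hg := hd.green hpq he.jet.conj
  have c0 := he.jet.conj.continuousOn hpq (j := 0) (by norm_num)
  have d0 := hd.continuousOn hpq (j := 0) (by norm_num)
  have i4 : IntervalIntegrable (fun t => d 4 t * starRingEnd ℂ (e 0 t)) volume p q :=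
    (hd.prim 3 (by norm_num)).int.mul_continuousOn (by rwa [uIcc_of_le hpq])
  have iV : IntervalIntegrable (fun t => V t * d 0 t * starRingEnd ℂ (e 0 t)) volume p q :=
    ContinuousOn.intervalIntegrable (by
      rw [uIcc_of_le hpq]; exact (continuousOn_ofReal_mul hV d0).mul c0)
  have e1 : ∫ t in p..q, starRingEnd ℂ (e 4 t) * d 0 t
      = -∫ t in p..q, V t * d 0 t * starRingEnd ℂ (e 0 t) := by
    rw [← intervalIntegral.integral_neg]
    refine intervalIntegral.integral_congr fun t ht => ?_
    rw [uIcc_of_le hpq] at ht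
    have := congrArg (starRingEnd ℂ) (he.eqn t ht)
    rw [map_add, map_mul, Complex.conj_ofReal, map_zero] at this
    linear_combination d 0 t * this
  have e2 : ∫ t in p..q, starRingEnd ℂ (e 0 t) * (d 4 t + V t * d 0 t) =
      (∫ t in p..q, d 4 t * starRingEnd ℂ (e 0 t))
      + ∫ t in p..q, V t * d 0 t * starRingEnd ℂ (e 0 t) := by
    rw [← intervalIntegral.integral_add i4 iV]
    congr 1
    ext t
    ring
  rw [e2, hg, e1]
  simp only [lagrangeForm, jetVec, Fin.isValue, Fin.val_zero, Fin.val_one, Fin.val_two]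
  have e3 : ((3 : Fin 4) : ℕ) = 3 := rfl
  rw [e3]
  ring

theorem norm_lagrangeForm_sub_le (x y y' : Fin 4 → ℂ) :
    ‖lagrangeForm x y - lagrangeForm x y'‖ ≤ 4 * ‖x‖ * ‖y - y'‖ := by
  have e : lagrangeForm x y - lagrangeForm x y' = x 3 * starRingEnd ℂ ((y - y') 0)
      - x 2 * starRingEnd ℂ ((y - y') 1) + x 1 * starRingEnd ℂ ((y - y') 2)
      - x 0 * starRingEnd ℂ ((y - y') 3) := by
    simp only [lagrangeForm, Pi.sub_apply, map_sub]
    ring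
  have b : ∀ i j, ‖x i * starRingEnd ℂ ((y - y') j)‖ ≤ ‖x‖ * ‖y - y'‖ := fun i j => by
    rw [norm_mul, RCLike.norm_conj]
    exact mul_le_mul (norm_le_pi_norm x i) (norm_le_pi_norm _ j) (norm_nonneg _) (norm_nonneg _)
  rw [e]
  refine (norm_sub_le _ _).trans ((add_le_add ((norm_add_le _ _).trans (add_le_add
    ((norm_sub_le _ _).trans (add_le_add (b 3 0) (b 2 1))) (b 1 2))) (b 0 3)).trans ?_)
  linarith

theorem glue_eq_left {l r : (ℂ × ℂ) →ₗ[ℂ] (ℕ → ℝ → ℂ)} {z : (ℂ × ℂ) × (ℂ × ℂ)}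
    (hl : l z.1 0 0 = 0) (hr : r z.2 0 0 = 0) {x : ℝ} (hx : x ≤ 0) :
    glue l r z x = l z.1 0 x := by
  rcases hx.lt_or_eq with h | rfl
  · rw [glue, if_pos h]
  · rw [glue, if_neg (lt_irrefl _), hl, hr]

theorem glue_eq_right {l r : (ℂ × ℂ) →ₗ[ℂ] (ℕ → ℝ → ℂ)} {z : (ℂ × ℂ) × (ℂ × ℂ)}
    {x : ℝ} (hx : 0 ≤ x) : glue l r z x = r z.2 0 x := by
  rw [glue, if_neg hx.not_gt]

theorem glue_sub_smul (l r : (ℂ × ℂ) →ₗ[ℂ] (ℕ → ℝ → ℂ)) (z w : (ℂ × ℂ) × (ℂ × ℂ)) (c : ℂ)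
    (x : ℝ) : glue l r (z - c • w) x = glue l r z x - c * glue l r w x := by
  unfold glue
  split_ifs
  · rw [Prod.fst_sub, Prod.smul_fst, map_sub, map_smul]
    simp
  · rw [Prod.snd_sub, Prod.smul_snd, map_sub, map_smul]
    simp

namespace IsMatching

variable {D : InnerData} {a b C ε₀ : ℝ} {l r : (ℂ × ℂ) →ₗ[ℂ] (ℕ → ℝ → ℂ)}
  {J : ((Fin 4 → ℂ) × (Fin 4 → ℂ)) →ₗ[ℂ] (Fin 4 → ℂ)}

theorem continuousOn_glue (h : IsMatching D a b l r J C ε₀) {z : (ℂ × ℂ) × (ℂ × ℂ)}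
    (hl : l z.1 0 0 = 0) (hr : r z.2 0 0 = 0) : ContinuousOn (glue l r z) (Icc a b) := by
  rw [← Icc_union_Icc_eq_Icc h.ha.le h.hb.le]
  refine ContinuousOn.union_of_isClosed ?_ ?_ isClosed_Icc isClosed_Icc
  · exact ((h.left.sol z.1).jet.continuousOn h.ha.le (j := 0) (by norm_num)).congr
      fun x hx => glue_eq_left hl hr hx.2
  · exact ((h.right.sol z.2).jet.continuousOn h.hb.le (j := 0) (by norm_num)).congr
      fun x hx => glue_eq_right hx.1

/-- The defect of a jet is almost orthogonal to the limit eigenfunction. -/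
theorem exists_pairing_le (h : IsMatching D a b l r J C ε₀) {ζ : (ℂ × ℂ) × (ℂ × ℂ)}
    (hl : l ζ.1 0 0 = 0) (hr : r ζ.2 0 0 = 0)
    (hJ : J (jetVec (l ζ.1) 0, jetVec (r ζ.2) 0) = 0) :
    ∃ K : ℝ, 0 < K ∧ ∀ ε, 0 < ε → ε < ε₀ → ∀ d, IsDirichletJet a b d → ∀ F G,
      F = (∫ x in a..b, ‖d 4 x + D.potential ε x * d 0 x‖) →
      G = (∫ x in a..b, ‖d 0 x‖) →
      ‖∫ x in a..b, starRingEnd ℂ (glue l r ζ x) * (d 4 x + D.potential ε x * d 0 x)‖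
        ≤ K * ε * (F + G) := by
  obtain ⟨K, hK, hout⟩ := h.exists_outer_estimate
  have hC := h.C_pos
  obtain ⟨s1, s2, s3, s4⟩ := h.small
  have hab : a ≤ b := (h.ha.trans h.hb).le
  refine ⟨C * ‖ζ‖ + 8 * K * (C * ‖ζ‖) + 2 * K * (2 * C * ‖ζ‖) + K, by positivity,
    fun ε hε hεε d hd F G hF hG => ?_⟩
  have haε : a ≤ -ε := by linarith
  have hεb : ε ≤ b := by linarith
  have hεε' : -ε ≤ ε := by linarith
  have m1 : -ε ∈ Icc a b := ⟨haε, by linarith⟩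
  have m2 : ε ∈ Icc a b := ⟨by linarith, hεb⟩
  have hF0 : 0 ≤ F := hF ▸ intervalIntegral.integral_nonneg hab fun _ _ => norm_nonneg _
  have hG0 : 0 ≤ G := hG ▸ intervalIntegral.integral_nonneg hab fun _ _ => norm_nonneg _
  obtain ⟨-, -, -, -, hv₁, hv₂, -, hJε⟩ := hout ε hε hεε d hd F G hF hG
  set g : ℝ → ℂ := fun x => d 4 x + D.potential ε x * d 0 x with hg
  have iop : IntervalIntegrable g volume a b :=
    hd.jet.intervalIntegrable_op hab (h.continuousOn_potential ε)
  have hglue := h.continuousOn_glue hl hr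
  have icg : IntervalIntegrable (fun x => starRingEnd ℂ (glue l r ζ x) * g x) volume a b :=
    iop.continuousOn_mul (by
      rw [uIcc_of_le hab]; exact Complex.continuous_conj.comp_continuousOn hglue)
  have j1 := intervalIntegrable_sub_interval hab icg (left_mem_Icc.2 hab) m1
  have j2 := intervalIntegrable_sub_interval hab icg m1 m2
  have j3 := intervalIntegrable_sub_interval hab icg m2 (right_mem_Icc.2 hab)
  -- On the outer intervals the glued function solves the same equation, so Green's formula leaves
  -- only the boundary form at `±ε`; at `a` and `b` it vanishes by the Dirichlet conditions.
  have hleft : ∫ x in a..(-ε), starRingEnd ℂ (glue l r ζ x) * g x =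
      lagrangeForm (jetVec d (-ε)) (jetVec (l ζ.1) (-ε)) := by
    have hs : IsSolution a (-ε) D.Q (l ζ.1) :=
      ⟨(h.left.sol ζ.1).jet.mono le_rfl haε (by linarith),
        fun x hx => (h.left.sol ζ.1).eqn x ⟨hx.1, by linarith [hx.2]⟩⟩
    have hgr := hs.green haε (h.hQ.mono (Icc_subset_Icc_right m1.2))
      (hd.jet.mono le_rfl haε m1.2)
    have e0 : lagrangeForm (jetVec d a) (jetVec (l ζ.1) a) = 0 := by
      simp [lagrangeForm, jetVec, hd.left0, hd.left1, h.left.zero, h.left.one]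
    rw [e0, sub_zero] at hgr
    rw [← hgr]
    refine intervalIntegral.integral_congr fun x hx => ?_
    rw [uIcc_of_le haε] at hx
    simp only [hg, h.potential_eq ε hε x (by rw [le_abs']; exact Or.inl hx.2),
      glue_eq_left hl hr (show x ≤ 0 by linarith [hx.2])]
  have hright : ∫ x in ε..b, starRingEnd ℂ (glue l r ζ x) * g x =
      -lagrangeForm (jetVec d ε) (jetVec (r ζ.2) ε) := by
    have hs : IsSolution ε b D.Q (r ζ.2) :=
      ⟨(h.right.sol ζ.2).jet.mono hε.le hεb le_rfl,
        fun x hx => (h.right.sol ζ.2).eqn x ⟨by linarith [hx.1], hx.2⟩⟩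
    have hgr := hs.green hεb (h.hQ.mono (Icc_subset_Icc_left m2.1))
      (hd.jet.mono m2.1 hεb le_rfl)
    have e0 : lagrangeForm (jetVec d b) (jetVec (r ζ.2) b) = 0 := by
      simp [lagrangeForm, jetVec, hd.right0, hd.right1, h.right.zero, h.right.one]
    rw [e0, zero_sub] at hgr
    rw [← hgr]
    refine intervalIntegral.integral_congr fun x hx => ?_
    rw [uIcc_of_le hεb] at hx
    simp only [hg, h.potential_eq ε hε x (by rw [le_abs']; exact Or.inr hx.1),
      glue_eq_right (show 0 ≤ x by linarith [hx.1])]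
  have hmid : ‖∫ x in (-ε)..ε, starRingEnd ℂ (glue l r ζ x) * g x‖ ≤ C * ‖ζ‖ * ε * F := by
    have k1 := intervalIntegrable_sub_interval hab iop m1 m2
    have k2 : ∫ x in (-ε)..ε, ‖g x‖ ≤ F := by
      rw [hF]
      exact intervalIntegral.integral_mono_interval haε hεε' hεb
        (Filter.Eventually.of_forall fun _ => norm_nonneg _) iop.norm
    refine (intervalIntegral.norm_integral_le_of_norm_le hεε'
      (g := fun x => C * ‖ζ‖ * ε * ‖g x‖) ?_ (k1.norm.const_mul _)).trans ?_
    · refine Filter.Eventually.of_forall fun x hx => ?_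
      rw [norm_mul, RCLike.norm_conj]
      gcongr
      exact h.norm_glue_le hεε hl hr (Ioc_subset_Icc_self hx)
    · rw [intervalIntegral.integral_const_mul]
      gcongr
  have l1 := h.left.lipschitz ζ.1 (-ε) ⟨haε, by linarith⟩
  have l2 := h.right.lipschitz ζ.2 ε ⟨hε.le, hεb⟩
  rw [abs_neg, abs_of_pos hε] at l1
  rw [abs_of_pos hε] at l2
  replace l1 : ‖jetVec (l ζ.1) (-ε) - jetVec (l ζ.1) 0‖ ≤ C * ‖ζ‖ * ε := l1.trans (by
    gcongr; exact norm_fst_le ζ)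
  replace l2 : ‖jetVec (r ζ.2) ε - jetVec (r ζ.2) 0‖ ≤ C * ‖ζ‖ * ε := l2.trans (by
    gcongr; exact norm_snd_le ζ)
  have n1 : ‖jetVec (l ζ.1) 0‖ ≤ C * ‖ζ‖ := ((norm_jetVec_le _ _).trans
    (h.left.le ζ.1 0 (right_mem_Icc.2 h.ha.le))).trans (by gcongr; exact norm_fst_le ζ)
  have n2 : ‖jetVec (r ζ.2) 0‖ ≤ C * ‖ζ‖ := ((norm_jetVec_le _ _).trans
    (h.right.le ζ.2 0 (left_mem_Icc.2 h.hb.le))).trans (by gcongr; exact norm_snd_le ζ)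
  have q1 := (norm_lagrangeForm_sub_le (jetVec d (-ε)) (jetVec (l ζ.1) (-ε)) (jetVec (l ζ.1) 0))
  have q2 := (norm_lagrangeForm_sub_le (jetVec d ε) (jetVec (r ζ.2) ε) (jetVec (r ζ.2) 0))
  have q3 := h.interface.isotropic (jetVec d (-ε)) (jetVec d ε) _ _ hJ
  have r1 : 4 * ‖jetVec d (-ε)‖ * ‖jetVec (l ζ.1) (-ε) - jetVec (l ζ.1) 0‖ ≤
      4 * (K * (F + G)) * (C * ‖ζ‖ * ε) := by gcongr
  have r2 : 4 * ‖jetVec d ε‖ * ‖jetVec (r ζ.2) ε - jetVec (r ζ.2) 0‖ ≤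
      4 * (K * (F + G)) * (C * ‖ζ‖ * ε) := by gcongr
  have r3 : 2 * ‖J (jetVec d (-ε), jetVec d ε)‖ * (‖jetVec (l ζ.1) 0‖ + ‖jetVec (r ζ.2) 0‖) ≤
      2 * (K * ε * (F + G)) * (C * ‖ζ‖ + C * ‖ζ‖) := by gcongr
  rw [← intervalIntegral.integral_add_adjacent_intervals (j1.trans j2) j3,
    ← intervalIntegral.integral_add_adjacent_intervals j1 j2, hleft, hright]
  set I := ∫ x in (-ε)..ε, starRingEnd ℂ (glue l r ζ x) * g x
  -- The traces of the limit function are moved from `±ε` to `0` at a Lipschitz cost. The remaining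
  -- difference of forms is bounded by isotropy, since those traces at `0` lie in the kernel of `J`.
  have e : lagrangeForm (jetVec d (-ε)) (jetVec (l ζ.1) (-ε)) + I
      + -lagrangeForm (jetVec d ε) (jetVec (r ζ.2) ε) =
      (lagrangeForm (jetVec d (-ε)) (jetVec (l ζ.1) (-ε))
        - lagrangeForm (jetVec d (-ε)) (jetVec (l ζ.1) 0))
      - (lagrangeForm (jetVec d ε) (jetVec (r ζ.2) ε)
        - lagrangeForm (jetVec d ε) (jetVec (r ζ.2) 0))
      - (lagrangeForm (jetVec d ε) (jetVec (r ζ.2) 0)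
        - lagrangeForm (jetVec d (-ε)) (jetVec (l ζ.1) 0)) + I := by ring
  rw [e]
  refine (norm_add_le _ _).trans ((add_le_add ((norm_sub_le _ _).trans (add_le_add
    ((norm_sub_le _ _).trans (add_le_add (q1.trans r1) (q2.trans r2))) (q3.trans r3))) hmid).trans ?_)
  have w1 : C * ‖ζ‖ * ε * F ≤ C * ‖ζ‖ * ε * (F + G) := by gcongr; linarith
  have w2 : 0 ≤ K * ε * (F + G) := by positivity
  linarith

end IsMatching

/-! ### Estimates in `L₂` -/

/-- The Cauchy–Schwarz inequality, from the nonnegativity of the integral of `(L ‖F‖ - I)²`, where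
`L` is the length and `I` the integral of `‖F‖`. -/
theorem integral_norm_le {a b : ℝ} (hab : a ≤ b) {u : L2 a b} {F : ℝ → ℂ}
    (hu : u =ᵐ[volume.restrict (Ioo a b)] F) :
    ∫ x in a..b, ‖F x‖ ≤ Real.sqrt (b - a) * ‖u‖ := by
  have hm : MemLp F 2 (volume.restrict (Ioo a b)) := (memLp_congr_ae hu).1 (Lp.memLp u)
  have i1 : IntervalIntegrable (fun x => ‖F x‖) volume a b := (intervalIntegrable_of_memLp hab hm).norm
  have i2 : IntervalIntegrable (fun x => ‖F x‖ ^ 2) volume a b := by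
    rw [intervalIntegrable_iff_integrableOn_Ioo_of_le hab]
    exact (memLp_two_iff_integrable_sq_norm hm.1).1 hm
  have hs := norm_sq_eq_intervalIntegral hab hu
  set L := b - a
  have hL : 0 ≤ L := sub_nonneg.2 hab
  set I := ∫ x in a..b, ‖F x‖
  set S := ∫ x in a..b, ‖F x‖ ^ 2
  have hI : 0 ≤ I := intervalIntegral.integral_nonneg hab fun _ _ => norm_nonneg _
  have h0 : 0 ≤ ∫ x in a..b, (L * ‖F x‖ - I) ^ 2 :=
    intervalIntegral.integral_nonneg hab fun _ _ => sq_nonneg _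
  have e : ∫ x in a..b, (L * ‖F x‖ - I) ^ 2 = L * (L * S - I ^ 2) := by
    have e1 : ∀ x, (L * ‖F x‖ - I) ^ 2 = (L ^ 2 * ‖F x‖ ^ 2 - 2 * L * I * ‖F x‖) + I ^ 2 :=
      fun x => by ring
    simp only [e1]
    rw [intervalIntegral.integral_add ((i2.const_mul _).sub (i1.const_mul _))
      intervalIntegrable_const, intervalIntegral.integral_sub (i2.const_mul _) (i1.const_mul _),
      intervalIntegral.integral_const_mul, intervalIntegral.integral_const_mul,
      intervalIntegral.integral_const, smul_eq_mul]
    ring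
  rw [e] at h0
  rcases hL.lt_or_eq with h | h
  · have h1 : I ^ 2 ≤ L * S := by
      by_contra! hlt
      nlinarith
    refine abs_le_of_sq_le_sq' ?_ (by positivity) |>.2
    rw [mul_pow, Real.sq_sqrt hL, hs]
    exact h1
  · have : a = b := by simp only [L] at h; linarith
    have hI0 : I = 0 := by simp only [I, this, intervalIntegral.integral_same]
    rw [hI0]
    positivity

theorem norm_le_of_forall_norm_le {a b M : ℝ} (hab : a ≤ b) {u : L2 a b} {F : ℝ → ℂ}
    (hu : u =ᵐ[volume.restrict (Ioo a b)] F) (hM0 : 0 ≤ M) (hM : ∀ x ∈ Icc a b, ‖F x‖ ≤ M) :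
    ‖u‖ ≤ Real.sqrt (b - a) * M := by
  have hm : MemLp F 2 (volume.restrict (Ioo a b)) := (memLp_congr_ae hu).1 (Lp.memLp u)
  have i2 : IntervalIntegrable (fun x => ‖F x‖ ^ 2) volume a b := by
    rw [intervalIntegrable_iff_integrableOn_Ioo_of_le hab]
    exact (memLp_two_iff_integrable_sq_norm hm.1).1 hm
  refine abs_le_of_sq_le_sq' ?_ (by positivity) |>.2
  rw [norm_sq_eq_intervalIntegral hab hu, mul_pow, Real.sq_sqrt (sub_nonneg.2 hab)]
  refine (intervalIntegral.integral_mono_on hab i2 intervalIntegrable_const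
    (g := fun _ => M ^ 2) fun x hx => ?_).trans_eq ?_
  · exact pow_le_pow_left₀ (norm_nonneg _) (hM x hx) 2
  · rw [intervalIntegral.integral_const, smul_eq_mul]

/-- Membership of `(y, f + lam y)` in the graph says that `f` is the defect of `y` in the equation
shifted by `lam`. The estimates in `L¹` and in the uniform norm pass to `L₂` with factors `√(b -
a)`. -/
theorem IsMatching.exists_estimates {D : InnerData} {a b C ε₀ lam : ℝ}
    {l r : (ℂ × ℂ) →ₗ[ℂ] (ℕ → ℝ → ℂ)} {J : ((Fin 4 → ℂ) × (Fin 4 → ℂ)) →ₗ[ℂ] (Fin 4 → ℂ)}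
    (h : IsMatching D a b l r J C ε₀) {ζ : (ℂ × ℂ) × (ℂ × ℂ)}
    (hl : l ζ.1 0 0 = 0) (hr : r ζ.2 0 0 = 0)
    (hJ : J (jetVec (l ζ.1) 0, jetVec (r ζ.2) 0) = 0)
    (hker : ∀ z : (ℂ × ℂ) × (ℂ × ℂ), J (jetVec (l z.1) 0, jetVec (r z.2) 0) = 0 →
      ∃ c : ℂ, z = c • ζ) {v : L2 a b} (hv : v =ᵐ[volume.restrict (Ioo a b)] glue l r ζ)
    (hab : a ≤ b) :
    ∃ K : ℝ, 0 < K ∧ ∀ ε, 0 < ε → ε < ε₀ → ∀ V : ℝ → ℝ, (∀ x, V x = D.potential ε x + lam) →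
      ∀ y f : L2 a b, (y, f + (lam : ℂ) • y) ∈ (dirichletOperator a b hab V).graph →
      (∃ c : ℂ, ‖y - c • v‖ ≤ K * (‖f‖ + ε * ‖y‖)) ∧ ‖inner ℂ v f‖ ≤ K * ε * (‖f‖ + ‖y‖) := by
  obtain ⟨K₁, hK₁, h1⟩ := h.exists_near_glue hl hr hker
  obtain ⟨K₂, hK₂, h2⟩ := h.exists_pairing_le hl hr hJ
  set s := Real.sqrt (b - a) with hs
  have hs0 : 0 ≤ s := Real.sqrt_nonneg _
  refine ⟨s * K₁ * s + K₂ * s + 1, by positivity, fun ε hε hεε V hV y f hyf => ?_⟩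
  obtain ⟨d, hd, -, hy, hf⟩ := (mem_dirichletOperator_graph hab).1 hyf
  have hf' : f =ᵐ[volume.restrict (Ioo a b)] fun x => d 4 x + D.potential ε x * d 0 x := by
    have e1 := Lp.coeFn_add f ((lam : ℂ) • y)
    have e2 := Lp.coeFn_smul (lam : ℂ) y
    filter_upwards [hy, hf, e1, e2] with x x1 x2 x3 x4
    rw [x3, Pi.add_apply, x4, Pi.smul_apply, x1, hV x, smul_eq_mul] at x2
    push_cast at x2
    linear_combination x2
  have hF := integral_norm_le hab hf'
  have hG := integral_norm_le hab hy
  have hF0 : 0 ≤ ∫ x in a..b, ‖d 4 x + D.potential ε x * d 0 x‖ :=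
    intervalIntegral.integral_nonneg hab fun _ _ => norm_nonneg _
  have hG0 : 0 ≤ ∫ x in a..b, ‖d 0 x‖ :=
    intervalIntegral.integral_nonneg hab fun _ _ => norm_nonneg _
  have nf := norm_nonneg f
  have ny := norm_nonneg y
  constructor
  · obtain ⟨c, hc⟩ := h1 ε hε hεε d hd _ _ rfl rfl
    refine ⟨c, ?_⟩
    have hyc : (y - c • v : L2 a b) =ᵐ[volume.restrict (Ioo a b)]
        fun x => d 0 x - c * glue l r ζ x := by
      filter_upwards [Lp.coeFn_sub y (c • v), Lp.coeFn_smul c v, hy, hv] with x x1 x2 x3 x4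
      rw [x1, Pi.sub_apply, x2, Pi.smul_apply, x3, x4, smul_eq_mul]
    refine (norm_le_of_forall_norm_le hab hyc (by positivity) hc).trans ?_
    calc _ ≤ s * (K₁ * (s * ‖f‖ + ε * (s * ‖y‖))) := by gcongr
      _ = s * K₁ * s * (‖f‖ + ε * ‖y‖) := by ring
      _ ≤ _ := by
        gcongr
        have : 0 ≤ K₂ * s := by positivity
        linarith
  · rw [inner_eq_intervalIntegral hab hv hf']
    refine (h2 ε hε hεε d hd _ _ rfl rfl).trans ?_
    calc _ ≤ K₂ * ε * (s * ‖f‖ + s * ‖y‖) := by gcongr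
      _ = K₂ * s * ε * (‖f‖ + ‖y‖) := by ring
      _ ≤ _ := by
        gcongr
        have : 0 ≤ s * K₁ * s := by positivity
        linarith


/-! ### The eigenfunction of the limit operator -/

theorem InterfaceConditions.apply_zero {α β : ℝ} {Ψ Φ : ℝ → ℝ} {l r : ℕ → ℝ → ℂ}
    (h : InterfaceConditions α β Ψ Φ l r) : l 0 0 = 0 ∧ r 0 0 = 0 := by
  unfold InterfaceConditions at h
  split_ifs at h
  · exact ⟨h.1, h.2.1⟩
  · exact ⟨h.1, h.2.2.1⟩

theorem IsSolution.realizes {p q lam : ℝ} {U Q : ℝ → ℝ} {d : ℕ → ℝ → ℂ} {u h : ℝ → ℂ} (hpq : p ≤ q)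
    (hQc : ContinuousOn Q (Icc p q)) (hd : IsSolution p q Q d) (hQ : ∀ x, Q x = U x - lam)
    (hu : u =ᵐ[volume.restrict (Ioo p q)] d 0)
    (hh : h =ᵐ[volume.restrict (Ioo p q)] fun x => lam * u x) : Realizes p q U d u h where
  jet := ⟨fun j hj => (hd.jet.prim j hj).ftc, memLp_of_continuousOn (hd.continuousOn_four hpq hQc)⟩
  eq_zero := hu
  eq_op := by
    filter_upwards [hu, hh, ae_restrict_mem measurableSet_Ioo] with x x1 x2 x3
    have := hd.eqn x (Ioo_subset_Icc_self x3)
    rw [hQ] at this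
    push_cast at this
    rw [x2, x1]
    linear_combination -this

theorem intervalIntegral_norm_eq_zero {p q : ℝ} (hpq : p ≤ q) {f : ℝ → ℂ}
    (hf : f =ᵐ[volume.restrict (Ioo p q)] 0) : ∫ x in p..q, ‖f x‖ = 0 := by
  rw [intervalIntegral.integral_of_le hpq, integral_Ioc_eq_integral_Ioo]
  refine integral_eq_zero_of_ae ?_
  filter_upwards [hf] with x hx
  simp [hx]

theorem Realizes.integral_defect {p q lam : ℝ} {U Q : ℝ → ℝ} {d : ℕ → ℝ → ℂ} {u h : ℝ → ℂ}
    (hpq : p ≤ q) (H : Realizes p q U d u h) (hQ : ∀ x, Q x = U x - lam)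
    (hh : h =ᵐ[volume.restrict (Ioo p q)] fun x => lam * u x) :
    ∫ x in p..q, ‖d 4 x + Q x * d 0 x‖ = 0 := by
  refine intervalIntegral_norm_eq_zero hpq ?_
  filter_upwards [H.eq_zero, H.eq_op, hh] with x x1 x2 x3
  rw [x2, x1] at x3
  rw [hQ, Pi.zero_apply]
  push_cast
  linear_combination x3

theorem jetVec_eq_of_jetNorm_sub_le {d e : ℕ → ℝ → ℂ} {x : ℝ} (h : jetNorm (d - e) x ≤ 0) :
    jetVec d x = jetVec e x := by
  have h1 := (norm_jetVec_le (d - e) x).trans h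
  have h2 : jetVec (d - e) x = jetVec d x - jetVec e x := rfl
  rw [h2, norm_le_zero_iff, sub_eq_zero] at h1
  exact h1

namespace IsMatching

variable {D : InnerData} {a b C ε₀ lam : ℝ} {U : ℝ → ℝ} {l r : (ℂ × ℂ) →ₗ[ℂ] (ℕ → ℝ → ℂ)}
  {J : ((Fin 4 → ℂ) × (Fin 4 → ℂ)) →ₗ[ℂ] (Fin 4 → ℂ)}

theorem apply_zero (h : IsMatching D a b l r J C ε₀) {z : (ℂ × ℂ) × (ℂ × ℂ)}
    (hz : J (jetVec (l z.1) 0, jetVec (r z.2) 0) = 0) : l z.1 0 0 = 0 ∧ r z.2 0 0 = 0 :=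
  ((h.interface.iff _ _).2 hz).apply_zero

/-- Glued solutions that satisfy the interface conditions are eigenfunctions of the limit
operator. -/
theorem toLp_glue_mem_eigenspace (h : IsMatching D a b l r J C ε₀) (hU : ∀ x, D.Q x = U x - lam)
    {z : (ℂ × ℂ) × (ℂ × ℂ)} (hz : J (jetVec (l z.1) 0, jetVec (r z.2) 0) = 0)
    (hm : MemLp (glue l r z) 2 (volume.restrict (Ioo a b))) :
    hm.toLp ∈ eigenspace (limitOperator a b h.ha h.hb U D.α D.β D.Ψ D.Φ) lam := by
  obtain ⟨hl, hr⟩ := h.apply_zero hz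
  change (hm.toLp, (lam : ℂ) • hm.toLp) ∈ (limitOperator a b h.ha h.hb U D.α D.β D.Ψ D.Φ).graph
  rw [limitOperator_graph]
  have hsl : volume.restrict (Ioo a 0) ≤ volume.restrict (Ioo a b) :=
    Measure.restrict_mono (Ioo_subset_Ioo_right h.hb.le) le_rfl
  have hsr : volume.restrict (Ioo 0 b) ≤ volume.restrict (Ioo a b) :=
    Measure.restrict_mono (Ioo_subset_Ioo_left h.ha.le) le_rfl
  have hu := hm.coeFn_toLp
  have hs : ((lam : ℂ) • (hm.toLp : L2 a b) : L2 a b) =ᵐ[volume.restrict (Ioo a b)]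
      fun x => (lam : ℂ) * (hm.toLp : L2 a b) x := Lp.coeFn_smul _ _
  refine ⟨l z.1, r z.2, (h.left.sol z.1).realizes h.ha.le
    (h.hQ.mono (Icc_subset_Icc_right h.hb.le)) hU ?_ (ae_mono hsl hs),
    (h.right.sol z.2).realizes h.hb.le (h.hQ.mono (Icc_subset_Icc_left h.ha.le)) hU ?_
      (ae_mono hsr hs), ⟨h.left.zero _, h.left.one _, h.right.zero _, h.right.one _⟩,
    (h.interface.iff _ _).2 hz⟩
  · filter_upwards [ae_mono hsl hu, ae_restrict_mem measurableSet_Ioo] with x x1 x2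
    rw [x1, glue_eq_left hl hr x2.2.le]
  · filter_upwards [ae_mono hsr hu, ae_restrict_mem measurableSet_Ioo] with x x1 x2
    rw [x1, glue_eq_right x2.1.le]

/-- A glued function that vanishes almost everywhere has zero parameters. -/
theorem eq_zero_of_glue_ae_eq_zero (h : IsMatching D a b l r J C ε₀) {z : (ℂ × ℂ) × (ℂ × ℂ)}
    (hz : glue l r z =ᵐ[volume.restrict (Ioo a b)] 0) : z = 0 := by
  have hsl : volume.restrict (Ioo a 0) ≤ volume.restrict (Ioo a b) :=
    Measure.restrict_mono (Ioo_subset_Ioo_right h.hb.le) le_rfl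
  have hsr : volume.restrict (Ioo 0 b) ≤ volume.restrict (Ioo a b) :=
    Measure.restrict_mono (Ioo_subset_Ioo_left h.ha.le) le_rfl
  have h1 : ∫ t in a..0, ‖l z.1 0 t‖ = 0 := by
    refine intervalIntegral_norm_eq_zero h.ha.le ?_
    filter_upwards [ae_mono hsl hz, ae_restrict_mem measurableSet_Ioo] with x x1 x2
    rwa [glue, if_pos x2.2] at x1
  have h2 : ∫ t in 0..b, ‖r z.2 0 t‖ = 0 := by
    refine intervalIntegral_norm_eq_zero h.hb.le ?_
    filter_upwards [ae_mono hsr hz, ae_restrict_mem measurableSet_Ioo] with x x1 x2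
    rwa [glue_eq_right x2.1.le] at x1
  have z1 := h.left.norm_le z.1
  have z2 := h.right.norm_le z.2
  rw [h1, mul_zero, norm_le_zero_iff] at z1
  rw [h2, mul_zero, norm_le_zero_iff] at z2
  exact Prod.ext z1 z2

/-- The eigenfunction for a simple eigenvalue of the limit operator is glued from outer solutions,
and spans the solutions of the interface conditions. -/
theorem exists_glue_eq (h : IsMatching D a b l r J C ε₀) (hU : ∀ x, D.Q x = U x - lam) {v : L2 a b}
    (hsimple : IsSimpleEigenvalue (limitOperator a b h.ha h.hb U D.α D.β D.Ψ D.Φ) lam)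
    (hv : v ∈ eigenspace (limitOperator a b h.ha h.hb U D.α D.β D.Ψ D.Φ) lam) (hv0 : v ≠ 0) :
    ∃ ζ : (ℂ × ℂ) × (ℂ × ℂ), v =ᵐ[volume.restrict (Ioo a b)] glue l r ζ ∧
      J (jetVec (l ζ.1) 0, jetVec (r ζ.2) 0) = 0 ∧
      ∀ z : (ℂ × ℂ) × (ℂ × ℂ), J (jetVec (l z.1) 0, jetVec (r z.2) 0) = 0 → ∃ c : ℂ, z = c • ζ := by
  have hv' : (v, (lam : ℂ) • v) ∈ (limitOperator a b h.ha h.hb U D.α D.β D.Ψ D.Φ).graph := hv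
  rw [limitOperator_graph] at hv'
  obtain ⟨l', r', hl', hr', ⟨o1, o2, o3, o4⟩, hint⟩ := hv'
  have hsl : volume.restrict (Ioo a 0) ≤ volume.restrict (Ioo a b) :=
    Measure.restrict_mono (Ioo_subset_Ioo_right h.hb.le) le_rfl
  have hsr : volume.restrict (Ioo 0 b) ≤ volume.restrict (Ioo a b) :=
    Measure.restrict_mono (Ioo_subset_Ioo_left h.ha.le) le_rfl
  have hs : ((lam : ℂ) • v : L2 a b) =ᵐ[volume.restrict (Ioo a b)] fun x => lam * v x :=
    Lp.coeFn_smul _ _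
  -- With zero defect and `s = 0`, approximation by the outer family becomes equality.
  obtain ⟨z₁, -, h₁⟩ := h.left.near 0 ⟨by linarith [h.ha], le_rfl⟩ l' (hl'.jet.isJet h.ha.le) o1 o2
  obtain ⟨z₂, -, h₂⟩ := h.right.near 0 ⟨le_rfl, by linarith [h.hb]⟩ r' (hr'.jet.isJet h.hb.le) o3 o4
  rw [hl'.integral_defect h.ha.le hU (ae_mono hsl hs), mul_zero] at h₁
  rw [hr'.integral_defect h.hb.le hU (ae_mono hsr hs), mul_zero] at h₂
  have e₁ : ∀ x ∈ Icc a 0, jetVec l' x = jetVec (l z₁) x := fun x hx =>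
    jetVec_eq_of_jetNorm_sub_le (h₁ x hx)
  have e₂ : ∀ x ∈ Icc 0 b, jetVec r' x = jetVec (r z₂) x := fun x hx =>
    jetVec_eq_of_jetNorm_sub_le (h₂ x hx)
  have hJ : J (jetVec (l z₁) 0, jetVec (r z₂) 0) = 0 := by
    rw [← e₁ 0 (right_mem_Icc.2 h.ha.le), ← e₂ 0 (left_mem_Icc.2 h.hb.le)]
    exact (h.interface.iff _ _).1 hint
  have hvglue : v =ᵐ[volume.restrict (Ioo a b)] glue l r (z₁, z₂) := by
    have hne : ∀ᵐ x : ℝ, x ≠ 0 := by simp [ae_iff, measure_singleton]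
    refine (ae_restrict_iff' measurableSet_Ioo).2 ?_
    filter_upwards [(ae_restrict_iff' measurableSet_Ioo).1 hl'.eq_zero,
      (ae_restrict_iff' measurableSet_Ioo).1 hr'.eq_zero, hne] with x x1 x2 x3 hx
    rcases lt_or_gt_of_ne x3 with hx0 | hx0
    · rw [glue, if_pos hx0, x1 ⟨hx.1, hx0⟩]
      exact congrFun (e₁ x ⟨hx.1.le, hx0.le⟩) 0
    · rw [glue_eq_right hx0.le, x2 ⟨hx0, hx.2⟩]
      exact congrFun (e₂ x ⟨hx0.le, hx.2.le⟩) 0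
  refine ⟨(z₁, z₂), hvglue, hJ, fun z hz => ?_⟩
  obtain ⟨hl, hr⟩ := h.apply_zero hz
  have hm : MemLp (glue l r z) 2 (volume.restrict (Ioo a b)) :=
    memLp_of_continuousOn (h.continuousOn_glue hl hr)
  have hmem := h.toLp_glue_mem_eigenspace hU hz hm
  -- Simplicity enters here: any other admissible pair of parameters glues to an eigenfunction,
  -- hence to a multiple of `v`, and the function determines its parameters.
  have hv0' : (⟨v, hv⟩ : eigenspace (limitOperator a b h.ha h.hb U D.α D.β D.Ψ D.Φ) lam) ≠ 0 :=
    fun he => hv0 (congrArg Subtype.val he)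
  obtain ⟨c, hc⟩ := (finrank_eq_one_iff_of_nonzero' _ hv0').1 hsimple ⟨_, hmem⟩
  have hc' : c • v = hm.toLp := congrArg Subtype.val hc
  refine ⟨c, sub_eq_zero.1 (h.eq_zero_of_glue_ae_eq_zero ?_)⟩
  have e3 := Lp.coeFn_smul c v
  rw [hc'] at e3
  filter_upwards [hm.coeFn_toLp, e3, hvglue] with x x1 x2 x3
  rw [glue_sub_smul, ← x1, x2, Pi.smul_apply, x3, smul_eq_mul, sub_self, Pi.zero_apply]

end IsMatching


/-! ### Perturbation of a simple eigenvalue -/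

section Abstract

variable {H : Type*} [NormedAddCommGroup H] [InnerProductSpace ℂ H]

theorem isNormalizedEigenfunction_of_mem_graph {A : H →ₗ.[ℂ] H} {μ : ℝ} {u : H}
    (hu : (u, (μ : ℂ) • u) ∈ A.graph) (h1 : ‖u‖ = 1) : IsNormalizedEigenfunction A μ u := by
  obtain ⟨y, hy, hy'⟩ := (LinearPMap.mem_graph_iff A).1 hu
  simp only at hy hy'
  subst hy
  exact ⟨⟨y.2, hy'⟩, h1⟩

/-- Comparing norms gives `|‖c‖ - 1| ≤ t`; the phase of `c` is removed by `σ = c̄ / |c|`. -/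
theorem exists_unit_smul_near {v e : H} (hv : ‖v‖ = 1) (he : ‖e‖ = 1) {c : ℂ} {t : ℝ}
    (h : ‖e - c • v‖ ≤ t) (ht : t < 1) : ∃ σ : ℂ, ‖σ‖ = 1 ∧ ‖σ • e - v‖ ≤ 2 * t := by
  have hc : |‖c‖ - 1| ≤ t := by
    have := abs_norm_sub_norm_le e (c • v)
    rw [norm_smul, hv, he, mul_one, abs_sub_comm] at this
    exact this.trans h
  have hc0 : c ≠ 0 := by
    rintro rfl
    rw [norm_zero, zero_sub, abs_neg, abs_one] at hc
    linarith
  have hn : (‖c‖ : ℂ) ≠ 0 := by exact_mod_cast norm_ne_zero_iff.2 hc0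
  refine ⟨starRingEnd ℂ c / ‖c‖, ?_, ?_⟩
  · rw [norm_div, RCLike.norm_conj, Complex.norm_real, norm_norm, div_self (norm_ne_zero_iff.2 hc0)]
  · have e1 : starRingEnd ℂ c / ‖c‖ * c = ‖c‖ := by
      rw [div_mul_eq_mul_div, Complex.conj_mul', sq, mul_div_cancel_right₀ _ hn]
    have e2 : (starRingEnd ℂ c / ‖c‖) • e - v =
        (starRingEnd ℂ c / ‖c‖) • (e - c • v) + ((‖c‖ : ℂ) - 1) • v := by
      rw [smul_sub, smul_smul, e1, sub_smul, one_smul]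
      abel
    rw [e2]
    refine (norm_add_le _ _).trans ?_
    rw [norm_smul, norm_smul, hv, norm_div, RCLike.norm_conj, Complex.norm_real, norm_norm,
      div_self (norm_ne_zero_iff.2 hc0), one_mul, mul_one]
    have e3 : ‖(‖c‖ : ℂ) - 1‖ = |‖c‖ - 1| := by
      rw [← Real.norm_eq_abs, ← Complex.norm_real]
      push_cast
      rfl
    rw [e3]
    linarith

/-- The resolvent of `A` at `lam` is close to the projection to `v`, up to a scalar. -/
structure IsNearEigenpair (A : H →ₗ.[ℂ] H) (lam : ℝ) (v : H) (K ε : ℝ) : Prop where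
  near : ∀ y f, (y, f + (lam : ℂ) • y) ∈ A.graph → ∃ c : ℂ, ‖y - c • v‖ ≤ K * (‖f‖ + ε * ‖y‖)
  pairing : ∀ y f, (y, f + (lam : ℂ) • y) ∈ A.graph → ‖inner ℂ v f‖ ≤ K * ε * (‖f‖ + ‖y‖)

/-- Both estimates are applied to `f = (ν - lam) e`. The first makes the overlap with `v` at least
`3 / 4`; the pairing then bounds `(3 / 4) |ν - lam|` by `K ε (|ν - lam| + 1)`; the resulting rate
for `ν` is fed back into the first. -/
theorem IsNearEigenpair.eigenvector {A : H →ₗ.[ℂ] H} {lam K ε δ : ℝ} {v : H}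
    (h : IsNearEigenpair A lam v K ε) (hv : ‖v‖ = 1) (hK : 0 < K) (hε : 0 < ε)
    (hKδ : K * δ ≤ 1 / 16) (hKε : K * ε ≤ 1 / 16) {e : H} {ν : ℝ} (he : ‖e‖ = 1)
    (hmem : (e, (ν : ℂ) • e) ∈ A.graph) (hν : |ν - lam| ≤ δ) :
    3 / 4 ≤ ‖inner ℂ v e‖ ∧ |ν - lam| ≤ 2 * K * ε ∧
      ∃ σ : ℂ, ‖σ‖ = 1 ∧ ‖σ • e - v‖ ≤ 2 * (K * (2 * K + 1)) * ε := by
  have hmem' : (e, ((ν - lam : ℝ) : ℂ) • e + (lam : ℂ) • e) ∈ A.graph := by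
    rw [← add_smul]
    push_cast
    rwa [sub_add_cancel]
  have hnf : ‖((ν - lam : ℝ) : ℂ) • e‖ = |ν - lam| := by
    rw [norm_smul, he, mul_one, Complex.norm_real, Real.norm_eq_abs]
  obtain ⟨c, hc⟩ := h.near _ _ hmem'
  have hp := h.pairing _ _ hmem'
  rw [hnf, he] at hc hp
  rw [inner_smul_right, norm_mul, Complex.norm_real, Real.norm_eq_abs] at hp
  have ht : K * (|ν - lam| + ε * 1) ≤ 1 / 8 := by
    have : K * |ν - lam| ≤ K * δ := by gcongr
    linarith
  have h1 : 3 / 4 ≤ ‖inner ℂ v e‖ := by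
    have a1 : ‖c‖ ≥ 1 - 1 / 8 := by
      have := norm_sub_norm_le e (c • v)
      rw [norm_smul, hv, he, mul_one] at this
      linarith
    have a2 : inner ℂ v (e - c • v) = inner ℂ v e - c := by
      rw [inner_sub_right, inner_smul_right, inner_self_eq_norm_sq_to_K, hv]
      simp
    have a3 : ‖inner ℂ v e - c‖ ≤ 1 / 8 := by
      rw [← a2]
      refine (norm_inner_le_norm _ _).trans ?_
      rw [hv, one_mul]
      exact hc.trans ht
    have := norm_sub_norm_le c (inner ℂ v e)
    rw [norm_sub_rev] at this
    linarith
  have h2 : |ν - lam| ≤ 2 * K * ε := by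
    have p := abs_nonneg (ν - lam)
    have a1 : |ν - lam| * (3 / 4) ≤ |ν - lam| * ‖inner ℂ v e‖ := by gcongr
    have a2 : K * ε * |ν - lam| ≤ 1 / 16 * |ν - lam| := by gcongr
    have a3 : 0 < K * ε := by positivity
    linarith
  have h3 : K * (|ν - lam| + ε * 1) ≤ K * (2 * K + 1) * ε := by
    calc _ ≤ K * (2 * K * ε + ε * 1) := by gcongr
      _ = _ := by ring
  refine ⟨h1, h2, ?_⟩
  obtain ⟨σ, hσ, hσe⟩ := exists_unit_smul_near hv he hc (by linarith)
  exact ⟨σ, hσ, hσe.trans (by linarith)⟩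

/-- Existence: without a close eigenvalue, the solution for the right-hand side `v` contradicts the
pairing estimate. Uniqueness: two overlaps of at least `3 / 4` would contradict Bessel's inequality,
since `9 / 16 + 9 / 16 > 1`. -/
theorem IsNearEigenpair.exists_index [CompleteSpace H] {A : H →ₗ.[ℂ] H} {lam K ε δ : ℝ} {v : H}
    (h : IsNearEigenpair A lam v K ε) (hv : ‖v‖ = 1) (hK : 0 < K) (hε : 0 < ε) (hδ : 0 < δ)
    (hKδ : K * δ ≤ 1 / 16) (hKε : K * ε ≤ 1 / 16) (hεδ : K * ε * (1 + 1 / δ) < 1)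
    {R : H →L[ℂ] H} {M : ℝ} (hA : HasCompactResolvent A R M)
    {ι : Type*} {e : HilbertBasis ι ℂ H} {ν : ι → ℝ} (he : IsEigenbasis A e ν) :
    ∃ i₀, |ν i₀ - lam| ≤ 2 * K * ε ∧ (∀ i, i ≠ i₀ → δ < |ν i - lam|) ∧
      ∃ σ : ℂ, ‖σ‖ = 1 ∧ ‖σ • e i₀ - v‖ ≤ 2 * (K * (2 * K + 1)) * ε := by
  have hunit : ∀ i, ‖e i‖ = 1 := e.orthonormal.1
  have hex : ∃ i₀, |ν i₀ - lam| < δ := by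
    by_contra! hgap
    obtain ⟨u, hu, hule⟩ := hA.exists_solve he hδ hgap v
    have hp := h.pairing _ _ hu
    rw [inner_self_eq_norm_sq_to_K, hv] at hp
    rw [hv] at hule
    have hu1 : ‖u‖ ≤ 1 / δ := by rw [le_div_iff₀ hδ]; linarith
    have : K * ε * (1 + ‖u‖) ≤ K * ε * (1 + 1 / δ) := by gcongr
    norm_num at hp
    norm_num at hεδ this
    linarith
  obtain ⟨i₀, hi₀⟩ := hex
  obtain ⟨h1, h2, h3⟩ := h.eigenvector hv hK hε hKδ hKε (hunit i₀) (he.mem_graph i₀) hi₀.le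
  refine ⟨i₀, h2, fun i hi => ?_, h3⟩
  by_contra! hle
  obtain ⟨h1', -, -⟩ := h.eigenvector hv hK hε hKδ hKε (hunit i) (he.mem_graph i) hle
  classical
  have hB := sum_le_hasSum {i₀, i} (fun j _ => sq_nonneg ‖inner ℂ (e j) v‖)
    (hasSum_normSq_inner e v)
  rw [Finset.sum_pair hi.symm, hv, norm_inner_symm, norm_inner_symm (e i)] at hB
  nlinarith

/-- If no eigenvalue of `A` equals `m`, operators with close forms have as many eigenvalues below
`m`. -/
theorem IsEigenbasis.exists_ncard_eq {A : H →ₗ.[ℂ] H} {ι : Type*} {e : HilbertBasis ι ℂ H}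
    {ν : ι → ℝ} (hA : IsEigenbasis A e ν) {m : ℝ} (hm : ∀ i, ν i ≠ m) :
    ∃ η : ℝ, 0 < η ∧ ∀ (A' : H →ₗ.[ℂ] H) (ι' : Type) (e' : HilbertBasis ι' ℂ H) (ν' : ι' → ℝ),
      IsEigenbasis A' e' ν' →
      (∀ u h', (u, h') ∈ A'.graph → ∃ h, (u, h) ∈ A.graph ∧
        (inner ℂ u h).re ≤ (inner ℂ u h').re + η * ‖u‖ ^ 2) →
      (∀ u h', (u, h') ∈ A.graph → ∃ h, (u, h) ∈ A'.graph ∧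
        (inner ℂ u h).re ≤ (inner ℂ u h').re + η * ‖u‖ ^ 2) →
      {i | ν' i < m}.ncard = {i | ν i < m}.ncard := by
  -- Only finitely many eigenvalues lie below `m + 1`, so they keep a distance from `m`; the minimum
  -- with `1` takes care of the others.
  obtain ⟨g, hg, hgap⟩ : ∃ g : ℝ, 0 < g ∧ ∀ i, g ≤ |ν i - m| := by
    have hfin : (ν '' {i | ν i < m + 1}).Finite := (hA.finite (m + 1)).image ν
    have hopen : (ν '' {i | ν i < m + 1})ᶜ ∈ nhds m := hfin.isClosed.isOpen_compl.mem_nhds (by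
      rintro ⟨i, -, hi⟩
      exact hm i hi)
    obtain ⟨g, hg, hball⟩ := Metric.mem_nhds_iff.1 hopen
    refine ⟨min g 1, lt_min hg one_pos, fun i => ?_⟩
    by_contra! hlt
    obtain ⟨h1, h2⟩ := lt_min_iff.1 hlt
    exact hball (show ν i ∈ Metric.ball m g by rwa [Metric.mem_ball, Real.dist_eq])
      ⟨i, show ν i < m + 1 by linarith [(abs_lt.1 h2).2], rfl⟩
  refine ⟨g / 2, by positivity, fun A' ι' e' ν' hA' hc hc' => le_antisymm ?_ ?_⟩
  · have h1 : {i | ν' i < m}.ncard ≤ {i | ν' i ≤ m}.ncard :=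
      ncard_le_ncard (fun i (hi : ν' i < m) => hi.le) ((hA'.finite (m + 1)).subset
        fun i (hi : ν' i ≤ m) => show ν' i < m + 1 by linarith)
    have h2 := hA.ncard_le hA' (s := m) (t := m + g) hc (by linarith)
    have h3 : {i | ν i < m + g} = {i | ν i < m} := by
      ext i
      refine ⟨fun (hi : ν i < m + g) => ?_, fun (hi : ν i < m) => show ν i < m + g by linarith⟩
      change ν i < m
      by_contra! hle
      have := hgap i
      rw [abs_of_nonneg (by linarith)] at this
      linarith
    rw [h3] at h2
    exact h1.trans h2
  · have h2 := hA'.ncard_le hA (s := m - g) (t := m) hc' (by linarith)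
    have h3 : {i | ν i ≤ m - g} = {i | ν i < m} := by
      ext i
      refine ⟨fun (hi : ν i ≤ m - g) => show ν i < m by linarith, fun (hi : ν i < m) => ?_⟩
      have := hgap i
      rw [abs_of_neg (by linarith)] at this
      change ν i ≤ m - g
      linarith
    rwa [h3] at h2

/-- Perturbation of a simple eigenvalue in a family of operators with compact resolvent: the
eigenvalue keeps its index and depends on the parameter with linear rate. -/
theorem exists_isKthEigenvalue_near [CompleteSpace H] (A : ℝ → H →ₗ.[ℂ] H) {ε₀ lam K : ℝ} {v : H} (hε₀ : 0 < ε₀)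
    (hK : 0 < K) (hv : ‖v‖ = 1)
    (hA : ∀ ε, 0 < ε → ε < ε₀ → ∃ R M, HasCompactResolvent (A ε) R M)
    (hnear : ∀ ε, 0 < ε → ε < ε₀ → IsNearEigenpair (A ε) lam v K ε)
    (hcont : ∀ ε, 0 < ε → ε < ε₀ → ∀ η > 0, ∀ᶠ ε' in nhds ε,
      (∀ u h', (u, h') ∈ (A ε').graph → ∃ h, (u, h) ∈ (A ε).graph ∧
        (inner ℂ u h).re ≤ (inner ℂ u h').re + η * ‖u‖ ^ 2) ∧
      ∀ u h', (u, h') ∈ (A ε).graph → ∃ h, (u, h) ∈ (A ε').graph ∧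
        (inner ℂ u h).re ≤ (inner ℂ u h').re + η * ‖u‖ ^ 2) :
    ∃ (j : ℕ) (c₁ c₂ ε₁ : ℝ), 0 < ε₁ ∧ ∀ ε, 0 < ε → ε < ε₁ → ∃ (μ : ℝ) (y : H),
      IsKthEigenvalue (A ε) j μ ∧ IsSimpleEigenvalue (A ε) μ ∧
      IsNormalizedEigenfunction (A ε) μ y ∧ |μ - lam| ≤ c₁ * ε ∧ ‖y - v‖ ≤ c₂ * ε := by
  set δ := 1 / (16 * K) with hδdef
  have hδ : 0 < δ := by positivity
  have hKδ : K * δ ≤ 1 / 16 := by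
    rw [hδdef]
    field_simp
    norm_num
  -- The three summands encode the three smallness conditions of `hsmall`; each follows from `κ * ε
  -- < 1`.
  set κ := K * (16 + (1 + 1 / δ) + 2 / δ) with hκ
  have hκ0 : 0 < κ := by positivity
  set ε₁ := min ε₀ (1 / (2 * κ)) with hε₁
  have hε₁0 : 0 < ε₁ := lt_min hε₀ (by positivity)
  have hsmall : ∀ ε, 0 < ε → ε < ε₁ → ε < ε₀ ∧ K * ε ≤ 1 / 16 ∧ K * ε * (1 + 1 / δ) < 1 ∧
      2 * K * ε < δ := by
    intro ε hε h
    obtain ⟨h1, h2⟩ := lt_min_iff.1 h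
    have h3 : κ * ε < 1 := by
      rw [lt_div_iff₀ (by positivity)] at h2
      nlinarith
    have q0 : 0 < K * ε := by positivity
    have q1 : 0 < K * ε * (1 + 1 / δ) := by positivity
    have q2 : 0 < K * ε * (2 / δ) := by positivity
    have e : κ * ε = 16 * (K * ε) + K * ε * (1 + 1 / δ) + K * ε * (2 / δ) := by rw [hκ]; ring
    refine ⟨h1, by linarith, by linarith, ?_⟩
    have h4 : K * ε * (2 / δ) < 1 := by linarith
    have h5 : K * ε * (2 / δ) = 2 * K * ε / δ := by ring
    rw [h5, div_lt_one hδ] at h4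
    exact h4
  have hbasis : ∀ ε : Ioo 0 ε₁, ∃ (ι : Type) (e : HilbertBasis ι ℂ H) (ν : ι → ℝ),
      IsEigenbasis (A ε) e ν := fun ε => by
    obtain ⟨R, M, h⟩ := hA ε ε.2.1 (hsmall ε ε.2.1 ε.2.2).1
    exact h.exists_isEigenbasis
  choose ι e ν heig using hbasis
  have hidx : ∀ ε : Ioo 0 ε₁, ∃ i₀, |ν ε i₀ - lam| ≤ 2 * K * ε ∧
      (∀ i, i ≠ i₀ → δ < |ν ε i - lam|) ∧
      ∃ σ : ℂ, ‖σ‖ = 1 ∧ ‖σ • e ε i₀ - v‖ ≤ 2 * (K * (2 * K + 1)) * ε := fun ε => by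
    obtain ⟨s1, s2, s3, -⟩ := hsmall ε ε.2.1 ε.2.2
    obtain ⟨R, M, h⟩ := hA ε ε.2.1 s1
    exact (hnear ε ε.2.1 s1).exists_index hv hK ε.2.1 hδ hKδ s2 s3 h (heig ε)
  choose i₀ hi₀ hother hσ using hidx
  -- The close eigenvalue is at distance less than `δ` from `lam` and all others at distance more
  -- than `δ`, so `m` is never an eigenvalue.
  set m := lam - δ with hm
  have hlt : ∀ ε : Ioo 0 ε₁, |ν ε (i₀ ε) - lam| < δ := fun ε =>
    (hi₀ ε).trans_lt (hsmall ε ε.2.1 ε.2.2).2.2.2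
  have hne : ∀ (ε : Ioo 0 ε₁) i, ν ε i ≠ m := by
    intro ε i hi
    have habs : |ν ε i - lam| = δ := by
      rw [hi, hm, sub_sub_cancel_left, abs_neg, abs_of_pos hδ]
    by_cases h : i = i₀ ε
    · have := hlt ε
      rw [← h, habs] at this
      exact lt_irrefl _ this
    · have := hother ε i h
      rw [habs] at this
      exact lt_irrefl _ this
  -- An integer-valued continuous function on a connected interval is constant, so the index does
  -- not depend on ε.
  let N : Ioo 0 ε₁ → ℕ := fun ε => {i | ν ε i < m}.ncard
  have hN : Continuous N := by
    refine continuous_iff_continuousAt.2 fun ε => ?_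
    obtain ⟨η, hη, hcard⟩ := (heig ε).exists_ncard_eq (hne ε)
    have hev := hcont ε ε.2.1 (hsmall ε ε.2.1 ε.2.2).1 η hη
    refine continuousAt_const.congr (f := fun _ => N ε) ?_
    filter_upwards [continuousAt_subtype_val.eventually hev] with ε' hε'
    exact (hcard (A ε') _ (e ε') (ν ε') (heig ε') hε'.1 hε'.2).symm
  have hconst : ∀ x y, N x = N y := by
    have : PreconnectedSpace (Ioo 0 ε₁) := Subtype.preconnectedSpace isPreconnected_Ioo
    intro x y
    exact PreconnectedSpace.constant this hN
  refine ⟨N ⟨ε₁ / 2, by constructor <;> linarith⟩ + 1, 2 * K, 2 * (K * (2 * K + 1)), ε₁, hε₁0,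
    fun ε hε hεε => ?_⟩
  set x : Ioo 0 ε₁ := ⟨ε, hε, hεε⟩
  obtain ⟨σ, hσ1, hσv⟩ := hσ x
  obtain ⟨l1, l2⟩ := abs_lt.1 (hlt x)
  have hsep : ∀ i, i ≠ i₀ x → ν x i < m ∨ ν x (i₀ x) < ν x i := by
    intro i hi
    rcases lt_abs.1 (hother x i hi) with h | h
    · right
      linarith
    · left
      rw [hm]
      linarith
  refine ⟨ν x (i₀ x), σ • e x (i₀ x), ?_, ?_, ?_, hi₀ x, hσv⟩
  · rw [hconst _ x]
    exact (heig x).isKthEigenvalue (by rw [hm]; linarith) hsep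
  · refine (heig x).isSimpleEigenvalue fun i hi he => ?_
    rcases hsep i hi with h | h
    · rw [hm] at h
      linarith
    · linarith
  · refine isNormalizedEigenfunction_of_mem_graph ?_ ?_
    · have := (A ε).graph.smul_mem σ ((heig x).mem_graph (i₀ x))
      rw [Prod.smul_mk, smul_comm] at this
      exact this
    · rw [norm_smul, hσ1, (e x).orthonormal.1, one_mul]

end Abstract

/-! ### Continuity of the family of operators -/

/-- The domain does not depend on the continuous potential, and the forms differ only by the
integral of `(V - V') ‖u‖²`. -/
theorem dirichletOperator_form_le {a b η : ℝ} (hab : a ≤ b) {V V' : ℝ → ℝ}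
    (hV : ContinuousOn V (Icc a b)) (hV' : ContinuousOn V' (Icc a b))
    (hη : ∀ x ∈ Icc a b, V x ≤ V' x + η) {u h' : L2 a b}
    (hu : (u, h') ∈ (dirichletOperator a b hab V').graph) :
    ∃ h, (u, h) ∈ (dirichletOperator a b hab V).graph ∧
      (inner ℂ u h).re ≤ (inner ℂ u h').re + η * ‖u‖ ^ 2 := by
  obtain ⟨d, hd, h4, hu0, hh⟩ := (mem_dirichletOperator_graph hab).1 hu
  have c0 := hd.jet.continuousOn hab (j := 0) (by norm_num)
  have hm : MemLp (fun x => d 4 x + V x * d 0 x) 2 (volume.restrict (Ioo a b)) :=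
    h4.add (memLp_of_continuousOn (continuousOn_ofReal_mul hV c0))
  refine ⟨hm.toLp, (mem_dirichletOperator_graph hab).2 ⟨d, hd, h4, hu0, hm.coeFn_toLp⟩, ?_⟩
  rw [dirichletOperator_form hab hV hd hu0 hm.coeFn_toLp, dirichletOperator_form hab hV' hd hu0 hh,
    norm_sq_eq_intervalIntegral hab hu0, add_assoc, ← intervalIntegral.integral_const_mul]
  have hn : ContinuousOn (fun x => ‖d 0 x‖ ^ 2) (Icc a b) := c0.norm.pow 2
  have int : ∀ f : ℝ → ℝ, ContinuousOn f (Icc a b) → IntervalIntegrable f volume a b := fun f hf =>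
    ContinuousOn.intervalIntegrable (by rwa [uIcc_of_le hab])
  have i1 := int (fun x => V x * ‖d 0 x‖ ^ 2) (hV.mul hn)
  have i2 := int (fun x => V' x * ‖d 0 x‖ ^ 2) (hV'.mul hn)
  have i3 := int (fun x => η * ‖d 0 x‖ ^ 2) (continuousOn_const.mul hn)
  rw [← intervalIntegral.integral_add i2 i3]
  gcongr
  refine intervalIntegral.integral_mono_on hab i1 (i2.add i3) fun x hx => ?_
  have := hη x hx
  have p : 0 ≤ ‖d 0 x‖ ^ 2 := sq_nonneg _
  nlinarith

/-- Joint continuity in `(ε', x)` away from `ε' = 0`, made uniform in `x` by the compactness of `[a,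
b]`. -/
theorem eventually_abs_regularization_sub_le {α β γ₁ γ₂ : ℝ} {Ψ Φ Υ₁ Υ₂ : ℝ → ℝ}
    (hΨ : Continuous Ψ) (hΦ : Continuous Φ) (hΥ₁ : Continuous Υ₁) (hΥ₂ : Continuous Υ₂)
    {a b ε η : ℝ} (hε : 0 < ε) (hη : 0 < η) : ∀ᶠ ε' in nhds ε, ∀ x ∈ Icc a b,
      |regularization α β γ₁ γ₂ Ψ Φ Υ₁ Υ₂ ε' x - regularization α β γ₁ γ₂ Ψ Φ Υ₁ Υ₂ ε x| < η := by
  refine isCompact_Icc.eventually_forall_of_forall_eventually fun x _ => ?_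
  have hc : ContinuousAt (fun p : ℝ × ℝ => |regularization α β γ₁ γ₂ Ψ Φ Υ₁ Υ₂ p.1 p.2
      - regularization α β γ₁ γ₂ Ψ Φ Υ₁ Υ₂ ε p.2|) (ε, x) := by
    have hd : ContinuousAt (fun p : ℝ × ℝ => p.2 / p.1) (ε, x) :=
      continuousAt_snd.div continuousAt_fst hε.ne'
    have hd' : ContinuousAt (fun p : ℝ × ℝ => p.2 / ε) (ε, x) :=
      continuousAt_snd.div continuousAt_const hε.ne'
    have hi : ∀ n : ℕ, ContinuousAt (fun p : ℝ × ℝ => (p.1 ^ n)⁻¹) (ε, x) := fun n =>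
      (continuousAt_fst.pow n).inv₀ (pow_ne_zero n hε.ne')
    have hi1 : ContinuousAt (fun p : ℝ × ℝ => p.1⁻¹) (ε, x) := continuousAt_fst.inv₀ hε.ne'
    have comp : ∀ {f : ℝ → ℝ}, Continuous f → ContinuousAt (fun p : ℝ × ℝ => f (p.2 / p.1)) (ε, x) :=
      fun hf => ContinuousAt.comp (g := _) hf.continuousAt hd
    have comp' : ∀ {f : ℝ → ℝ}, Continuous f → ContinuousAt (fun p : ℝ × ℝ => f (p.2 / ε)) (ε, x) :=
      fun hf => ContinuousAt.comp (g := _) hf.continuousAt hd'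
    unfold regularization
    refine ContinuousAt.abs (ContinuousAt.sub ?_ ?_)
    · exact ((((continuousAt_const.mul (hi 4)).mul (comp hΨ)).add
        ((continuousAt_const.mul (hi 3)).mul (comp hΦ))).add
        ((continuousAt_const.mul (hi 2)).mul (comp hΥ₁))).add
        ((continuousAt_const.mul hi1).mul (comp hΥ₂))
    · exact (((continuousAt_const.mul (comp' hΨ)).add (continuousAt_const.mul (comp' hΦ))).add
        (continuousAt_const.mul (comp' hΥ₁))).add (continuousAt_const.mul (comp' hΥ₂))
  have h0 : |regularization α β γ₁ γ₂ Ψ Φ Υ₁ Υ₂ ε x - regularization α β γ₁ γ₂ Ψ Φ Υ₁ Υ₂ ε x| < η := by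
    rwa [sub_self, abs_zero]
  exact hc.eventually_lt_const h0

/-- The support condition covers `|x| > 1` and continuity the points `±1`, which are needed because
the outer intervals are closed. -/
theorem IsShape.eq_zero {f : ℝ → ℝ} (hf : IsShape f) {x : ℝ} (hx : 1 ≤ |x|) : f x = 0 := by
  have hc := hf.smooth.continuous
  have hout : ∀ y : ℝ, 1 < |y| → f y = 0 := fun y hy => by
    by_contra hne
    have := hf.support (subset_tsupport f hne)
    exact absurd (abs_le.2 this) hy.not_ge
  have hcl : x ∈ closure {y : ℝ | 1 < |y|} := by
    rcases le_abs'.1 hx with h | h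
    · have h1 : Iio (-1 : ℝ) ⊆ {y : ℝ | 1 < |y|} := fun y (hy : y < -1) => by
        change 1 < |y|
        exact lt_abs.2 (Or.inr (by linarith))
      exact closure_mono h1 (by rw [closure_Iio]; exact h)
    · have h1 : Ioi (1 : ℝ) ⊆ {y : ℝ | 1 < |y|} := fun y (hy : 1 < y) => lt_abs.2 (Or.inl hy)
      exact closure_mono h1 (by rw [closure_Ioi]; exact h)
  have hclosed : IsClosed {y | f y = 0} := isClosed_eq hc continuous_const
  exact hclosed.closure_subset_iff.2 (fun y hy => hout y hy) hcl


/-! ### Construction of the matching data -/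

theorem IsLeftFamily.mono {p C C' : ℝ} (hp : p ≤ 0) {V : ℝ → ℝ} {l : (ℂ × ℂ) →ₗ[ℂ] (ℕ → ℝ → ℂ)}
    (h : IsLeftFamily p V l C) (hC : C ≤ C') : IsLeftFamily p V l C' where
  pos := h.pos.trans_le hC
  sol := h.sol
  zero := h.zero
  one := h.one
  le z x hx := (h.le z x hx).trans (by gcongr)
  lipschitz z x hx := (h.lipschitz z x hx).trans (by gcongr)
  norm_le z := (h.norm_le z).trans (mul_le_mul_of_nonneg_right hC
    (intervalIntegral.integral_nonneg hp fun _ _ => norm_nonneg _))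
  near s hs d hd h0 h1 := by
    obtain ⟨z, hz, hx⟩ := h.near s hs d hd h0 h1
    have hps : p ≤ s := by linarith [hs.1]
    have p1 : 0 ≤ ∫ t in p..s, ‖d 4 t + V t * d 0 t‖ :=
      intervalIntegral.integral_nonneg hps fun _ _ => norm_nonneg _
    have p2 : 0 ≤ ∫ t in p..s, ‖d 0 t‖ :=
      intervalIntegral.integral_nonneg hps fun _ _ => norm_nonneg _
    exact ⟨z, hz.trans (by gcongr), fun x hx' => (hx x hx').trans (by gcongr)⟩

theorem IsRightFamily.mono {q C C' : ℝ} (hq : 0 ≤ q) {V : ℝ → ℝ} {r : (ℂ × ℂ) →ₗ[ℂ] (ℕ → ℝ → ℂ)}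
    (h : IsRightFamily q V r C) (hC : C ≤ C') : IsRightFamily q V r C' where
  pos := h.pos.trans_le hC
  sol := h.sol
  zero := h.zero
  one := h.one
  le z x hx := (h.le z x hx).trans (by gcongr)
  lipschitz z x hx := (h.lipschitz z x hx).trans (by gcongr)
  norm_le z := (h.norm_le z).trans (mul_le_mul_of_nonneg_right hC
    (intervalIntegral.integral_nonneg hq fun _ _ => norm_nonneg _))
  near s hs d hd h0 h1 := by
    obtain ⟨z, hz, hx⟩ := h.near s hs d hd h0 h1
    have hsq : s ≤ q := by linarith [hs.2]
    have p1 : 0 ≤ ∫ t in s..q, ‖d 4 t + V t * d 0 t‖ :=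
      intervalIntegral.integral_nonneg hsq fun _ _ => norm_nonneg _
    have p2 : 0 ≤ ∫ t in s..q, ‖d 0 t‖ :=
      intervalIntegral.integral_nonneg hsq fun _ _ => norm_nonneg _
    exact ⟨z, hz.trans (by gcongr), fun x hx' => (hx x hx').trans (by gcongr)⟩

theorem IsInterfaceMap.mono {D : InnerData} {J : ((Fin 4 → ℂ) × (Fin 4 → ℂ)) →ₗ[ℂ] (Fin 4 → ℂ)}
    {C C' ε₀ ε₁ : ℝ} (h : IsInterfaceMap D J C ε₀) (hC : C ≤ C') (hε : ε₁ ≤ ε₀) :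
    IsInterfaceMap D J C' ε₁ where
  iff := h.iff
  isotropic := h.isotropic
  estimate ε Y d hd hεε := by
    obtain ⟨h1, h2⟩ := h.estimate ε Y d hd (hεε.trans_le hε)
    have hε0 := hd.pos
    have hY := hd.nonneg
    exact ⟨h1.trans (by gcongr), fun x hx => (h2 x hx).trans (by gcongr)⟩

theorem regularization_eq_zero {α β γ₁ γ₂ : ℝ} {Ψ Φ Υ₁ Υ₂ : ℝ → ℝ} (hΨ : IsShape Ψ)
    (hΦ : IsShape Φ) (hΥ₁ : IsShape Υ₁) (hΥ₂ : IsShape Υ₂) {ε x : ℝ} (hε : 0 < ε) (hx : ε ≤ |x|) :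
    regularization α β γ₁ γ₂ Ψ Φ Υ₁ Υ₂ ε x = 0 := by
  have h : 1 ≤ |x / ε| := by
    rw [abs_div, abs_of_pos hε]
    exact (one_le_div hε).2 hx
  simp [regularization, hΨ.eq_zero h, hΦ.eq_zero h, hΥ₁.eq_zero h, hΥ₂.eq_zero h]

theorem exists_isMatching (D : InnerData) {a b : ℝ} (ha : a < 0) (hb : 0 < b)
    (hQ : ContinuousOn D.Q (Icc a b)) (hΨ : IsShape D.Ψ) (hΦ : IsShape D.Φ) (hΥ₁ : IsShape D.Υ₁)
    (hΥ₂ : IsShape D.Υ₂) (hres : D.α ∈ resonantSet D.Ψ → NondegenerateResonance D.α D.Ψ) :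
    ∃ l r J C ε₀, IsMatching D a b l r J C ε₀ := by
  obtain ⟨l, C₁, hl⟩ := exists_isLeftFamily ha (hQ.mono (Icc_subset_Icc_right hb.le))
  obtain ⟨r, C₂, hr⟩ := exists_isRightFamily hb (hQ.mono (Icc_subset_Icc_left ha.le))
  obtain ⟨J, C₃, ε₀, hC₃, hε₀, hJ⟩ := exists_isInterfaceMap D hres
  have p1 := hl.pos
  have p2 := hr.pos
  have m1 : min (-a / 2) (min (b / 2) (min 1 (min D.r ε₀))) ≤ -a / 2 := min_le_left _ _
  have m2 : min (-a / 2) (min (b / 2) (min 1 (min D.r ε₀))) ≤ min (b / 2) (min 1 (min D.r ε₀)) :=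
    min_le_right _ _
  have m3 := m2.trans (min_le_right _ _)
  have m4 := m3.trans (min_le_right _ _)
  refine ⟨l, r, J, C₁ + C₂ + C₃, min (-a / 2) (min (b / 2) (min 1 (min D.r ε₀))), ha, hb, hQ, ?_, ?_,
    by positivity, hl.mono ha.le (by linarith), hr.mono hb.le (by linarith),
    hJ.mono (by linarith) (m4.trans (min_le_right _ _)),
    m1, m2.trans (min_le_left _ _), m3.trans (min_le_left _ _), m4.trans (min_le_left _ _)⟩
  · intro ε hε x hx
    rw [InnerData.potential, regularization_eq_zero hΨ hΦ hΥ₁ hΥ₂ hε hx, add_zero]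
  · have := D.r_pos
    exact lt_min (by linarith) (lt_min (by linarith) (lt_min one_pos (lt_min this hε₀)))


end FourthOrder


theorem theorem5 (a b : ℝ) (ha : a < 0) (hb : 0 < b)
    (U : ℝ → ℝ) (hU : ContDiffOn ℝ ∞ U (Set.Icc a b))
    (α β γ₁ γ₂ : ℝ) (Ψ Φ Υ₁ Υ₂ : ℝ → ℝ)
    (hΨ : IsShape Ψ) (hΦ : IsShape Φ) (hΥ₁ : IsShape Υ₁) (hΥ₂ : IsShape Υ₂)
    (hres : α ∈ resonantSet Ψ → NondegenerateResonance α Ψ)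
    (lam : ℝ) (v : L2 a b)
    (hlam : IsSimpleEigenvalue (limitOperator a b ha hb U α β Ψ Φ) lam)
    (hv : IsNormalizedEigenfunction (limitOperator a b ha hb U α β Ψ Φ) lam v) :
    ∃ (j : ℕ) (c₁ c₂ ε₀ : ℝ), 0 < ε₀ ∧ ∀ ε : ℝ, 0 < ε → ε < ε₀ →
      ∃ (lamε : ℝ) (yε : L2 a b),
        IsKthEigenvalue
          (perturbedOperator a b (ha.trans hb).le U α β γ₁ γ₂ Ψ Φ Υ₁ Υ₂ ε) j lamε ∧
        IsSimpleEigenvalue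
          (perturbedOperator a b (ha.trans hb).le U α β γ₁ γ₂ Ψ Φ Υ₁ Υ₂ ε) lamε ∧
        IsNormalizedEigenfunction
          (perturbedOperator a b (ha.trans hb).le U α β γ₁ γ₂ Ψ Φ Υ₁ Υ₂ ε) lamε yε ∧
        |lamε - lam| ≤ c₁ * ε ∧ ‖yε - v‖ ≤ c₂ * ε := by
  have hab : a ≤ b := (ha.trans hb).le
  have hUc : ContinuousOn U (Icc a b) := hU.continuousOn
  have cΨ := hΨ.smooth.continuous
  have cΦ := hΦ.smooth.continuous
  have cΥ₁ := hΥ₁.smooth.continuous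
  have cΥ₂ := hΥ₂.smooth.continuous
  have hQ : ContinuousOn (fun x => U x - lam) (Icc a b) := hUc.sub continuousOn_const
  -- The regular part is `U - lam`, so that the defect of `y` is `(S_ε - lam) y` and the outer
  -- families solve the limit eigenvalue equation.
  let D : InnerData :=
    { α := α, β := β, γ₁ := γ₁, γ₂ := γ₂, r := min (-a) b, Ψ := Ψ, Φ := Φ, Υ₁ := Υ₁, Υ₂ := Υ₂
      Q := fun x => U x - lam, cΨ := cΨ, cΦ := cΦ, cΥ₁ := cΥ₁, cΥ₂ := cΥ₂
      r_pos := lt_min (neg_pos.2 ha) hb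
      cQ := hQ.mono (Icc_subset_Icc (by linarith [min_le_left (-a) b]) (min_le_right _ _)) }
  obtain ⟨l, r, J, C, ε₀, h⟩ := exists_isMatching D ha hb hQ hΨ hΦ hΥ₁ hΥ₂ hres
  obtain ⟨⟨hvd, hve⟩, hv1⟩ := hv
  have hvmem : v ∈ eigenspace (limitOperator a b ha hb U α β Ψ Φ) lam := by
    change (v, (lam : ℂ) • v) ∈ (limitOperator a b ha hb U α β Ψ Φ).graph
    rw [← hve]
    exact LinearPMap.mem_graph _ ⟨v, hvd⟩
  have hv0 : v ≠ 0 := by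
    rintro rfl
    simp at hv1
  obtain ⟨ζ, hvζ, hJ, hker⟩ := h.exists_glue_eq (fun _ => rfl) hlam hvmem hv0
  obtain ⟨hl, hr⟩ := h.apply_zero hJ
  obtain ⟨K, hK, hest⟩ := h.exists_estimates (lam := lam) hl hr hJ hker hvζ hab
  have hV : ∀ ε, ContinuousOn (fun x => U x + regularization α β γ₁ γ₂ Ψ Φ Υ₁ Υ₂ ε x) (Icc a b) :=
    fun ε => hUc.add (D.continuous_regularization ε).continuousOn
  refine exists_isKthEigenvalue_near (perturbedOperator a b hab U α β γ₁ γ₂ Ψ Φ Υ₁ Υ₂)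
    h.ε₀_pos hK hv1 (fun ε _ _ => dirichletOperator_hasCompactResolvent (ha.trans hb) (hV ε))
    (fun ε hε hεε => ?_) (fun ε hε _ η hη => ?_)
  · have hVe : ∀ x, U x + regularization α β γ₁ γ₂ Ψ Φ Υ₁ Υ₂ ε x = D.potential ε x + lam := fun x => by
      simp only [InnerData.potential, D]
      ring
    exact ⟨fun y f hy => (hest ε hε hεε _ hVe y f hy).1, fun y f hy => (hest ε hε hεε _ hVe y f hy).2⟩
  · filter_upwards [eventually_abs_regularization_sub_le (α := α) (β := β) (γ₁ := γ₁) (γ₂ := γ₂)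
      cΨ cΦ cΥ₁ cΥ₂ (a := a) (b := b) hε hη] with ε' hε'
    refine ⟨fun u h' hu => dirichletOperator_form_le hab (hV ε) (hV ε') (fun x hx => ?_) hu,
      fun u h' hu => dirichletOperator_form_le hab (hV ε') (hV ε) (fun x hx => ?_) hu⟩
    · linarith [(abs_lt.1 (hε' x hx)).1]
    · linarith [(abs_lt.1 (hε' x hx)).2]
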